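/- All graphs are finite, simple and undirected. For a graph $G$ and a subgraph $H$ of $G$, let $\mathrm{BBC}_2(G,H)$ be the least $k$ for which $G$ has a proper colouring $c:V(G)\to\{1,\dots,k\}$ with $|c(u)-c(v)|\ge 2$ for every edge $uv$ of $H$. Let $\mathrm{Mad}(H)=\max_{H'\subseteq H} \frac{2|E(H')|}{|V(H')|}$, the maximum being over the subgraphs $H'$ of $H$ with at least one vertex ($0$ if $H$ has no vertex), and let $\mathrm{tw}(G)$ be the treewidth of $G$, that is, the minimum over all tree-decompositions of $G$ of the maximum bag size minus one. Then the following hold. 1. There is an absolute constant $C$ such that, for every graph $G$ and every subgraph $H$ of $G$ with at least one edge, $$\mathrm{BBC}_2(G,H)\le \mathrm{tw}(G)+C\sqrt{\mathrm{Mad}(H)\cdot \mathrm{tw}(G)};$$ if $H$ has no edge, then $\mathrm{BBC}_2(G,H)\le \mathrm{tw}(G)+1$. 2. For every graph $G$ and every subgraph $H$ of $G$ that does not contain the 4-cycle $C_4$ as a (not necessarily induced) subgraph, $$\mathrm{BBC}_2(G,H)\le \tfrac32\,\mathrm{tw}(G)+\tfrac{11}{2}.$$ -/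

import Mathlib

namespace SimpleGraph

/-- `(G, H)` has a `q`-backbone `k`-colouring: a proper colouring `c` of `G` with `k` colours
(the integers `0, …, k - 1`) such that `|c u - c v| ≥ q` for every edge `uv` of `H`. -/
def BackboneColorable {V : Type*} (G : SimpleGraph V) (H : G.Subgraph) (q k : ℕ) : Prop :=
  ∃ c : G.Coloring (Fin k), ∀ u v : V, H.Adj u v →
    (q : ℤ) ≤ |(((c u : Fin k) : ℕ) : ℤ) - (((c v : Fin k) : ℕ) : ℤ)|

/-- The `q`-backbone chromatic number of `(G, H)`: the least `k` for which `(G, H)` has a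
`q`-backbone `k`-colouring (there is such a `k` whenever `G` is finite). -/
noncomputable def backboneChromaticNumber {V : Type*} (G : SimpleGraph V) (H : G.Subgraph)
    (q : ℕ) : ℕ :=
  sInf {k : ℕ | G.BackboneColorable H q k}

/-- The average degree `2 |E(H)| / |V(H)|` of a finite graph (`0` if there is no vertex). -/
noncomputable def Subgraph.averageDegree {V : Type*} {G : SimpleGraph V} (H : G.Subgraph) : ℝ :=
  2 * (H.edgeSet.ncard : ℝ) / (H.verts.ncard : ℝ)

/-- The maximum average degree of a finite graph: the maximum of the average degrees of its
subgraphs. The subgraph without vertices contributes the value `0`, which does not affect the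
maximum as average degrees are nonnegative. -/
noncomputable def Subgraph.maximumAverageDegree {V : Type*} {G : SimpleGraph V}
    (H : G.Subgraph) : ℝ :=
  ⨆ K : {K : G.Subgraph // K ≤ H}, K.1.averageDegree

/-- A tree-decomposition of the graph `G`, over a finite tree. -/
structure TreeDecomposition {V : Type*} (G : SimpleGraph V) where
  /-- the nodes of the tree -/
  ι : Type
  finite_nodes : Finite ι
  /-- the tree -/
  tree : SimpleGraph ι
  isTree : tree.IsTree
  /-- the bags -/
  bag : ι → Set V
  iUnion_bag : ⋃ i, bag i = Set.univ
  exists_bag_of_adj : ∀ x y : V, G.Adj x y → ∃ i, x ∈ bag i ∧ y ∈ bag i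
  connected_nodes : ∀ v : V, (tree.induce {i | v ∈ bag i}).Connected

/-- The width of a tree-decomposition: the maximum of `|B| - 1` over all bags `B`. -/
noncomputable def TreeDecomposition.width {V : Type*} {G : SimpleGraph V}
    (D : G.TreeDecomposition) : ℤ :=
  ⨆ i : D.ι, (((D.bag i).ncard : ℤ) - 1)

/-- The treewidth of a finite graph: the minimum width of a tree-decomposition. It is an integer,
equal to `-1` for the graph without vertices. -/
noncomputable def treewidth {V : Type*} (G : SimpleGraph V) : ℤ :=
  ⨅ D : G.TreeDecomposition, D.width

end SimpleGraph

open Finset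

set_option linter.unusedSectionVars false

/-! Let `k` be the treewidth. A rooted tree-decomposition embeds `G` in a graph with a perfect
elimination order in which every vertex has at most `k` later neighbours (`exists_isElim`). Adding
edges to `G` only makes colouring harder, so `G` may be replaced by this graph. If `M` colours do
not suffice, one passes to an induced pair that is critical.

The engine is a list colouring lemma, `exists_isListCol_of_order`. Handing out colours in increasing
order makes an uncoloured edge of `H` cost one extra colour per endpoint. Colour the outside of a
set `Q`. Then a vertex of `Q` keeps at least its excess plus its `G`-degree and its `H`-degree in
`Q` many colours. If this does not suffice, some nonempty `J ⊆ Q` is stuck: excess plus number of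
`G`-neighbours in `Q \ J` is at most `0` at each vertex of `J`. Deleting a stuck set does not lower
the total excess, so the total excess of every nonempty set is at most `0` in a critical pair
(`IsCritical.pot_nonpos`). This bounds `M` by degree sums.

For part 1, singletons give `M ≤ deg_G + 2 deg_H` at every vertex. One averages this over a block
`S`: a union of sets of descendants with about `√(Mad · k)` vertices and at most `k + 1` outer
neighbours, or none.

For part 2, the absence of 4-cycles means that two vertices have at most one common `H`-neighbour,
so a small set sends few edges of `H` to its outer neighbours. With `M = k + D` and `D = ⌊(k + 11) /
2⌋`, counting on blocks of at most three vertices, and of seven in one case, produces a vertex `p`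
with exactly four descendants (`IsElim.exists_card_desc_eq_four`). On these four, counting almost
refutes criticality. What survives is that `H` is a perfect matching there and that `G` is complete,
a diamond (one edge missing) or a paw (two missing at one vertex).

These cases need the gain: a colour forbidden twice, or out of range, lengthens a list by one. In
the tight case the later neighbours of `p` form a clique with `k ≥ M / 2` distinct colours. So an
extreme colour or two consecutive ones occur there, which gives a gain when neighbourhoods are
nested. Nestedness fails only for some diamonds; there a missing gain forces `k = D = 10`, and the
four vertices are coloured by hand. -/

namespace Backbone

/-! ### Greedy list colouring with a backbone -/

section ListColouring

variable {V : Type*} [DecidableEq V]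

/-- The number of neighbours of `v` in the set `K`. -/
def degIn (G : SimpleGraph V) [DecidableRel G.Adj] (K : Finset V) (v : V) : ℕ :=
  #{w ∈ K | G.Adj v w}

/-- `c` colours the vertices of `Q` from the lists `L`, properly for `G` and with distance at
least two along the edges of `H`. -/
structure IsListCol (G H : SimpleGraph V) (Q : Finset V) (L : V → Finset ℤ) (c : V → ℤ) :
    Prop where
  mem : ∀ v ∈ Q, c v ∈ L v
  ne : ∀ u ∈ Q, ∀ v ∈ Q, G.Adj u v → c u ≠ c v
  dist : ∀ u ∈ Q, ∀ v ∈ Q, H.Adj u v → 2 ≤ |c u - c v|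

variable {G H : SimpleGraph V} [DecidableRel G.Adj] [DecidableRel H.Adj]

lemma degIn_mono {K K' : Finset V} (h : K ⊆ K') (v : V) : degIn G K v ≤ degIn G K' v :=
  card_le_card (filter_subset_filter _ h)

lemma degIn_add_sdiff {K K' : Finset V} (h : K ⊆ K') (v : V) :
    degIn G K v + degIn G (K' \ K) v = degIn G K' v := by
  unfold degIn
  rw [← card_union_of_disjoint, ← filter_union, union_sdiff_of_subset h]
  exact disjoint_filter_filter disjoint_sdiff

lemma degIn_add_compl [Fintype V] (K : Finset V) (v : V) :
    degIn G K v + degIn G Kᶜ v = degIn G univ v := by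
  rw [compl_eq_univ_sdiff, degIn_add_sdiff (subset_univ K)]

lemma degIn_le_of_le (hHG : H ≤ G) (K : Finset V) (v : V) : degIn H K v ≤ degIn G K v :=
  card_le_card fun w hw => by
    simp only [mem_filter] at hw ⊢
    exact ⟨hw.1, hHG hw.2⟩

/-- Greedy list colouring along an order, one colour after the other. -/
lemma exists_isListCol_of_order (hHG : H ≤ G) (r : V → ℕ) (n : ℕ) :
    ∀ (Q : Finset V) (L : V → Finset ℤ), #Q = n → Set.InjOn r Q →
    (∀ i ∈ Q, #{j ∈ Q | G.Adj i j ∧ r j < r i} + degIn H Q i + 1 ≤ #(L i)) →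
    ∃ c, IsListCol G H Q L c := by
  induction n with
  | zero =>
    intro Q L hQ _ _
    rw [card_eq_zero] at hQ
    subst hQ
    exact ⟨0, ⟨by simp, by simp, by simp⟩⟩
  | succ n ih =>
    intro Q L hQ hr hL
    have hQne : Q.Nonempty := card_pos.1 (by omega)
    have hUne : (Q.biUnion L).Nonempty := by
      obtain ⟨i, hi⟩ := hQne
      have := hL i hi
      obtain ⟨a, ha⟩ := card_pos.1 (show 0 < #(L i) by omega)
      exact ⟨a, mem_biUnion.2 ⟨i, hi, ha⟩⟩
    -- The smallest available colour is used first. All other colours are at least `m`, so an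
    -- `H`-neighbour of the vertex coloured `m` only has to avoid `m` and `m + 1`, never `m - 1`.
    set m := (Q.biUnion L).min' hUne with hm
    have hmin : ∀ i ∈ Q, ∀ a ∈ L i, m ≤ a := fun i hi a ha =>
      min'_le _ _ (mem_biUnion.2 ⟨i, hi, ha⟩)
    have hAne : ({i ∈ Q | m ∈ L i}).Nonempty := by
      obtain ⟨i, hi, h⟩ := mem_biUnion.1 (min'_mem _ hUne)
      exact ⟨i, by simp only [mem_filter]; exact ⟨hi, h⟩⟩
    obtain ⟨i₀, hi₀, hfirst⟩ := exists_min_image _ r hAne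
    rw [mem_filter] at hi₀
    obtain ⟨hi₀Q, hmi₀⟩ := hi₀
    let L' : V → Finset ℤ := fun j =>
      (L j \ (if G.Adj i₀ j then {m} else ∅)) \ (if H.Adj i₀ j then {m + 1} else ∅)
    obtain ⟨c, hc⟩ := ih (Q.erase i₀) L' (by rw [card_erase_of_mem hi₀Q]; omega)
      (hr.mono (by simp)) (by
        intro j hj
        have hjQ := mem_of_mem_erase hj
        have hne := ne_of_mem_erase hj
        -- Since `i₀` comes first among the vertices with `m` in their lists, a neighbour that
        -- really loses `m` also loses an earlier neighbour. The loss of `m + 1` is paid by the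
        -- `H`-degree in `h2`.
        have h1 : #{j' ∈ Q.erase i₀ | G.Adj j j' ∧ r j' < r j} +
            #(L j ∩ (if G.Adj i₀ j then {m} else ∅)) ≤ #{j' ∈ Q | G.Adj j j' ∧ r j' < r j} := by
          by_cases h : G.Adj i₀ j ∧ m ∈ L j
          · have hlt : r i₀ < r j := lt_of_le_of_ne (hfirst j (by simp [hjQ, h.2]))
              (fun e => hne (hr hjQ hi₀Q e.symm))
            have : #(L j ∩ (if G.Adj i₀ j then {m} else ∅)) ≤ 1 := by
              rw [if_pos h.1]
              exact (card_le_card inter_subset_right).trans (by simp)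
            have h2 : #{j' ∈ Q.erase i₀ | G.Adj j j' ∧ r j' < r j} <
                #{j' ∈ Q | G.Adj j j' ∧ r j' < r j} := by
              apply card_lt_card
              rw [ssubset_iff_of_subset (filter_subset_filter _ (erase_subset _ _))]
              exact ⟨i₀, by simp [hi₀Q, h.1.symm, hlt], by simp⟩
            omega
          · have : L j ∩ (if G.Adj i₀ j then {m} else ∅) = ∅ := by
              by_cases h' : G.Adj i₀ j
              · rw [if_pos h']
                exact inter_singleton_of_notMem fun hm => h ⟨h', hm⟩
              · simp [h']
            rw [this, card_empty, add_zero]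
            exact card_le_card (filter_subset_filter _ (erase_subset _ _))
        have h2 : degIn H (Q.erase i₀) j + #((if H.Adj i₀ j then {m + 1} else ∅ : Finset ℤ)) ≤
            degIn H Q j := by
          by_cases h : H.Adj i₀ j
          · rw [if_pos h, card_singleton]
            apply Nat.succ_le_of_lt
            apply card_lt_card
            rw [ssubset_iff_of_subset (filter_subset_filter _ (erase_subset _ _))]
            exact ⟨i₀, by simp [hi₀Q, h.symm], by simp⟩
          · rw [if_neg h, card_empty, add_zero]
            exact degIn_mono (erase_subset _ _) j
        have h3 := hL j hjQ
        have h4 : #(L j) ≤ #(L' j) + #(L j ∩ (if G.Adj i₀ j then {m} else ∅)) +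
            #((if H.Adj i₀ j then {m + 1} else ∅ : Finset ℤ)) := by
          have e1 := card_sdiff_add_card_inter (L j) (if G.Adj i₀ j then {m} else ∅)
          have e2 := le_card_sdiff (if H.Adj i₀ j then {m + 1} else ∅)
            (L j \ (if G.Adj i₀ j then {m} else ∅))
          simp only [L']
          omega
        omega)
    have hL' : ∀ j ∈ Q.erase i₀, c j ∈ L j ∧ (G.Adj i₀ j → c j ≠ m) ∧
        (H.Adj i₀ j → c j ≠ m + 1) := by
      intro j hj
      have := hc.mem j hj
      simp only [L', mem_sdiff] at this
      refine ⟨this.1.1, fun h => ?_, fun h => ?_⟩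
      · have := this.1.2
        simpa [h] using this
      · have := this.2
        simpa [h] using this
    have hdist : ∀ j ∈ Q.erase i₀, H.Adj i₀ j → 2 ≤ c j - m := by
      intro j hj h
      obtain ⟨h1, h2, h3⟩ := hL' j hj
      have h4 := hmin j (mem_of_mem_erase hj) _ h1
      have h5 := h2 (hHG h)
      have h6 := h3 h
      omega
    refine ⟨Function.update c i₀ m, ⟨?_, ?_, ?_⟩⟩
    · intro v hv
      by_cases h : v = i₀
      · subst h; simpa using hmi₀
      · rw [Function.update_of_ne h]
        exact (hL' v (mem_erase.2 ⟨h, hv⟩)).1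
    · intro u hu v hv huv
      by_cases h : u = i₀
      · subst h
        have hv' : v ≠ u := huv.ne'
        rw [Function.update_self, Function.update_of_ne hv']
        exact ((hL' v (mem_erase.2 ⟨hv', hv⟩)).2.1 huv).symm
      · by_cases h' : v = i₀
        · subst h'
          rw [Function.update_self, Function.update_of_ne h]
          exact (hL' u (mem_erase.2 ⟨h, hu⟩)).2.1 huv.symm
        · rw [Function.update_of_ne h, Function.update_of_ne h']
          exact hc.ne u (mem_erase.2 ⟨h, hu⟩) v (mem_erase.2 ⟨h', hv⟩) huv
    · intro u hu v hv huv
      by_cases h : u = i₀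
      · subst h
        have hv' : v ≠ u := huv.ne'
        rw [Function.update_self, Function.update_of_ne hv', abs_sub_comm]
        exact (hdist v (mem_erase.2 ⟨hv', hv⟩) huv).trans (le_abs_self _)
      · by_cases h' : v = i₀
        · subst h'
          rw [Function.update_self, Function.update_of_ne h]
          exact (hdist u (mem_erase.2 ⟨h, hu⟩) huv.symm).trans (le_abs_self _)
        · rw [Function.update_of_ne h, Function.update_of_ne h']
          exact hc.dist u (mem_erase.2 ⟨h, hu⟩) v (mem_erase.2 ⟨h', hv⟩) huv

/-- A vertex of small degree in the whole set is placed last, with a rank above all others, and the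
rest is ordered by induction. -/
lemma exists_order_of_degenerate (a : V → ℕ) (n : ℕ) : ∀ (Q : Finset V), #Q = n →
    (∀ K ⊆ Q, K.Nonempty → ∃ i ∈ K, degIn G K i ≤ a i) →
    ∃ r : V → ℕ, Set.InjOn r Q ∧ ∀ i ∈ Q, #{j ∈ Q | G.Adj i j ∧ r j < r i} ≤ a i := by
  induction n with
  | zero =>
    intro Q hQ _
    rw [card_eq_zero] at hQ
    subst hQ
    exact ⟨fun _ => 0, by simp, by simp⟩
  | succ n ih =>
    intro Q hQ h
    obtain ⟨i, hi, hdeg⟩ := h Q subset_rfl (card_pos.1 (by omega))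
    obtain ⟨r, hr, hra⟩ := ih (Q.erase i) (by rw [card_erase_of_mem hi]; omega)
      fun K hK hne => h K (hK.trans (erase_subset _ _)) hne
    have hb : ∀ j ∈ Q.erase i, r j < (Q.erase i).sup r + 1 := fun j hj =>
      Nat.lt_succ_of_le (le_sup (f := r) hj)
    set b := (Q.erase i).sup r + 1
    have hval : ∀ j ∈ Q, j ≠ i → Function.update r i b j = r j ∧ r j < b := fun j hj hne =>
      ⟨Function.update_of_ne hne _ _, hb j (mem_erase.2 ⟨hne, hj⟩)⟩
    refine ⟨Function.update r i b, ?_, ?_⟩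
    · intro u hu v hv huv
      by_cases h1 : u = i
      · by_cases h2 : v = i
        · rw [h1, h2]
        · have := hval v hv h2
          rw [this.1, h1, Function.update_self] at huv
          omega
      · have h1' := hval u hu h1
        by_cases h2 : v = i
        · rw [h1'.1, h2, Function.update_self] at huv
          omega
        · have := hval v hv h2
          rw [h1'.1, this.1] at huv
          exact hr (mem_coe.2 (mem_erase.2 ⟨h1, hu⟩)) (mem_coe.2 (mem_erase.2 ⟨h2, hv⟩)) huv
    · intro j hj
      by_cases h1 : j = i
      · subst h1
        refine le_trans (card_le_card fun w hw => ?_) hdeg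
        simp only [mem_filter] at hw ⊢
        exact ⟨hw.1, hw.2.1⟩
      · have h1' := hval j hj h1
        refine le_trans (card_le_card fun w hw => ?_) (hra j (mem_erase.2 ⟨h1, hj⟩))
        simp only [mem_filter, mem_erase] at hw ⊢
        by_cases h2 : w = i
        · rw [h1'.1, h2, Function.update_self] at hw
          omega
        · rw [h1'.1, (hval w hw.1 h2).1] at hw
          exact ⟨⟨h2, hw.1⟩, hw.2⟩

/-- List colouring with lists that are large compared to a degeneracy order. -/
lemma exists_isListCol_of_degenerate (hHG : H ≤ G) {Q : Finset V} {L : V → Finset ℤ}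
    (h : ∀ K ⊆ Q, K.Nonempty → ∃ i ∈ K, degIn G K i + degIn H Q i + 1 ≤ #(L i)) :
    ∃ c, IsListCol G H Q L c := by
  -- The hypothesis for singletons; it makes the truncated subtraction below exact.
  have hpos : ∀ i ∈ Q, degIn H Q i + 1 ≤ #(L i) := by
    intro i hi
    obtain ⟨j, hj, h1⟩ := h {i} (by simpa using hi) (by simp)
    rw [mem_singleton] at hj
    subst hj
    omega
  obtain ⟨r, hr, hra⟩ := exists_order_of_degenerate (G := G)
    (fun i => #(L i) - (degIn H Q i + 1)) _ Q rfl (by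
      intro K hK hne
      obtain ⟨i, hi, h1⟩ := h K hK hne
      exact ⟨i, hi, by omega⟩)
  exact exists_isListCol_of_order hHG r _ Q L rfl hr fun i hi => by
    have := hra i hi
    have := hpos i hi
    omega

end ListColouring

end Backbone

namespace Backbone

/-! ### Excess, potential and stuck sets -/

section Potential

variable {V : Type*} [DecidableEq V] [Fintype V]

/-- The vertices of `S` can be coloured with the colours `0, …, M - 1`. -/
def Colorable (G H : SimpleGraph V) (M : ℤ) (S : Finset V) : Prop :=
  ∃ c, IsListCol G H S (fun _ => Ico 0 M) c

/-- The colours left at `i` when the vertices outside `Q` are coloured by `φ`. -/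
noncomputable def resid (G H : SimpleGraph V) [DecidableRel G.Adj] [DecidableRel H.Adj] (M : ℤ) (Q : Finset V)
    (φ : V → ℤ) (i : V) : Finset ℤ :=
  Ico 0 M \ ({w ∈ Qᶜ | G.Adj i w}.image φ ∪
    ({w ∈ Qᶜ | H.Adj i w}.image (fun w => φ w + 1) ∪
      {w ∈ Qᶜ | H.Adj i w}.image (fun w => φ w - 1)))

/-- The number of colours guaranteed at `i`, as soon as the outside of `S` is coloured, beyond
the numbers of `G`-neighbours and `H`-neighbours in `S`. -/
def excess (G H : SimpleGraph V) [DecidableRel G.Adj] [DecidableRel H.Adj] (M : ℤ) (S : Finset V)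
    (i : V) : ℤ :=
  M - degIn G univ i - 2 * degIn H univ i + degIn H S i

/-- The total excess of a set. -/
def pot (G H : SimpleGraph V) [DecidableRel G.Adj] [DecidableRel H.Adj] (M : ℤ) (S : Finset V) :
    ℤ :=
  ∑ i ∈ S, excess G H M S i

/-- A pair of graphs that is not colourable although all its proper induced subgraphs are. -/
structure IsCritical (G H : SimpleGraph V) (M : ℤ) : Prop where
  le : H ≤ G
  colorable : ∀ S : Finset V, S ≠ univ → Colorable G H M S
  not_colorable : ¬ Colorable G H M univ

variable {G H : SimpleGraph V} [DecidableRel G.Adj] [DecidableRel H.Adj] {M : ℤ}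

lemma IsListCol.mono {Q Q' : Finset V} {L : V → Finset ℤ} {c : V → ℤ}
    (h : IsListCol G H Q L c) (hQ : Q' ⊆ Q) : IsListCol G H Q' L c :=
  ⟨fun v hv => h.mem v (hQ hv), fun u hu v hv => h.ne u (hQ hu) v (hQ hv),
    fun u hu v hv => h.dist u (hQ hu) v (hQ hv)⟩

/-- A colouring of the outside of `Q` extends by a list colouring of `Q`. -/
lemma colorable_of_resid (hHG : H ≤ G) {Q : Finset V} {φ c : V → ℤ}
    (hφ : IsListCol G H Qᶜ (fun _ => Ico 0 M) φ)
    (hc : IsListCol G H Q (resid G H M Q φ) c) : Colorable G H M univ := by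
  have hmix : ∀ u ∈ Q, ∀ v, v ∉ Q → (G.Adj u v → c u ≠ φ v) ∧ (H.Adj u v → 2 ≤ |c u - φ v|) := by
    intro u hu v hv
    have h := hc.mem u hu
    simp only [resid, mem_sdiff, mem_union, mem_image, mem_filter, mem_compl, not_or,
      not_exists, not_and] at h
    obtain ⟨-, h1, h2, h3⟩ := h
    refine ⟨fun hG e => h1 v ⟨hv, hG⟩ e.symm, fun hH => ?_⟩
    have e1 := h1 v ⟨hv, hHG hH⟩
    have e2 := h2 v ⟨hv, hH⟩
    have e3 := h3 v ⟨hv, hH⟩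
    rw [le_abs]
    omega
  refine ⟨fun v => if v ∈ Q then c v else φ v, ?_, ?_, ?_⟩
  · intro v _
    by_cases h : v ∈ Q
    · simp only [h, if_true]
      exact (mem_sdiff.1 (hc.mem v h)).1
    · simp only [h, if_false]
      exact hφ.mem v (by simpa using h)
  · intro u _ v _ huv
    by_cases h : u ∈ Q <;> by_cases h' : v ∈ Q <;> simp only [h, h', if_true, if_false]
    · exact hc.ne u h v h' huv
    · exact (hmix u h v h').1 huv
    · exact ((hmix v h' u h).1 huv.symm).symm
    · exact hφ.ne u (by simpa using h) v (by simpa using h') huv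
  · intro u _ v _ huv
    by_cases h : u ∈ Q <;> by_cases h' : v ∈ Q <;> simp only [h, h', if_true, if_false]
    · exact hc.dist u h v h' huv
    · exact (hmix u h v h').2 huv
    · rw [abs_sub_comm]
      exact (hmix v h' u h).2 huv.symm
    · exact hφ.dist u (by simpa using h) v (by simpa using h') huv

/-- A coloured `G`-neighbour forbids one colour and a coloured `H`-neighbour two more. Writing the
outer degrees as total minus inner degrees gives the stated form. -/
lemma card_resid (hM : 0 ≤ M) (Q : Finset V) (φ : V → ℤ) (i : V) :
    excess G H M Q i + degIn G Q i + degIn H Q i ≤ #(resid G H M Q φ i) := by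
  have h1 := degIn_add_compl (G := G) Q i
  have h2 := degIn_add_compl (G := H) Q i
  have h3 := le_card_sdiff ({w ∈ Qᶜ | G.Adj i w}.image φ ∪
    ({w ∈ Qᶜ | H.Adj i w}.image (fun w => φ w + 1) ∪
      {w ∈ Qᶜ | H.Adj i w}.image (fun w => φ w - 1))) (Ico 0 M)
  have h4 := card_union_le ({w ∈ Qᶜ | G.Adj i w}.image φ)
    ({w ∈ Qᶜ | H.Adj i w}.image (fun w => φ w + 1) ∪
      {w ∈ Qᶜ | H.Adj i w}.image (fun w => φ w - 1))
  have h5 := card_union_le ({w ∈ Qᶜ | H.Adj i w}.image (fun w => φ w + 1))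
      ({w ∈ Qᶜ | H.Adj i w}.image (fun w => φ w - 1))
  have h6 : #({w ∈ Qᶜ | G.Adj i w}.image φ) ≤ degIn G Qᶜ i := card_image_le
  have h7 : #({w ∈ Qᶜ | H.Adj i w}.image (fun w => φ w + 1)) ≤ degIn H Qᶜ i := card_image_le
  have h8 : #({w ∈ Qᶜ | H.Adj i w}.image (fun w => φ w - 1)) ≤ degIn H Qᶜ i := card_image_le
  have h9 : (#(Ico 0 M) : ℤ) = M := by simp [hM]
  unfold resid excess
  omega

/-- The list at `i` is longer by one if two of the forbidden colours coincide or a forbidden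
colour is out of range. -/
lemma card_resid_of_gain (hM : 0 ≤ M) (Q : Finset V) (φ : V → ℤ) (i : V) {y : V} (hy : y ∉ Q)
    (hiy : H.Adj i y) (ε : ℤ) (hε : ε = 1 ∨ ε = -1)
    (h : φ y + ε ∉ Ico 0 M ∨ ∃ z, z ∉ Q ∧ G.Adj i z ∧ φ z = φ y + ε) :
    excess G H M Q i + degIn G Q i + degIn H Q i + 1 ≤ #(resid G H M Q φ i) := by
  have h1 := degIn_add_compl (G := G) Q i
  have h2 := degIn_add_compl (G := H) Q i
  set B : Finset V := {w ∈ Qᶜ | H.Adj i w}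
  have hyB : y ∈ B := by simp [B, hy, hiy]
  have hB : #(B.erase y) + 1 = degIn H Qᶜ i := card_erase_add_one hyB
  set A : Finset ℤ := {w ∈ Qᶜ | G.Adj i w}.image φ
  have hsub : Ico 0 M \ (A ∪ (B.image (fun w => φ w - ε) ∪
      (B.erase y).image (fun w => φ w + ε))) ⊆ resid G H M Q φ i := by
    intro a ha
    simp only [resid, mem_sdiff, mem_union, not_or] at ha ⊢
    obtain ⟨h0, hA, hm, hp⟩ := ha
    have hp' : a ∉ B.image (fun w => φ w + ε) := by
      intro hmem
      obtain ⟨w, hw, rfl⟩ := mem_image.1 hmem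
      by_cases hwy : w = y
      · subst hwy
        rcases h with h | ⟨z, hz, hiz, e⟩
        · exact h h0
        · exact hA (mem_image.2 ⟨z, by simp [hz, hiz], e⟩)
      · exact hp (mem_image.2 ⟨w, mem_erase.2 ⟨hwy, hw⟩, rfl⟩)
    refine ⟨h0, hA, ?_⟩
    rcases hε with rfl | rfl
    · exact ⟨hp', hm⟩
    · simp only [sub_neg_eq_add] at hm
      simp only [← sub_eq_add_neg] at hp'
      exact ⟨hm, hp'⟩
  have h0 := card_le_card hsub
  have h3 := le_card_sdiff (A ∪ (B.image (fun w => φ w - ε) ∪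
      (B.erase y).image (fun w => φ w + ε))) (Ico 0 M)
  have h4 := card_union_le A (B.image (fun w => φ w - ε) ∪
      (B.erase y).image (fun w => φ w + ε))
  have h5 := card_union_le (B.image (fun w => φ w - ε)) ((B.erase y).image (fun w => φ w + ε))
  have h6 : #A ≤ degIn G Qᶜ i := card_image_le
  have h7 : #(B.image (fun w => φ w - ε)) ≤ degIn H Qᶜ i := card_image_le
  have h8 : #((B.erase y).image (fun w => φ w + ε)) ≤ #(B.erase y) := card_image_le
  have h9 : (#(Ico 0 M) : ℤ) = M := by simp [hM]
  unfold excess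
  omega

/-- If the lists do not suffice, some nonempty set has small excesses. -/
lemma exists_stuck (hHG : H ≤ G) {Q : Finset V} {φ : V → ℤ} {t : V → ℤ}
    (hφ : IsListCol G H Qᶜ (fun _ => Ico 0 M) φ) (hbad : ¬ Colorable G H M univ)
    (ht : ∀ i ∈ Q, t i + degIn G Q i + degIn H Q i ≤ #(resid G H M Q φ i)) :
    ∃ J ⊆ Q, J.Nonempty ∧ ∀ i ∈ J, t i + degIn G (Q \ J) i ≤ 0 := by
  by_contra! hcon
  refine hbad ?_
  obtain ⟨c, hc⟩ := exists_isListCol_of_degenerate (L := resid G H M Q φ) (Q := Q) hHG (by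
    intro K hK hne
    obtain ⟨i, hi, h⟩ := hcon K hK hne
    have := degIn_add_sdiff (G := G) hK i
    have := ht i (hK hi)
    exact ⟨i, hi, by omega⟩)
  exact colorable_of_resid hHG hφ hc

lemma sum_degIn_comm (A B : Finset V) : ∑ i ∈ A, degIn G B i = ∑ i ∈ B, degIn G A i := by
  simp only [degIn, card_filter]
  rw [sum_comm]
  simp only [G.adj_comm]

/-- Each remaining vertex loses its number of `H`-neighbours in `J` from its excess; these losses
are counted from the side of `J`. -/
lemma pot_sdiff {J S : Finset V} (hJ : J ⊆ S) :
    pot G H M (S \ J) = pot G H M S - ∑ i ∈ J, excess G H M S i - ∑ i ∈ J, (degIn H (S \ J) i : ℤ)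
    := by
  have h1 : pot G H M S = ∑ i ∈ S \ J, excess G H M S i + ∑ i ∈ J, excess G H M S i :=
    (sum_sdiff hJ).symm
  have h2 : ∑ i ∈ J, (degIn H (S \ J) i : ℤ) = ∑ i ∈ S \ J, (degIn H J i : ℤ) := by
    exact_mod_cast sum_degIn_comm J (S \ J)
  have h3 : pot G H M (S \ J) =
      ∑ i ∈ S \ J, excess G H M S i - ∑ i ∈ S \ J, (degIn H J i : ℤ) := by
    rw [pot, ← sum_sub_distrib]
    refine sum_congr rfl fun i _ => ?_
    have := degIn_add_sdiff (G := H) hJ i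
    unfold excess
    omega
  rw [h1, h2, h3]
  ring

/-- The number of edges of `G` that are not in `H` between two sets. -/
def cross (G H : SimpleGraph V) [DecidableRel G.Adj] [DecidableRel H.Adj] (J K : Finset V) : ℤ :=
  ∑ i ∈ J, ((degIn G K i : ℤ) - degIn H K i)

lemma cross_nonneg (hHG : H ≤ G) (J K : Finset V) : 0 ≤ cross G H J K :=
  sum_nonneg fun i _ => by
    have := degIn_le_of_le hHG K i
    omega

/-- Deleting `J` removes a total excess that is at most minus the number of `G`-edges of the cut,
and costs one for each `H`-edge of the cut. The balance is the number of cut edges outside of the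
backbone. -/
lemma pot_sdiff_ge {J S : Finset V} (hJ : J ⊆ S)
    (h : ∀ i ∈ J, excess G H M S i + degIn G (S \ J) i ≤ 0) :
    pot G H M S + cross G H J (S \ J) ≤ pot G H M (S \ J) := by
  rw [pot_sdiff hJ]
  have := sum_le_sum h
  simp only [sum_add_distrib, sum_const_zero] at this
  rw [cross, sum_sub_distrib]
  linarith

lemma IsCritical.exists_coloring (h : IsCritical G H M) {Q : Finset V} (hQ : Q.Nonempty) :
    ∃ φ, IsListCol G H Qᶜ (fun _ => Ico 0 M) φ :=
  h.colorable _ (by simpa [compl_eq_univ_iff] using hQ.ne_empty)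

lemma IsCritical.exists_stuck (h : IsCritical G H M) (hM : 0 ≤ M) {Q : Finset V}
    (hQ : Q.Nonempty) :
    ∃ J ⊆ Q, J.Nonempty ∧ ∀ i ∈ J, excess G H M Q i + degIn G (Q \ J) i ≤ 0 := by
  obtain ⟨φ, hφ⟩ := h.exists_coloring hQ
  exact Backbone.exists_stuck h.le hφ h.not_colorable fun i _ => card_resid hM Q φ i

/-- The potential of a nonempty set is not positive in a critical pair. -/
lemma IsCritical.pot_nonpos (h : IsCritical G H M) (hM : 0 ≤ M) :
    ∀ {S : Finset V}, S.Nonempty → pot G H M S ≤ 0 := by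
  intro S
  induction hn : #S using Nat.strong_induction_on generalizing S with
  | _ n ih =>
    intro hS
    -- Stuck sets are deleted one after the other without lowering the potential, which is `0` once
    -- nothing is left.
    obtain ⟨J, hJ, hJne, hst⟩ := h.exists_stuck hM hS
    have h1 := pot_sdiff_ge hJ hst
    have h2 := cross_nonneg h.le J (S \ J)
    rcases (S \ J).eq_empty_or_nonempty with he | hne
    · rw [he] at h1 h2
      have : pot G H M (∅ : Finset V) = 0 := by simp [pot]
      linarith
    · have hlt : #(S \ J) < n := by
        rw [card_sdiff_of_subset hJ]
        have := card_pos.2 hJne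
        have := card_le_card hJ
        omega
      have := ih _ hlt rfl hne
      linarith

end Potential

end Backbone

namespace Backbone

/-! ### Reduction to critical pairs -/

section Critical

variable {V : Type*} [DecidableEq V] [Fintype V] {G H : SimpleGraph V} {M : ℤ}

/-- Uncolourable pairs contain critical pairs. -/
lemma exists_isCritical (hHG : H ≤ G) (h : ¬ Colorable G H M univ) :
    ∃ S : Finset V, IsCritical (G.comap (Subtype.val : S → V)) (H.comap (Subtype.val : S → V)) M := by
  classical
  have hne : ({S : Finset V | ¬ Colorable G H M S} : Finset (Finset V)).Nonempty :=
    ⟨univ, by simpa using h⟩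
  obtain ⟨S, hS, hmin⟩ := exists_min_image _ card hne
  simp only [mem_filter, mem_univ, true_and] at hS hmin
  refine ⟨S, fun a b hab => hHG hab, ?_, ?_⟩
  · intro T hT
    obtain ⟨x, hx⟩ : ∃ x, x ∉ T := by
      by_contra! hcon
      exact hT (eq_univ_of_forall hcon)
    have hlt : #(T.map (Function.Embedding.subtype _)) < #S := by
      rw [card_map, ← Fintype.card_coe S]
      exact card_lt_univ_of_notMem hx
    have hcol : Colorable G H M (T.map (Function.Embedding.subtype _)) := by
      by_contra hcon
      exact absurd (hmin _ hcon) (not_le.2 hlt)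
    obtain ⟨c, hc⟩ := hcol
    have hm : ∀ v ∈ T, (v : V) ∈ T.map (Function.Embedding.subtype _) := fun v hv =>
      mem_map.2 ⟨v, hv, rfl⟩
    exact ⟨fun v => c v, fun v hv => hc.mem v (hm v hv),
      fun u hu v hv huv => hc.ne u (hm u hu) v (hm v hv) huv,
      fun u hu v hv huv => hc.dist u (hm u hu) v (hm v hv) huv⟩
  · rintro ⟨c, hc⟩
    refine hS ⟨fun v => if hv : v ∈ S then c ⟨v, hv⟩ else 0, ?_, ?_, ?_⟩
    · intro v hv
      simpa [hv] using hc.mem ⟨v, hv⟩ (mem_univ _)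
    · intro u hu v hv huv
      simpa [hu, hv] using hc.ne ⟨u, hu⟩ (mem_univ _) ⟨v, hv⟩ (mem_univ _) huv
    · intro u hu v hv huv
      simpa [hu, hv] using hc.dist ⟨u, hu⟩ (mem_univ _) ⟨v, hv⟩ (mem_univ _) huv

end Critical

/-! ### Perfect elimination orders, descendants and blocks -/

section Elimination

variable {V : Type*} [LinearOrder V] [Fintype V]

/-- The later neighbours of a vertex. -/
def up (G : SimpleGraph V) [DecidableRel G.Adj] (v : V) : Finset V := {w | v < w ∧ G.Adj v w}

/-- The order of `V` is a perfect elimination order of `G` in which every vertex has at most `k`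
later neighbours. -/
structure IsElim (G : SimpleGraph V) [DecidableRel G.Adj] (k : ℕ) : Prop where
  adj : ∀ {a b c : V}, a < b → a < c → b ≠ c → G.Adj a b → G.Adj a c → G.Adj b c
  card_up : ∀ v, #(up G v) ≤ k

variable {G H : SimpleGraph V} [DecidableRel G.Adj] [DecidableRel H.Adj] {k : ℕ} {M : ℤ}

@[simp] lemma mem_up {v w : V} : w ∈ up G v ↔ v < w ∧ G.Adj v w := by simp [up]

lemma IsElim.comap (h : IsElim G k) (S : Finset V) :
    IsElim (G.comap (Subtype.val : S → V)) k where
  adj {a b c} hab hac hbc h1 h2 :=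
    h.adj (a := a) (b := b) (c := c) hab hac (fun e => hbc (Subtype.ext e)) h1 h2
  card_up v := by
    refine le_trans ?_ (h.card_up v)
    rw [← card_map (Function.Embedding.subtype _)]
    refine card_le_card fun w hw => ?_
    obtain ⟨w', hw', rfl⟩ := mem_map.1 hw
    rw [mem_up] at hw' ⊢
    exact hw'

/-- Greedy colouring. -/
lemma IsElim.exists_proper (h : IsElim G k) :
    ∃ c : V → ℤ, (∀ v, c v ∈ Ico (0 : ℤ) (k + 1)) ∧ ∀ u v, G.Adj u v → c u ≠ c v := by
  have hb : (⊥ : SimpleGraph V) ≤ G := bot_le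
  obtain ⟨c, hc⟩ := exists_isListCol_of_degenerate (G := G) (H := ⊥) (Q := univ)
    (L := fun _ => Ico (0 : ℤ) (k + 1)) hb (by
      intro K _ hK
      -- All neighbours in `K` of its least vertex are later neighbours.
      refine ⟨K.min' hK, min'_mem _ _, ?_⟩
      have h1 : degIn G K (K.min' hK) ≤ k := by
        refine le_trans (card_le_card fun w hw => ?_) (h.card_up (K.min' hK))
        rw [mem_filter] at hw
        rw [mem_up]
        exact ⟨lt_of_le_of_ne (min'_le _ _ hw.1) hw.2.ne, hw.2⟩
      have h2 : degIn (⊥ : SimpleGraph V) univ (K.min' hK) = 0 := by simp [degIn]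
      rw [h2, Int.card_Ico]
      omega)
  exact ⟨c, fun v => hc.mem v (mem_univ _),
    fun u v huv => hc.ne u (mem_univ _) v (mem_univ _) huv⟩

/-- Doubling a proper colouring with the colours `0, …, k` makes all edges of `G` have distance at
least two. -/
lemma IsElim.colorable_of_two_mul (h : IsElim G k) (hHG : H ≤ G) (hM : 2 * (k : ℤ) + 1 ≤ M) :
    Colorable G H M univ := by
  obtain ⟨c, hc, hne⟩ := h.exists_proper
  refine ⟨fun v => 2 * c v, ?_, ?_, ?_⟩
  · intro v _
    have := mem_Ico.1 (hc v)
    rw [mem_Ico]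
    omega
  · intro u _ v _ huv
    have := hne u v huv
    omega
  · intro u _ v _ huv
    have := hne u v (hHG huv)
    rw [le_abs]
    omega

lemma IsElim.colorable_of_bot (h : IsElim G k) (hH : ∀ u v, ¬ H.Adj u v) (hM : (k : ℤ) + 1 ≤ M) :
    Colorable G H M univ := by
  obtain ⟨c, hc, hne⟩ := h.exists_proper
  refine ⟨c, ?_, fun u _ v _ huv => hne u v huv, fun u _ v _ huv => absurd huv (hH u v)⟩
  intro v _
  have := mem_Ico.1 (hc v)
  rw [mem_Ico]
  omega

open scoped Classical in
/-- The vertices from which there is an increasing path to `p`. -/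
noncomputable def desc (G : SimpleGraph V) (p : V) : Finset V :=
  {v | Relation.ReflTransGen (fun a b => a < b ∧ G.Adj a b) v p}

lemma self_mem_desc (p : V) : p ∈ desc G p := by
  simpa [desc] using Relation.ReflTransGen.refl

lemma le_of_mem_desc {v p : V} (h : v ∈ desc G p) : v ≤ p := by
  simp only [desc, mem_filter, mem_univ, true_and] at h
  induction h with
  | refl => exact le_rfl
  | tail _ h ih => exact ih.trans h.1.le

lemma mem_desc_of_adj {v w p : V} (h : v ∈ desc G p) (hwv : w < v) (hadj : G.Adj w v) :
    w ∈ desc G p := by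
  simp only [desc, mem_filter, mem_univ, true_and] at h ⊢
  exact Relation.ReflTransGen.head ⟨hwv, hadj⟩ h

/-- Neighbours of a descendant that are not descendants are later neighbours of the ancestor. -/
lemma IsElim.mem_up_of_adj (hG : IsElim G k) {v p z : V} (h : v ∈ desc G p) (hz : z ∉ desc G p)
    (hvz : G.Adj v z) : z ∈ up G p := by
  have h' := h
  simp only [desc, mem_filter, mem_univ, true_and] at h'
  induction h' using Relation.ReflTransGen.head_induction_on with
  | refl =>
    rw [mem_up]
    refine ⟨lt_of_le_of_ne (not_lt.1 fun hlt => hz ?_) hvz.ne, hvz⟩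
    exact mem_desc_of_adj (self_mem_desc p) hlt hvz.symm
  | @head a c hac hcp ih =>
    have hc : c ∈ desc G p := by simpa [desc] using hcp
    have haz : a < z := lt_of_le_of_ne (not_lt.1 fun hlt => hz
      (mem_desc_of_adj h hlt hvz.symm)) hvz.ne
    exact ih hc (hG.adj hac.1 haz (fun e => hz (e ▸ hc)) hac.2 hvz)

/-- A set that contains the earlier neighbours of its members and whose other outer neighbours
lie in `X`. -/
structure IsBlock (G : SimpleGraph V) (S X : Finset V) : Prop where
  down : ∀ i ∈ S, ∀ j, j < i → G.Adj i j → j ∈ S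
  nbr : ∀ i ∈ S, ∀ j, j ∉ S → G.Adj i j → j ∈ X

lemma IsElim.isBlock_desc (hG : IsElim G k) (p : V) : IsBlock G (desc G p) (up G p) where
  down _ hi _ hji hij := mem_desc_of_adj hi hji hij.symm
  nbr _ hi _ hj hij := hG.mem_up_of_adj hi hj hij

/-- A union of components of the set of the proper descendants of `p`. -/
structure IsClosedBelow (G : SimpleGraph V) (p : V) (A : Finset V) : Prop where
  sub : A ⊆ (desc G p).erase p
  closed : ∀ i ∈ A, ∀ j ∈ (desc G p).erase p, G.Adj i j → j ∈ A

lemma IsClosedBelow.isBlock {p : V} {A : Finset V} (h : IsClosedBelow G p A) (hG : IsElim G k) :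
    IsBlock G A (insert p (up G p)) where
  down i hi j hji hij := by
    have h1 := h.sub hi
    rw [mem_erase] at h1
    have h2 := le_of_mem_desc h1.2
    exact h.closed i hi j (mem_erase.2 ⟨(hji.trans_le h2).ne, mem_desc_of_adj h1.2 hji hij.symm⟩)
      hij
  nbr i hi j hj hij := by
    rw [mem_insert]
    by_contra! hcon
    have h1 := h.sub hi
    rw [mem_erase] at h1
    by_cases h2 : j ∈ desc G p
    · exact hj (h.closed i hi j (mem_erase.2 ⟨hcon.1, h2⟩) hij)
    · exact hcon.2 (hG.mem_up_of_adj h1.2 h2 hij)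

lemma isClosedBelow_empty (p : V) : IsClosedBelow G p ∅ := ⟨by simp, by simp⟩

lemma IsClosedBelow.union {p : V} {A B : Finset V} (hA : IsClosedBelow G p A)
    (hB : IsClosedBelow G p B) : IsClosedBelow G p (A ∪ B) where
  sub := union_subset hA.sub hB.sub
  closed i hi j hj hij := by
    rcases mem_union.1 hi with h | h
    · exact mem_union_left _ (hA.closed i h j hj hij)
    · exact mem_union_right _ (hB.closed i h j hj hij)

/-- Outside a closed set of proper descendants there is a whole closed set of descendants. -/
lemma IsClosedBelow.exists_desc {p : V} {A : Finset V} (hA : IsClosedBelow G p A)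
    (hG : IsElim G k) (hne : ((desc G p).erase p \ A).Nonempty) :
    ∃ c < p, IsClosedBelow G p (desc G c) ∧ Disjoint A (desc G c) := by
  -- A neighbour of `desc G c` outside of it comes later than `c`. By the choice of the last vertex
  -- `c` it cannot be another proper descendant of `p` outside `A`, and the closedness of `A` keeps
  -- it out of `A`.
  set c := ((desc G p).erase p \ A).max' hne with hc
  have hmem := max'_mem _ hne
  rw [← hc, mem_sdiff, mem_erase] at hmem
  obtain ⟨⟨hcp, hcd⟩, hcA⟩ := hmem
  have hlt : c < p := lt_of_le_of_ne (le_of_mem_desc hcd) hcp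
  have hsub : ∀ v ∈ desc G c, v ∈ (desc G p).erase p ∧ v ∉ A := by
    intro v hv
    have hv' := hv
    simp only [desc, mem_filter, mem_univ, true_and] at hv'
    induction hv' using Relation.ReflTransGen.head_induction_on with
    | refl => exact ⟨mem_erase.2 ⟨hcp, hcd⟩, hcA⟩
    | @head a b hab hbc ih =>
      have hb : b ∈ desc G c := by simpa [desc] using hbc
      obtain ⟨h1, h2⟩ := ih hb
      have ha : a ∈ (desc G p).erase p := by
        rw [mem_erase] at h1 ⊢
        exact ⟨((le_of_mem_desc hv).trans_lt hlt).ne, mem_desc_of_adj h1.2 hab.1 hab.2⟩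
      exact ⟨ha, fun haA => h2 (hA.closed a haA b h1 hab.2)⟩
  refine ⟨c, hlt, ⟨fun v hv => (hsub v hv).1, ?_⟩, ?_⟩
  · intro i hi j hj hij
    by_contra hjc
    have h1 := hG.mem_up_of_adj hi hjc hij
    rw [mem_up] at h1
    have h2 : j ∉ A := fun hjA => (hsub i hi).2 (hA.closed j hjA i (hsub i hi).1 hij.symm)
    exact absurd (le_max' _ j (mem_sdiff.2 ⟨hj, h2⟩)) (not_le.2 h1.1)
  · exact disjoint_left.2 fun v hvA hvc => (hsub v hvc).2 hvA

/-- Degree sums of blocks. -/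
lemma IsBlock.two_mul_sum_degIn {S X : Finset V} (h : IsBlock G S X) :
    2 * ∑ i ∈ S, degIn G univ i = 2 * ∑ i ∈ S, #(up G i) + ∑ i ∈ S, degIn G S i := by
  have h1 : ∀ i ∈ S, degIn G univ i = #(up G i) + #{j ∈ S | j < i ∧ G.Adj i j} := by
    intro i hi
    unfold degIn up
    rw [← card_union_of_disjoint]
    · congr 1
      ext j
      simp only [mem_filter, mem_univ, true_and, mem_union]
      constructor
      · intro hij
        rcases lt_or_gt_of_ne hij.ne with h' | h'
        · exact Or.inl ⟨h', hij⟩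
        · exact Or.inr ⟨h.down i hi j h' hij, h', hij⟩
      · tauto
    · rw [disjoint_left]
      intro j hj hj'
      simp only [mem_filter, mem_univ, true_and] at hj hj'
      exact absurd hj.1 (not_lt.2 hj'.2.1.le)
  have h2 : ∀ i ∈ S, degIn G S i = #{j ∈ S | j < i ∧ G.Adj i j} + #{j ∈ S | i < j ∧ G.Adj i j} := by
    intro i hi
    unfold degIn
    rw [← card_union_of_disjoint]
    · congr 1
      ext j
      simp only [mem_filter, mem_union]
      constructor
      · rintro ⟨hj, hij⟩
        rcases lt_or_gt_of_ne hij.ne with h' | h'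
        · exact Or.inr ⟨hj, h', hij⟩
        · exact Or.inl ⟨hj, h', hij⟩
      · tauto
    · rw [disjoint_left]
      intro j hj hj'
      simp only [mem_filter] at hj hj'
      exact absurd hj.2.1 (not_lt.2 hj'.2.1.le)
  have h3 : ∑ i ∈ S, #{j ∈ S | j < i ∧ G.Adj i j} = ∑ i ∈ S, #{j ∈ S | i < j ∧ G.Adj i j} := by
    simp only [card_filter]
    rw [sum_comm]
    simp only [G.adj_comm]
  rw [sum_congr rfl h1, sum_congr rfl h2, sum_add_distrib, sum_add_distrib, h3]
  omega

end Elimination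

end Backbone

namespace Backbone

/-! ### The bound for sparse backbones -/

section Sparse

variable {V : Type*} [LinearOrder V] [Fintype V] {G H : SimpleGraph V} [DecidableRel G.Adj]
  [DecidableRel H.Adj] {k : ℕ} {M : ℤ}

/-- The potential bound for one vertex. -/
lemma IsCritical.le_degIn (h : IsCritical G H M) (hM : 0 ≤ M) (v : V) :
    M ≤ degIn G univ v + 2 * degIn H univ v := by
  have h1 := h.pot_nonpos hM (singleton_nonempty v)
  have h2 : degIn H {v} v = 0 := by simp [degIn, filter_singleton]
  simp only [pot, sum_singleton, excess, h2] at h1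
  push_cast at h1
  linarith

lemma IsBlock.degIn_le {S X : Finset V} (h : IsBlock G S X) (hG : IsElim G k) {i : V}
    (hi : i ∈ S) : degIn G univ i ≤ k + #S := by
  refine le_trans (card_le_card (t := up G i ∪ S) fun w hw => ?_)
    ((card_union_le _ _).trans (Nat.add_le_add_right (hG.card_up i) _))
  simp only [mem_filter, mem_univ, true_and] at hw
  rw [mem_union, mem_up]
  rcases lt_or_gt_of_ne hw.ne with h' | h'
  · exact Or.inl ⟨h', hw⟩
  · exact Or.inr (h.down i hi w h' hw)

/-- The bound on the number of colours that a block gives in a critical pair. -/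
lemma IsBlock.mul_le {S X : Finset V} (hS : IsBlock G S X) (hG : IsElim G k)
    (h : IsCritical G H M) (hM : 0 ≤ M) {d : ℝ}
    (hd : ∀ S : Finset V, (∑ i ∈ S, degIn H S i : ℝ) ≤ d * #S) (hd0 : 0 ≤ d) :
    (M : ℝ) * #S ≤ #S * (k + #S) + 2 * (d * (#S + #X)) := by
  have h1 : (M : ℝ) * #S ≤ ∑ i ∈ S, ((degIn G univ i : ℝ) + 2 * degIn H univ i) := by
    rw [mul_comm, ← nsmul_eq_mul, ← sum_const]
    exact sum_le_sum fun i _ => by exact_mod_cast h.le_degIn hM i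
  have h2 : ∑ i ∈ S, (degIn G univ i : ℝ) ≤ #S * (k + #S) := by
    rw [← nsmul_eq_mul, ← sum_const]
    exact sum_le_sum fun i hi => by exact_mod_cast hS.degIn_le hG hi
  have h3 : ∑ i ∈ S, (degIn H univ i : ℝ) ≤ d * (#S + #X) := by
    calc ∑ i ∈ S, (degIn H univ i : ℝ) ≤ ∑ i ∈ S, (degIn H (S ∪ X) i : ℝ) := by
          refine sum_le_sum fun i hi => ?_
          refine Nat.cast_le.2 (card_le_card fun w hw => ?_)
          simp only [mem_filter, mem_univ, true_and, mem_union] at hw ⊢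
          refine ⟨?_, hw⟩
          by_cases hwS : w ∈ S
          · exact Or.inl hwS
          · exact Or.inr (hS.nbr i hi w hwS (h.le hw))
      _ ≤ ∑ i ∈ S ∪ X, (degIn H (S ∪ X) i : ℝ) :=
          sum_le_sum_of_subset_of_nonneg subset_union_left fun _ _ _ => by positivity
      _ ≤ d * #(S ∪ X) := hd _
      _ ≤ d * (#S + #X) := by
          refine mul_le_mul_of_nonneg_left ?_ hd0
          exact_mod_cast card_union_le S X
  rw [sum_add_distrib, ← mul_sum] at h1
  linarith

/-- There are blocks of every order of magnitude. -/
lemma IsElim.exists_block [Nonempty V] (hG : IsElim G k) (q : ℕ) (hq : 1 ≤ q) :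
    ∃ S X : Finset V, IsBlock G S X ∧ S.Nonempty ∧ #S ≤ 2 * q ∧ #X ≤ k + 1 ∧
      (X = ∅ ∨ q ≤ #S) := by
  by_cases hbig : ∃ p, q ≤ #(desc G p)
  · have hne : ({p | q ≤ #(desc G p)} : Finset V).Nonempty := by
      obtain ⟨p, hp⟩ := hbig
      exact ⟨p, by simpa using hp⟩
    -- Vertices before `p` have fewer than `q` descendants, so a closed set below `p` of size less
    -- than `q` can grow by such a descendant set without passing `2 * q`.
    set p := min' _ hne with hp
    have hpq : q ≤ #(desc G p) := by simpa using min'_mem _ hne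
    have hmin : ∀ c < p, #(desc G c) < q := by
      intro c hc
      by_contra! hcon
      exact absurd (min'_le _ c (by simpa using hcon)) (not_le.2 hc)
    classical
    have hAne : ({A | IsClosedBelow G p A ∧ #A ≤ 2 * q} : Finset (Finset V)).Nonempty :=
      ⟨∅, by simpa using isClosedBelow_empty p⟩
    obtain ⟨A, hA, hmax⟩ := exists_max_image _ card hAne
    simp only [mem_filter, mem_univ, true_and] at hA hmax
    by_cases hAq : q ≤ #A
    · refine ⟨A, _, hA.1.isBlock hG, card_pos.1 (by omega), hA.2, ?_, Or.inr hAq⟩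
      have := hG.card_up p
      have := card_insert_le p (up G p)
      omega
    · rcases ((desc G p).erase p \ A).eq_empty_or_nonempty with he | hne'
      · refine ⟨desc G p, up G p, hG.isBlock_desc p, ⟨p, self_mem_desc p⟩, ?_,
          (hG.card_up p).trans (Nat.le_succ k), Or.inr hpq⟩
        have h1 := card_le_card (sdiff_eq_empty_iff_subset.1 he)
        rw [card_erase_of_mem (self_mem_desc p)] at h1
        omega
      · obtain ⟨c, hc, hcl, hdisj⟩ := hA.1.exists_desc hG hne'
        have h1 := hmin c hc
        have h2 := card_union_of_disjoint hdisj
        have h3 := hmax _ ⟨hA.1.union hcl, by omega⟩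
        have h4 := card_pos.2 ⟨c, self_mem_desc (G := G) c⟩
        omega
  · push Not at hbig
    -- If all descendant sets are small, the last vertex is used: it has no later neighbours, so its
    -- block has no outer neighbours.
    refine ⟨desc G (univ.max' univ_nonempty), ∅, ?_, ⟨_, self_mem_desc _⟩, ?_, by simp,
      Or.inl rfl⟩
    · have h1 := hG.isBlock_desc (univ.max' univ_nonempty)
      refine ⟨h1.down, fun i hi j hj hij => ?_⟩
      have := h1.nbr i hi j hj hij
      rw [mem_up] at this
      exact absurd (le_max' _ j (mem_univ j)) (not_le.2 this.1)
    · have := hbig (univ.max' univ_nonempty)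
      omega

/-- No pair of graphs with a sparse backbone graph is critical for this many colours. -/
lemma IsElim.colorable_of_sparse (hG : IsElim G k) (hHG : H ≤ G) (hk : 1 ≤ k) {d : ℝ}
    (hd1 : 1 ≤ d) (hd : ∀ S : Finset V, (∑ i ∈ S, degIn H S i : ℝ) ≤ d * #S)
    (hM : k + 12 * Real.sqrt (d * k) ≤ M) : Colorable G H M univ := by
  have hk' : (1 : ℝ) ≤ k := by exact_mod_cast hk
  set s := Real.sqrt (d * k) with hs
  have hss : s * s = d * k := Real.mul_self_sqrt (by positivity)
  have hs0 : 0 ≤ s := Real.sqrt_nonneg _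
  have hs1 : 1 ≤ s := by nlinarith
  -- For `d > k` the allowance is at least `13 * k`, and `2 * k + 1` colours suffice. Otherwise `d ≤
  -- s`.
  rcases lt_or_ge (k : ℝ) d with hdk | hdk
  · refine hG.colorable_of_two_mul hHG ?_
    have : (k : ℝ) ≤ s := by
      by_contra! hcon
      nlinarith
    have h2 : (2 * (k : ℝ) + 1) ≤ M := by linarith
    exact_mod_cast h2
  by_contra hcon
  obtain ⟨S, hS⟩ := exists_isCritical hHG hcon
  have hM0 : 0 ≤ M := by
    have : (0 : ℝ) ≤ M := by linarith
    exact_mod_cast this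
  have hne : Nonempty S := by
    by_contra hemp
    rw [not_nonempty_iff] at hemp
    exact hS.not_colorable ⟨0, fun v => hemp.elim v, fun v => hemp.elim v, fun v => hemp.elim v⟩
  have hdS : ∀ T : Finset S, (∑ i ∈ T, degIn (H.comap (Subtype.val : S → V)) T i : ℝ) ≤ d * #T := by
    intro T
    have h1 := hd (T.map (Function.Embedding.subtype _))
    rw [sum_map, card_map] at h1
    refine le_trans (le_of_eq (sum_congr rfl fun i _ => ?_)) h1
    norm_cast
    unfold degIn
    rw [filter_map, card_map]
    rfl
  -- Blocks of order `s` balance the terms `#T` and `2 * d * #X / #T`. With `#T ≤ 2 * q ≤ 4 * s`, `d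
  -- ≤ s` and `d * #X ≤ 2 * s * #T`, the bound on `M` exceeds `k` by at most `4 * s + 2 * s + 4 *
  -- s`.
  set q := ⌈s⌉₊ with hq
  have hsq : s ≤ q := Nat.le_ceil s
  have hqs : (q : ℝ) < s + 1 := Nat.ceil_lt_add_one hs0
  have hq1 : 1 ≤ q := by
    have : (0 : ℝ) < q := by linarith
    exact_mod_cast this
  obtain ⟨T, X, hblock, hT, hTq, hXk, hor⟩ := (hG.comap S).exists_block q hq1
  have h1 := hblock.mul_le (hG.comap S) hS hM0 hdS (by linarith)
  have hT0 : (1 : ℝ) ≤ #T := by exact_mod_cast hT.card_pos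
  have hTq' : (#T : ℝ) ≤ 2 * q := by exact_mod_cast hTq
  have hds : d ≤ s := by
    by_contra! hc
    nlinarith
  have hX : d * #X ≤ 2 * s * #T := by
    rcases hor with rfl | hor
    · simp
      positivity
    · have h2 : (#X : ℝ) ≤ k + 1 := by exact_mod_cast hXk
      have h3 : (q : ℝ) ≤ #T := by exact_mod_cast hor
      nlinarith
  have h3 : (#T : ℝ) * (k + #T) + 2 * (d * (#T + #X)) < #T * (k + 12 * s) := by
    nlinarith
  nlinarith

end Sparse

end Backbone

namespace Backbone

/-! ### Subtrees of a rooted tree -/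

section Tree

variable {ι : Type*} {T : SimpleGraph ι}

/-- Parents are unique: shortest paths from `r` to `w` and to `w'`, prolonged to `v`, are both the
path from `r` to `v`. -/
lemma eq_of_adj_of_dist_succ (hT : T.IsTree) {r v w w' : ι} (hw : T.Adj v w) (hw' : T.Adj v w')
    (h : T.dist r w + 1 = T.dist r v) (h' : T.dist r w' + 1 = T.dist r v) : w = w' := by
  obtain ⟨p, hp⟩ := hT.connected.exists_walk_length_eq_dist r w
  obtain ⟨p', hp'⟩ := hT.connected.exists_walk_length_eq_dist r w'
  have h1 : (p.concat hw.symm).IsPath :=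
    SimpleGraph.Walk.isPath_of_length_eq_dist _ (by rw [SimpleGraph.Walk.length_concat, hp, h])
  have h2 : (p'.concat hw'.symm).IsPath :=
    SimpleGraph.Walk.isPath_of_length_eq_dist _ (by rw [SimpleGraph.Walk.length_concat, hp', h'])
  have h3 := (hT.isAcyclic.subsingleton_path r v).elim ⟨_, h1⟩ ⟨_, h2⟩
  have h4 := congrArg (fun q : T.Path r v => q.1.penultimate) h3
  simpa using h4

/-- A path that avoids the parent `x` of its first node steps to a child, whose parent is then
avoided too, so it always leads away from the root. -/
lemma dist_le_of_isPath (hT : T.IsTree) {r a y : ι} (q : T.Walk a y) : q.IsPath →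
    ∀ x, x ∉ q.support → T.Adj a x → T.dist r x + 1 = T.dist r a → T.dist r a ≤ T.dist r y := by
  induction q with
  | nil => intros; exact le_rfl
  | @cons a b y hab q ih =>
    intro hq x hx hax hd
    rw [SimpleGraph.Walk.cons_isPath_iff] at hq
    have hb : T.dist r b = T.dist r a + 1 := by
      rcases hT.dist_eq_dist_add_one_of_adj r hab with h | h
      · have := eq_of_adj_of_dist_succ hT hax hab hd h.symm
        subst this
        exact absurd (by simp) hx
      · exact h
    have := ih hq.1 a hq.2 hab.symm hb.symm
    omega

/-- The path in `S` to a different node that is no farther from the root has to start towards the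
root. -/
lemma exists_adj_dist_succ_mem (hT : T.IsTree) (r : ι) {S : Set ι} (hS : (T.induce S).Connected)
    {x y : ι} (hx : x ∈ S) (hy : y ∈ S) (hne : x ≠ y) (hd : T.dist r y ≤ T.dist r x) :
    ∃ z ∈ S, T.Adj x z ∧ T.dist r z + 1 = T.dist r x := by
  obtain ⟨p, hp⟩ := (hS.preconnected ⟨x, hx⟩ ⟨y, hy⟩).exists_isPath
  obtain ⟨q, hp', hmem⟩ : ∃ q : T.Walk x y, q.IsPath ∧ ∀ z ∈ q.support, z ∈ S := by
    refine ⟨p.map (SimpleGraph.Embedding.induce S).toHom, hp.map Subtype.val_injective, ?_⟩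
    intro z hz
    have hz' := (SimpleGraph.Walk.support_map (SimpleGraph.Embedding.induce S).toHom p) ▸ hz
    obtain ⟨z', -, rfl⟩ := List.mem_map.1 hz'
    exact z'.2
  cases q with
  | nil => exact absurd rfl hne
  | @cons _ b _ hxb q =>
    refine ⟨b, hmem b (by simp), hxb, ?_⟩
    rcases hT.dist_eq_dist_add_one_of_adj r hxb with h | h
    · exact h.symm
    · rw [SimpleGraph.Walk.cons_isPath_iff] at hp'
      have := dist_le_of_isPath hT q hp'.1 x hp'.2 hxb.symm h.symm
      omega

/-- If two subtrees meet, the higher one contains the root of the lower one. -/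
lemma root_mem_of_inter (hT : T.IsTree) (r : ι) {S S' : Set ι} (hS : (T.induce S).Connected)
    (hS' : (T.induce S').Connected) {s s' : ι} (hs : s ∈ S) (hs' : s' ∈ S')
    (hmin : ∀ z ∈ S, T.dist r s ≤ T.dist r z) (hle : T.dist r s' ≤ T.dist r s) (n : ℕ) :
    ∀ x ∈ S, x ∈ S' → T.dist r x = n → s ∈ S' := by
  induction n using Nat.strong_induction_on with
  | _ n ih =>
    intro x hx hx' hn
    by_cases hxs : x = s
    · exact hxs ▸ hx'
    -- Both subtrees contain the parent of `x`, so the common node climbs until it reaches `s`.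
    obtain ⟨z, hz, hxz, hdz⟩ := exists_adj_dist_succ_mem hT r hS hx hs hxs (hmin x hx)
    have h1 := hmin z hz
    have hne : x ≠ s' := by
      rintro rfl
      omega
    obtain ⟨z', hz', hxz', hdz'⟩ := exists_adj_dist_succ_mem hT r hS' hx' hs' hne
      (hle.trans (hmin x hx))
    obtain rfl := eq_of_adj_of_dist_succ hT hxz hxz' hdz hdz'
    exact ih _ (by omega) z hz hz' rfl

end Tree

/-! ### From tree-decompositions to elimination orders -/

section Treewidth

variable {V : Type*} [Finite V] {G : SimpleGraph V}

lemma ncard_bag_le_width (D : G.TreeDecomposition) (i : D.ι) :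
    ((D.bag i).ncard : ℤ) ≤ D.width + 1 := by
  have := D.finite_nodes
  have h := le_ciSup (f := fun i : D.ι => ((D.bag i).ncard : ℤ) - 1) (Set.finite_range _).bddAbove i
  rw [SimpleGraph.TreeDecomposition.width]
  linarith

lemma neg_one_le_width (D : G.TreeDecomposition) : -1 ≤ D.width := by
  obtain ⟨i⟩ := D.isTree.connected.nonempty
  have := ncard_bag_le_width D i
  omega

/-- The tree-decomposition with one bag. -/
def trivialDecomposition (G : SimpleGraph V) : G.TreeDecomposition where
  ι := Unit
  finite_nodes := inferInstance
  tree := ⊥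
  isTree := SimpleGraph.IsTree.of_subsingleton
  bag _ := Set.univ
  iUnion_bag := Set.eq_univ_of_forall fun _ => Set.mem_iUnion.2 ⟨(), trivial⟩
  exists_bag_of_adj _ _ _ := ⟨(), trivial, trivial⟩
  connected_nodes v := by
    have : Nonempty {i : Unit | v ∈ (Set.univ : Set V)} := ⟨⟨(), trivial⟩⟩
    exact SimpleGraph.IsTree.of_subsingleton.connected

lemma exists_width_eq_treewidth (G : SimpleGraph V) :
    ∃ D : G.TreeDecomposition, D.width = G.treewidth := by
  have hne : (Set.range fun D : G.TreeDecomposition => D.width).Nonempty :=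
    ⟨_, trivialDecomposition G, rfl⟩
  have hbd : BddBelow (Set.range fun D : G.TreeDecomposition => D.width) :=
    ⟨-1, by rintro _ ⟨D, rfl⟩; exact neg_one_le_width D⟩
  exact Int.csInf_mem hne hbd

lemma neg_one_le_treewidth (G : SimpleGraph V) : -1 ≤ G.treewidth := by
  obtain ⟨D, hD⟩ := exists_width_eq_treewidth G
  exact hD ▸ neg_one_le_width D

lemma treewidth_nonneg [Nonempty V] (G : SimpleGraph V) : 0 ≤ G.treewidth := by
  obtain ⟨D, hD⟩ := exists_width_eq_treewidth G
  obtain ⟨v⟩ := ‹Nonempty V›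
  have hv : v ∈ ⋃ i, D.bag i := by rw [D.iUnion_bag]; trivial
  obtain ⟨i, hi⟩ := Set.mem_iUnion.1 hv
  have h1 := ncard_bag_le_width D i
  have h2 : 0 < (D.bag i).ncard := (Set.ncard_pos (Set.toFinite _)).2 ⟨v, hi⟩
  omega

lemma one_le_treewidth {u v : V} (h : G.Adj u v) : 1 ≤ G.treewidth := by
  obtain ⟨D, hD⟩ := exists_width_eq_treewidth G
  obtain ⟨i, hu, hv⟩ := D.exists_bag_of_adj u v h
  have h1 := ncard_bag_le_width D i
  have h2 : 1 < (D.bag i).ncard := (Set.one_lt_ncard (Set.toFinite _)).2 ⟨u, hu, v, hv, h.ne⟩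
  omega

/-- A graph of treewidth `k` is a subgraph of a graph with a perfect elimination order in which
every vertex has at most `k` later neighbours. -/
lemma exists_isElim [Fintype V] (G : SimpleGraph V) {k : ℕ} (hk : G.treewidth = k) :
    ∃ (_ : LinearOrder V) (G' : SimpleGraph V) (_ : DecidableRel G'.Adj), G ≤ G' ∧ IsElim G' k := by
  classical
  obtain ⟨D, hD⟩ := exists_width_eq_treewidth G
  have hfin := D.finite_nodes
  obtain ⟨r⟩ := D.isTree.connected.nonempty
  have htop : ∀ v : V, ∃ i, v ∈ D.bag i ∧ ∀ j, v ∈ D.bag j → D.tree.dist r i ≤ D.tree.dist r j := by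
    intro v
    obtain ⟨⟨i, hi⟩⟩ := (D.connected_nodes v).nonempty
    obtain ⟨j, hj, hmin⟩ := Set.exists_min_image {i | v ∈ D.bag i} (D.tree.dist r)
      (Set.toFinite _) ⟨i, hi⟩
    exact ⟨j, hj, hmin⟩
  choose top hmem hmin using htop
  -- Vertices whose subtree has a deeper top come first; the second coordinate breaks ties.
  let key : V → ℤ ×ₗ Fin (Fintype.card V) := fun v =>
    toLex (-(D.tree.dist r (top v) : ℤ), Fintype.equivFin V v)
  have hkey : Function.Injective key := fun a b h => by
    have := congrArg (fun z => (ofLex z).2) h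
    simpa [key] using this
  let G' : SimpleGraph V :=
    { Adj := fun u v => u ≠ v ∧ ∃ i, u ∈ D.bag i ∧ v ∈ D.bag i
      symm := ⟨fun u v ⟨h, i, h1, h2⟩ => ⟨h.symm, i, h2, h1⟩⟩
      loopless := ⟨fun u h => h.1 rfl⟩ }
  let inst : LinearOrder V := LinearOrder.lift' key hkey
  have hlt : ∀ {a b : V}, a < b → D.tree.dist r (top b) ≤ D.tree.dist r (top a) := by
    intro a b hab
    have h : key a < key b := hab
    rw [Prod.Lex.lt_iff] at h
    simp only [key, ofLex_toLex] at h
    omega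
  -- The later neighbours of `a` share the bag at its top, hence are a clique. That bag has at most
  -- `k + 1` vertices, one of which is `a`.
  have hbag : ∀ {a b : V}, a < b → G'.Adj a b → b ∈ D.bag (top a) := by
    intro a b hab hadj
    obtain ⟨-, i, ha, hb⟩ := hadj
    exact root_mem_of_inter D.isTree r (D.connected_nodes a) (D.connected_nodes b)
      (hmem a) (hmem b) (hmin a) (hlt hab) _ i ha hb rfl
  refine ⟨inst, G', inferInstance, fun u v h => ⟨h.ne, D.exists_bag_of_adj u v h⟩, ?_⟩
  constructor
  · intro a b c hab hac hbc h1 h2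
    exact ⟨hbc, top a, hbag hab h1, hbag hac h2⟩
  · intro v
    have h1 := ncard_bag_le_width D (top v)
    have h2 : (insert v (up G' v) : Finset V) ⊆ (D.bag (top v)).toFinset := by
      intro w hw
      rw [Set.mem_toFinset]
      rcases mem_insert.1 hw with rfl | hw
      · exact hmem w
      · rw [mem_up] at hw
        exact hbag hw.1 hw.2
    have h3 := card_le_card h2
    rw [card_insert_of_notMem (by simp), ← Set.ncard_eq_toFinset_card'] at h3
    rw [hD, hk] at h1
    have : #(up G' v) + 1 ≤ k + 1 := by
      exact_mod_cast (Nat.cast_le (α := ℤ)).2 h3 |>.trans h1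
    omega

end Treewidth

end Backbone

/-! ### Counting in backbones without 4-cycles -/

namespace Backbone

/-- Any two vertices have at most one common neighbour. -/
def AtMostOneCommon {V : Type*} (H : SimpleGraph V) : Prop :=
  ∀ ⦃u v x y : V⦄, u ≠ v → H.Adj u x → H.Adj v x → H.Adj u y → H.Adj v y → x = y

section Counting

variable {V : Type*} [DecidableEq V] [Fintype V] {G H : SimpleGraph V} [DecidableRel G.Adj]
  [DecidableRel H.Adj] {M : ℤ}

/-- Distinct vertices `y` have disjoint families of pairs of neighbours in `S`. -/
lemma AtMostOneCommon.sum_choose_le (hH : AtMostOneCommon H) (S : Finset V) :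
    ∑ y, (degIn H S y).choose 2 ≤ (#S).choose 2 := by
  have h1 : ∀ y, (degIn H S y).choose 2 = #(powersetCard 2 {w ∈ S | H.Adj y w}) := fun y => by
    rw [card_powersetCard]; rfl
  rw [sum_congr rfl fun y _ => h1 y, ← card_powersetCard, ← card_biUnion]
  · refine card_le_card (biUnion_subset.2 fun y _ => powersetCard_mono (filter_subset _ _))
  · intro y _ y' _ hne
    refine disjoint_left.2 fun P hP hP' => hne ?_
    rw [mem_powersetCard] at hP hP'
    obtain ⟨u, v, huv, rfl⟩ := card_eq_two.1 hP.2
    have hu := hP.1 (mem_insert_self u {v})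
    have hv := hP.1 (mem_insert_of_mem (mem_singleton_self v))
    have hu' := hP'.1 (mem_insert_self u {v})
    have hv' := hP'.1 (mem_insert_of_mem (mem_singleton_self v))
    rw [mem_filter] at hu hv hu' hv'
    exact hH huv hu.2.symm hv.2.symm hu'.2.symm hv'.2.symm

lemma degIn_lt_card {S : Finset V} {i : V} (hi : i ∈ S) : degIn G S i < #S := by
  refine card_lt_card ?_
  rw [ssubset_iff_of_subset (filter_subset _ _)]
  exact ⟨i, hi, by simp⟩

/-- The number of pairs of a vertex in `S` and a neighbour outside of `S`. -/
def outSum (H : SimpleGraph V) [DecidableRel H.Adj] (S : Finset V) : ℕ := ∑ i ∈ S, degIn H Sᶜ i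

/-- The sum of the degrees of the induced graph. -/
def inSum (H : SimpleGraph V) [DecidableRel H.Adj] (S : Finset V) : ℕ := ∑ i ∈ S, degIn H S i

/-- The number of paths of length two in the induced graph. -/
def inPairs (H : SimpleGraph V) [DecidableRel H.Adj] (S : Finset V) : ℕ :=
  ∑ i ∈ S, (degIn H S i).choose 2

lemma pot_eq (S : Finset V) : pot G H M S =
    #S * M - ∑ i ∈ S, (degIn G univ i : ℤ) - 2 * outSum H S - inSum H S := by
  have h : ∀ i ∈ S, excess G H M S i =
      M - degIn G univ i - 2 * degIn H Sᶜ i - degIn H S i := by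
    intro i _
    have := degIn_add_compl (G := H) S i
    unfold excess
    omega
  unfold pot outSum inSum
  rw [sum_congr rfl h]
  simp only [sum_sub_distrib, sum_const, nsmul_eq_mul, ← mul_sum]
  push_cast
  ring

lemma degIn_union_of_forall_not_adj {A B : Finset V} {i : V} (h : ∀ j ∈ B, ¬ G.Adj i j) :
    degIn G (A ∪ B) i = degIn G A i := by
  unfold degIn
  congr 1
  ext j
  simp only [mem_filter, mem_union]
  constructor
  · rintro ⟨h1 | h1, h2⟩
    · exact ⟨h1, h2⟩
    · exact absurd h2 (h j h1)
  · tauto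

lemma degIn_compl_union_of_forall_not_adj {A B : Finset V} {i : V} (h : ∀ j ∈ B, ¬ G.Adj i j) :
    degIn G (A ∪ B)ᶜ i = degIn G Aᶜ i := by
  unfold degIn
  congr 1
  ext j
  simp only [mem_filter, mem_union, mem_compl, not_or]
  exact ⟨fun h1 => ⟨h1.1.1, h1.2⟩, fun h1 => ⟨⟨h1.1, fun hj => h j hj h1.2⟩, h1.2⟩⟩

section Union

variable {A B : Finset V} (hd : Disjoint A B) (h : ∀ i ∈ A, ∀ j ∈ B, ¬ G.Adj i j)
include hd h

lemma outSum_union : outSum G (A ∪ B) = outSum G A + outSum G B := by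
  unfold outSum
  rw [sum_union hd]
  congr 1
  · exact sum_congr rfl fun i hi => degIn_compl_union_of_forall_not_adj (h i hi)
  · rw [union_comm]
    exact sum_congr rfl fun i hi => degIn_compl_union_of_forall_not_adj
      fun j hj e => h j hj i hi e.symm

lemma inPairs_union : inPairs G (A ∪ B) = inPairs G A + inPairs G B := by
  unfold inPairs
  rw [sum_union hd]
  congr 1
  · exact sum_congr rfl fun i hi => by rw [degIn_union_of_forall_not_adj (h i hi)]
  · rw [union_comm]
    exact sum_congr rfl fun i hi => by rw [degIn_union_of_forall_not_adj
      fun j hj e => h j hj i hi e.symm]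

end Union

lemma inSum_le (S : Finset V) : inSum H S ≤ #S * (#S - 1) := by
  unfold inSum
  rw [← smul_eq_mul, ← sum_const]
  exact sum_le_sum fun i hi => Nat.le_pred_of_lt (degIn_lt_card hi)

lemma inSum_le_inPairs_add (S : Finset V) : inSum H S ≤ inPairs H S + #S := by
  unfold inSum inPairs
  rw [card_eq_sum_ones, ← sum_add_distrib]
  refine sum_le_sum fun i _ => ?_
  generalize degIn H S i = m
  rcases m with _ | _ | m
  · simp
  · simp
  · rw [Nat.choose_succ_succ, Nat.choose_one_right]
    omega

end Counting

section Blocks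

variable {V : Type*} [LinearOrder V] [Fintype V] {G H : SimpleGraph V} [DecidableRel G.Adj]
  [DecidableRel H.Adj] {k : ℕ} {M : ℤ} {S X : Finset V}

lemma even_inSum (S : Finset V) : Even (inSum H S) := by
  have h2 : ∀ i ∈ S, degIn H S i = #{j ∈ S | j < i ∧ H.Adj i j} + #{j ∈ S | i < j ∧ H.Adj i j} := by
    intro i hi
    unfold degIn
    rw [← card_union_of_disjoint]
    · congr 1
      ext j
      simp only [mem_filter, mem_union]
      constructor
      · rintro ⟨hj, hij⟩
        rcases lt_or_gt_of_ne hij.ne with h' | h'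
        · exact Or.inr ⟨hj, h', hij⟩
        · exact Or.inl ⟨hj, h', hij⟩
      · tauto
    · rw [disjoint_left]
      intro j hj hj'
      simp only [mem_filter] at hj hj'
      exact absurd hj.2.1 (not_lt.2 hj'.2.1.le)
  have h3 : ∑ i ∈ S, #{j ∈ S | j < i ∧ H.Adj i j} = ∑ i ∈ S, #{j ∈ S | i < j ∧ H.Adj i j} := by
    simp only [card_filter]
    rw [sum_comm]
    simp only [H.adj_comm]
  unfold inSum
  rw [sum_congr rfl h2, sum_add_distrib, h3]
  exact ⟨_, rfl⟩

lemma IsBlock.mono_left (h : IsBlock G S X) (hHG : H ≤ G) : IsBlock H S X :=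
  ⟨fun i hi j hji hij => h.down i hi j hji (hHG hij), fun i hi j hj hij => h.nbr i hi j hj (hHG hij)⟩

lemma IsBlock.degIn_eq_zero (h : IsBlock H S X) {y : V} (hy : y ∉ S) (hyX : y ∉ X) :
    degIn H S y = 0 := by
  unfold degIn
  rw [card_eq_zero, filter_eq_empty_iff]
  exact fun i hi hyi => hyX (h.nbr i hi y hy hyi.symm)

/-- The potential bound, with the `G`-degrees in a block split into later neighbours, at most `k`
each, and inner edges. The factor two avoids halving the inner degree sum. -/
lemma IsBlock.two_mul_card_mul_le (h : IsBlock G S X) (hG : IsElim G k) (hc : IsCritical G H M)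
    (hM : 0 ≤ M) (hS : S.Nonempty) :
    2 * #S * M ≤ 2 * #S * k + inSum G S + 4 * outSum H S + 2 * inSum H S := by
  have h1 := hc.pot_nonpos hM hS
  rw [pot_eq] at h1
  have h2 := h.two_mul_sum_degIn
  have h3 : ∑ i ∈ S, #(up G i) ≤ #S * k := by
    rw [← smul_eq_mul, ← sum_const]
    exact sum_le_sum fun i _ => hG.card_up i
  change _ = _ + inSum G S at h2
  have h4 : 2 * ∑ i ∈ S, (degIn G univ i : ℤ) = 2 * ∑ i ∈ S, (#(up G i) : ℤ) + inSum G S := by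
    exact_mod_cast h2
  have h5 : ∑ i ∈ S, (#(up G i) : ℤ) ≤ #S * k := by exact_mod_cast h3
  linarith

/-- The outgoing edges are counted at their ends in `X`, where the linear bound `a * m - b` for
`m.choose 2` turns the pair count into a bound on degrees. It is used with `m - 1`, exact for `m =
1, 2`, and `2 * m - 3`, exact for `m = 2, 3`. -/
lemma IsBlock.sum_compl (h : IsBlock H S X) (hH : AtMostOneCommon H) (a b : ℕ)
    (hab : ∀ m : ℕ, a * m ≤ b + m.choose 2) :
    a * outSum H S + inPairs H S ≤ b * #X + (#S).choose 2 := by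
  have h1 := hH.sum_choose_le S
  rw [← sum_add_sum_compl S] at h1
  have h2 : outSum H S = ∑ y ∈ Sᶜ, degIn H S y := sum_degIn_comm S Sᶜ
  have h3 : a * outSum H S ≤ b * #X + ∑ y ∈ Sᶜ, (degIn H S y).choose 2 := by
    have h4 : b * #X = ∑ y, if y ∈ X then b else 0 := by
      rw [sum_ite_mem, univ_inter, sum_const, smul_eq_mul, mul_comm]
    rw [h2, mul_sum, h4]
    refine le_trans ?_ (Nat.add_le_add_right
      (sum_le_sum_of_subset (subset_univ Sᶜ)) _)
    rw [← sum_add_distrib]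
    refine sum_le_sum fun y hy => ?_
    by_cases hyX : y ∈ X
    · simpa [hyX] using hab _
    · rw [h.degIn_eq_zero (mem_compl.1 hy) hyX]
      simp
  unfold inPairs
  omega

lemma le_one_add_choose_two (m : ℕ) : 1 * m ≤ 1 + m.choose 2 := by
  rcases m with _ | m
  · simp
  · rw [Nat.choose_succ_succ, Nat.choose_one_right]
    omega

lemma two_mul_le_three_add_choose_two (m : ℕ) : 2 * m ≤ 3 + m.choose 2 := by
  rcases m with _ | _ | m
  · simp
  · simp
  · have e : (m + 1 + 1).choose 2 = (m + 1) + (m + 1).choose 2 := by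
      rw [Nat.choose_succ_succ' (m + 1) 1, Nat.choose_one_right]
    have := le_one_add_choose_two (m + 1)
    omega

/-- What criticality says about small blocks. -/
lemma IsBlock.small (h : IsBlock G S X) (hG : IsElim G k) {D : ℕ} (hD : 10 ≤ D)
    (hc : IsCritical G H ((k + D : ℕ) : ℤ)) :
    (#S = 1 → D ≤ 2 * (outSum H S + inPairs H S)) ∧
    (#S = 2 → 2 * D ≤ 2 * (outSum H S + inPairs H S) + 2) ∧
    (#S = 3 → 3 * D ≤ 2 * (outSum H S + inPairs H S) + 5) ∧
    (#S = 3 → D = 10 → 25 ≤ 2 * outSum H S + inPairs H S) ∧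
    (#S = 3 → D = 11 → 27 ≤ 2 * outSum H S + inPairs H S) := by
  have h1 : S.Nonempty →
      2 * #S * (k + D) ≤ 2 * #S * k + inSum G S + 4 * outSum H S + 2 * inSum H S := by
    intro hne
    exact_mod_cast h.two_mul_card_mul_le hG hc (by positivity) hne
  have h2 := inSum_le (H := G) S
  have h3 := inSum_le (H := H) S
  have h4 := inSum_le_inPairs_add (H := H) S
  -- Parity excludes odd degree sums, for which the constants would be worse.
  obtain ⟨e, he⟩ := even_inSum (H := H) S
  refine ⟨fun hs => ?_, fun hs => ?_, fun hs => ?_, fun hs hd => ?_, fun hs hd => ?_⟩ <;>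
    have h1 := h1 (card_pos.1 (by omega)) <;> rw [hs] at h1 h2 h3 h4 <;> omega

end Blocks

/-! ### Finding a vertex with exactly four descendants -/

section FourBlock

variable {V : Type*} [LinearOrder V] [Fintype V] {G H : SimpleGraph V} [DecidableRel G.Adj]
  [DecidableRel H.Adj] {k D : ℕ} {p : V}

lemma IsClosedBelow.not_adj {A B : Finset V} (hA : IsClosedBelow G p A) (hB : IsClosedBelow G p B)
    (hd : Disjoint A B) : ∀ i ∈ A, ∀ j ∈ B, ¬ G.Adj i j := fun i hi j hj hij =>
  disjoint_left.1 hd (hA.closed i hi j (hB.sub hj) hij) hj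

lemma IsElim.card_insert_up_le (hG : IsElim G k) (p : V) : #(insert p (up G p)) ≤ k + 1 :=
  (card_insert_le _ _).trans (Nat.succ_le_succ (hG.card_up p))

/-- Two small blocks below the same vertex cannot be as large as this. -/
lemma IsClosedBelow.false_of_pair (hG : IsElim G k) (hD : 10 ≤ D) (hk : k + 10 ≤ 2 * D)
    (hc : IsCritical G H ((k + D : ℕ) : ℤ)) (hH : AtMostOneCommon H) {A B : Finset V}
    (hA : IsClosedBelow G p A) (hB : IsClosedBelow G p B) (hd : Disjoint A B)
    (hcard : (#A = 2 ∧ #B = 2) ∨ (#A = 3 ∧ #B = 1) ∨ (#A = 3 ∧ #B = 2) ∨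
      (#A = 3 ∧ #B = 3 ∧ ¬ (D = 11 ∧ k = 12))) : False := by
  have h1 := (hA.isBlock hG).small hG hD hc
  have h2 := (hB.isBlock hG).small hG hD hc
  have hadj := hA.not_adj hB hd
  have hadjH : ∀ i ∈ A, ∀ j ∈ B, ¬ H.Adj i j := fun i hi j hj hij => hadj i hi j hj (hc.le hij)
  have h3 := ((hA.union hB).isBlock hG).mono_left hc.le
  have h4 := h3.sum_compl hH 1 1 le_one_add_choose_two
  have h5 := h3.sum_compl hH 2 3 two_mul_le_three_add_choose_two
  rw [outSum_union hd hadjH, inPairs_union hd hadjH, card_union_of_disjoint hd] at h4 h5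
  have h6 := hG.card_insert_up_le p
  have c4 : Nat.choose 4 2 = 6 := rfl
  have c5 : Nat.choose 5 2 = 10 := rfl
  have c6 : Nat.choose 6 2 = 15 := rfl
  -- Lower bounds from criticality meet upper bounds from the pair count. Two triples pass the first
  -- count only for `D = 10` or for `D = 11`, `k = 12`; the second count excludes `D = 10`.
  rcases hcard with ⟨e1, e2⟩ | ⟨e1, e2⟩ | ⟨e1, e2⟩ | ⟨e1, e2, e3⟩ <;>
    rw [e1, e2] at h4 h5 <;> simp only [Nat.reduceAdd, c4, c5, c6] at h4 h5
  · have := h1.2.1 e1; have := h2.2.1 e2; omega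
  · have := h1.2.2.1 e1; have := h2.1 e2; omega
  · have := h1.2.2.1 e1; have := h2.2.1 e2; omega
  · have := h1.2.2.1 e1
    have := h2.2.2.1 e2
    have := h1.2.2.2.1 e1
    have := h2.2.2.2.1 e2
    have := h1.2.2.2.2 e1
    have := h2.2.2.2.2 e2
    omega

/-- Each triple contributes at least `27` to `2 * outSum + inPairs`, in total `81`, while the pair
count allows `3 * 13 + 36 = 75`. -/
lemma IsClosedBelow.false_of_triple (hG : IsElim G 12)
    (hc : IsCritical G H ((12 + 11 : ℕ) : ℤ)) (hH : AtMostOneCommon H) {A B C : Finset V}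
    (hA : IsClosedBelow G p A) (hB : IsClosedBelow G p B) (hC : IsClosedBelow G p C)
    (hd : Disjoint A B) (hd' : Disjoint (A ∪ B) C)
    (h3A : #A = 3) (h3B : #B = 3) (h3C : #C = 3) : False := by
  have hadj := hA.not_adj hB hd
  have hadjH : ∀ i ∈ A, ∀ j ∈ B, ¬ H.Adj i j := fun i hi j hj hij => hadj i hi j hj (hc.le hij)
  have hadj' := (hA.union hB).not_adj hC hd'
  have hadjH' : ∀ i ∈ A ∪ B, ∀ j ∈ C, ¬ H.Adj i j :=
    fun i hi j hj hij => hadj' i hi j hj (hc.le hij)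
  have h5 := (((hA.union hB).union hC).isBlock hG).mono_left hc.le |>.sum_compl hH 2 3
    two_mul_le_three_add_choose_two
  rw [outSum_union hd' hadjH', inPairs_union hd' hadjH', outSum_union hd hadjH,
    inPairs_union hd hadjH, card_union_of_disjoint hd', card_union_of_disjoint hd, h3A, h3B,
    h3C] at h5
  have h6 := hG.card_insert_up_le p
  have c9 : Nat.choose 9 2 = 36 := rfl
  simp only [Nat.reduceAdd, c9] at h5
  have := ((hA.isBlock hG).small hG (by norm_num) hc).2.2.2.2 h3A rfl
  have := ((hB.isBlock hG).small hG (by norm_num) hc).2.2.2.2 h3B rfl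
  have := ((hC.isBlock hG).small hG (by norm_num) hc).2.2.2.2 h3C rfl
  omega

/-- The seven descendants of `p` form a block with at most `12` outer neighbours. Criticality asks
for `14 * 11 = 154`, but counting yields at most `24 + 2 * 57 + 14 = 152`. -/
lemma IsClosedBelow.false_of_whole (hG : IsElim G 12)
    (hc : IsCritical G H ((12 + 11 : ℕ) : ℤ)) (hH : AtMostOneCommon H) {A B : Finset V}
    (hA : IsClosedBelow G p A) (hB : IsClosedBelow G p B) (hd : Disjoint A B)
    (h3A : #A = 3) (h3B : #B = 3) (hAB : (desc G p).erase p = A ∪ B) : False := by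
  have hcard : #(desc G p) = 7 := by
    have := card_erase_add_one (self_mem_desc (G := G) p)
    rw [hAB, card_union_of_disjoint hd] at this
    omega
  have hS := hG.isBlock_desc p
  have h1 := hS.two_mul_card_mul_le hG hc (by norm_num) ⟨p, self_mem_desc p⟩
  have h2 := (hS.mono_left hc.le).sum_compl hH 2 3 two_mul_le_three_add_choose_two
  have h3 := inSum_le_inPairs_add (H := H) (desc G p)
  have h4 := hG.card_up p
  have h5 : inSum G (desc G p) ≤ 24 := by
    have hle : ∀ A B : Finset V, IsClosedBelow G p A → IsClosedBelow G p B → Disjoint A B →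
        #A = 3 → (desc G p).erase p = A ∪ B → ∀ i ∈ A, degIn G (desc G p) i ≤ 3 := by
      intro A B hA hB hd h3A hAB i hi
      have e1 := degIn_add_sdiff (G := G) (erase_subset p (desc G p)) i
      have e2 : desc G p \ (desc G p).erase p = {p} := by
        rw [sdiff_erase_self (self_mem_desc p)]
      have e3 : degIn G {p} i ≤ 1 := card_filter_le _ _
      rw [e2, hAB, degIn_union_of_forall_not_adj (hA.not_adj hB hd i hi)] at e1
      have e4 := degIn_lt_card (G := G) hi
      omega
    have hp := degIn_lt_card (G := G) (self_mem_desc (G := G) p)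
    have hsumA := sum_le_sum (hle A B hA hB hd h3A hAB)
    have hsumB := sum_le_sum (hle B A hB hA hd.symm h3B (by rw [hAB, union_comm]))
    unfold inSum
    rw [← add_sum_erase _ _ (self_mem_desc p), hAB, sum_union hd]
    simp only [sum_const, smul_eq_mul, h3A, h3B] at hsumA hsumB
    omega
  have c7 : Nat.choose 7 2 = 21 := rfl
  rw [hcard] at h1 h2 h3
  simp only [c7] at h1 h2
  omega

/-- In a critical pair some vertex has exactly four descendants. -/
lemma IsElim.exists_card_desc_eq_four (hG : IsElim G k) (hk : 10 ≤ k) (hD : 10 ≤ D)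
    (hkD : k + 10 ≤ 2 * D) (hc : IsCritical G H ((k + D : ℕ) : ℤ)) (hH : AtMostOneCommon H) :
    ∃ p, #(desc G p) = 4 := by
  have hV : Nonempty V := by
    by_contra hemp
    rw [not_nonempty_iff] at hemp
    exact hc.not_colorable ⟨0, fun v => hemp.elim v, fun v => hemp.elim v, fun v => hemp.elim v⟩
  -- The last vertex has all its neighbours among its descendants. With at most three of these, `M ≤
  -- 3 + 2 * 3`.
  have hne : ({p | 4 ≤ #(desc G p)} : Finset V).Nonempty := by
    by_contra hcon
    rw [not_nonempty_iff_eq_empty, filter_eq_empty_iff] at hcon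
    set p : V := univ.max' univ_nonempty with hp
    have h1 := hcon (mem_univ p)
    have h2 : degIn G univ p ≤ #(desc G p) := by
      refine card_le_card fun w hw => ?_
      rw [mem_filter] at hw
      by_contra hwp
      have := hG.mem_up_of_adj (self_mem_desc p) hwp hw.2
      rw [mem_up] at this
      exact absurd (le_max' _ w (mem_univ w)) (not_le.2 this.1)
    have h3 := degIn_le_of_le hc.le univ p
    have h4 := hc.le_degIn (by positivity) p
    push_cast at h4
    omega
  set p := min' _ hne with hp
  have hp4 : 4 ≤ #(desc G p) := by simpa using min'_mem _ hne
  have hmin : ∀ c < p, #(desc G c) ≤ 3 := by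
    intro c hcp
    by_contra! hcon
    exact absurd (min'_le _ c (by simpa [Nat.succ_le_iff] using hcon)) (not_le.2 hcp)
  refine ⟨p, le_antisymm ?_ hp4⟩
  by_contra! hcon
  have hR := card_erase_add_one (self_mem_desc (G := G) p)
  classical
  have hAne : ({A | IsClosedBelow G p A ∧ #A ≤ 3} : Finset (Finset V)).Nonempty :=
    ⟨∅, by simpa using isClosedBelow_empty p⟩
  obtain ⟨A, hA, hmax⟩ := exists_max_image _ card hAne
  simp only [mem_filter, mem_univ, true_and] at hA hmax
  have hex : ∀ B, IsClosedBelow G p B → #B < #((desc G p).erase p) →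
      ∃ C, IsClosedBelow G p C ∧ Disjoint B C ∧ 1 ≤ #C ∧ #C ≤ 3 := by
    intro B hB hlt
    have hne' : ((desc G p).erase p \ B).Nonempty := by
      by_contra he
      rw [not_nonempty_iff_eq_empty, sdiff_eq_empty_iff_subset] at he
      have := card_le_card he
      omega
    obtain ⟨c, hcp, hcl, hdisj⟩ := hB.exists_desc hG hne'
    exact ⟨_, hcl, hdisj, card_pos.2 ⟨c, self_mem_desc c⟩, hmin c hcp⟩
  -- By maximality `B` is no larger than `A` and the two do not fit into three vertices, so the
  -- sizes are `2, 2` or `3` and at most `3`.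
  obtain ⟨B, hB, hdisj, hB1, hB3⟩ := hex A hA.1 (by omega)
  have h1 := hmax B ⟨hB, hB3⟩
  have h2 : 3 < #A + #B := by
    by_contra! hle
    have hcu := card_union_of_disjoint hdisj
    have := hmax _ ⟨hA.1.union hB, by omega⟩
    omega
  by_cases h33 : #A = 3 ∧ #B = 3 ∧ D = 11 ∧ k = 12
  · obtain ⟨e1, e2, rfl, rfl⟩ := h33
    by_cases hall : (desc G p).erase p = A ∪ B
    · exact hA.1.false_of_whole hG hc hH hB hdisj e1 e2 hall
    · have hsub : A ∪ B ⊂ (desc G p).erase p :=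
        lt_of_le_of_ne (hA.1.union hB).sub (Ne.symm hall)
      obtain ⟨C, hC, hdC, hC1, hC3⟩ := hex _ (hA.1.union hB) (card_lt_card hsub)
      have hdAC : Disjoint A C := hdC.mono_left subset_union_left
      by_cases hC33 : #C = 3
      · exact hA.1.false_of_triple hG hc hH hB hC hdisj hdC e1 e2 hC33
      · exact hA.1.false_of_pair hG hD hkD hc hH hC hdAC (by omega)
  · exact hA.1.false_of_pair hG hD hkD hc hH hB hdisj (by omega)

end FourBlock

end Backbone

namespace Backbone

/-! ### Gains and colouring in two stages -/

section Stages

variable {V : Type*} [DecidableEq V]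

/-- The set `A` induces a connected graph: all its cuts are crossed by an edge. -/
def CutConnected (G : SimpleGraph V) (A : Finset V) : Prop :=
  ∀ K ⊆ A, K.Nonempty → K ≠ A → ∃ i ∈ K, ∃ j ∈ A \ K, G.Adj i j

variable [Fintype V]

/-- A forbidden colour at `i` that is out of range or forbidden twice. -/
def Gain (G H : SimpleGraph V) (M : ℤ) (Q : Finset V) (φ : V → ℤ) (i : V) : Prop :=
  ∃ y, y ∉ Q ∧ H.Adj i y ∧ ∃ ε : ℤ, (ε = 1 ∨ ε = -1) ∧
    (φ y + ε ∉ Ico 0 M ∨ ∃ z, z ∉ Q ∧ G.Adj i z ∧ φ z = φ y + ε)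

variable {G H : SimpleGraph V} [DecidableRel G.Adj] [DecidableRel H.Adj] {M : ℤ} {Q : Finset V}
  {φ : V → ℤ}

lemma Gain.mono {Q' : Finset V} {i : V} (h : Gain G H M Q φ i) (hQ : Q' ⊆ Q) :
    Gain G H M Q' φ i := by
  obtain ⟨y, hy, hiy, ε, hε, h⟩ := h
  refine ⟨y, fun h => hy (hQ h), hiy, ε, hε, h.imp_right ?_⟩
  rintro ⟨z, hz, h⟩
  exact ⟨z, fun h => hz (hQ h), h⟩

lemma Gain.card_resid {i : V} (h : Gain G H M Q φ i) (hM : 0 ≤ M) :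
    excess G H M Q i + degIn G Q i + degIn H Q i + 1 ≤ #(resid G H M Q φ i) := by
  obtain ⟨y, hy, hiy, ε, hε, h⟩ := h
  exact card_resid_of_gain hM Q φ i hy hiy ε hε h

lemma degIn_lt_of_adj {K Q : Finset V} (hK : K ⊆ Q) {i j : V} (hj : j ∈ Q \ K)
    (hij : G.Adj i j) : degIn G K i < degIn G Q i := by
  rw [mem_sdiff] at hj
  refine card_lt_card ?_
  rw [ssubset_iff_of_subset (filter_subset_filter _ hK)]
  exact ⟨j, by simp [hj.1, hij], by simp [hj.2]⟩

/-- The lists left by a colouring of the outside of `Q` are not degenerate. -/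
lemma IsCritical.false_of_degenerate (hc : IsCritical G H M)
    (hφ : IsListCol G H Qᶜ (fun _ => Ico 0 M) φ)
    (h : ∀ K ⊆ Q, K.Nonempty →
      ∃ j ∈ K, (degIn G K j : ℤ) + degIn H Q j + 1 ≤ #(resid G H M Q φ j)) : False := by
  obtain ⟨c, hcol⟩ := exists_isListCol_of_degenerate (L := resid G H M Q φ) (Q := Q) hc.le
    fun K hK hne => by
      obtain ⟨j, hj, h1⟩ := h K hK hne
      exact ⟨j, hj, by omega⟩
  exact hc.not_colorable (colorable_of_resid hc.le hφ hcol)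

/-- Nonnegative excess leaves lists at most one colour short of degeneracy. For `K = Q` the gain
supplies that colour, and for a proper `K` an edge of `G` leaving it does. -/
lemma IsCritical.false_of_gain (hc : IsCritical G H M) (hM : 0 ≤ M)
    (hφ : IsListCol G H Qᶜ (fun _ => Ico 0 M) φ) (hconn : CutConnected G Q)
    (h0 : ∀ i ∈ Q, 0 ≤ excess G H M Q i) {i : V} (hi : i ∈ Q) (hg : Gain G H M Q φ i) :
    False := by
  refine hc.false_of_degenerate hφ fun K hK hne => ?_
  by_cases hKQ : K = Q
  · subst hKQ
    have := hg.card_resid hM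
    have := h0 i hi
    exact ⟨i, hi, by omega⟩
  · obtain ⟨j, hj, w, hw, hjw⟩ := hconn K hK hne hKQ
    have h1 := card_resid (G := G) (H := H) hM Q φ j
    have h2 := h0 j (hK hj)
    have h3 := degIn_lt_of_adj hK hw hjw
    exact ⟨j, hj, by omega⟩

lemma excess_eq_sub {J Q : Finset V} (hJ : J ⊆ Q) (i : V) :
    excess G H M (Q \ J) i = excess G H M Q i - degIn H J i := by
  have := degIn_add_sdiff (G := H) hJ i
  unfold excess
  omega

/-- Colouring in two stages, first `J` and then the rest of `Q`. -/
lemma IsCritical.false_of_two_stages (hc : IsCritical G H M) (hM : 0 ≤ M) {J : Finset V}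
    (hJQ : J ⊆ Q) (hne : (Q \ J).Nonempty) (hJ : CutConnected G J)
    (hQJ : CutConnected G (Q \ J)) (hedge : ∃ i ∈ Q \ J, ∃ j ∈ J, H.Adj i j)
    (htJ : ∀ i ∈ J, 0 ≤ excess G H M Q i + degIn G (Q \ J) i)
    (htQ : ∀ i ∈ Q \ J, (degIn H J i : ℤ) ≤ excess G H M Q i)
    (hgain : ∀ φ, IsListCol G H Qᶜ (fun _ => Ico 0 M) φ → ∃ i ∈ Q, Gain G H M Q φ i) :
    False := by
  -- Here `φ` colours `J` too. If its restriction to the outside of `Q` has a gain in `J`, all of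
  -- `Q` is recoloured at once; if the gain is in `Q \ J`, the colours on `J` are kept.
  obtain ⟨φ, hφ⟩ := hc.exists_coloring hne
  have hφ' : IsListCol G H Qᶜ (fun _ => Ico 0 M) φ :=
    hφ.mono (compl_subset_compl.2 sdiff_subset)
  obtain ⟨i, hi, hg⟩ := hgain φ hφ'
  by_cases hiJ : i ∈ J
  · refine hc.false_of_degenerate hφ' fun K hK hKne => ?_
    have hcard := fun j => card_resid (G := G) (H := H) hM Q φ j
    by_cases h1 : Q \ J ⊆ K
    · obtain ⟨w, hw, j, hj, hwj⟩ := hedge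
      have h2 := htQ w hw
      have h3 : 0 < degIn H J w := card_pos.2 ⟨j, by simp [hj, hwj]⟩
      have h4 := degIn_mono (G := G) hK w
      have h5 := hcard w
      exact ⟨w, h1 hw, by omega⟩
    by_cases h2 : (K ∩ (Q \ J)).Nonempty
    · obtain ⟨j, hj, w, hw, hjw⟩ := hQJ (K ∩ (Q \ J)) inter_subset_right h2
        (fun e => h1 (inter_eq_right.1 e))
      rw [mem_inter] at hj
      have h3 := htQ j hj.2
      have h4 : w ∈ Q \ K := by
        rw [mem_sdiff] at hw ⊢
        exact ⟨(mem_sdiff.1 hw.1).1, fun h => hw.2 (mem_inter.2 ⟨h, hw.1⟩)⟩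
      have h5 := degIn_lt_of_adj hK h4 hjw
      have h6 := hcard j
      exact ⟨j, hj.1, by omega⟩
    have hKJ : K ⊆ J := fun w hw => by
      by_contra hwJ
      exact h2 ⟨w, mem_inter.2 ⟨hw, mem_sdiff.2 ⟨hK hw, hwJ⟩⟩⟩
    by_cases hKJ' : K = J
    · subst hKJ'
      have h3 := hg.card_resid hM
      have h4 := htJ i hiJ
      have h5 := degIn_add_sdiff (G := G) hK i
      exact ⟨i, hiJ, by omega⟩
    · obtain ⟨j, hj, w, hw, hjw⟩ := hJ K hKJ hKne hKJ'
      have h3 := htJ j (hKJ hj)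
      have h4 := degIn_lt_of_adj hKJ hw hjw
      have h5 := degIn_add_sdiff (G := G) hJQ j
      have h6 := hcard j
      exact ⟨j, hj, by omega⟩
  · refine hc.false_of_gain hM hφ hQJ ?_ (mem_sdiff.2 ⟨hi, hiJ⟩) (hg.mono sdiff_subset)
    intro j hj
    rw [excess_eq_sub hJQ]
    have := htQ j hj
    omega

/-- If a stuck set `J` leaves a set of potential zero, the excesses are known. -/
lemma IsCritical.excess_eq_of_stuck (hc : IsCritical G H M) (hM : 0 ≤ M) {J : Finset V}
    (hJ : J ⊆ Q) (hne : (Q \ J).Nonempty)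
    (hst : ∀ i ∈ J, excess G H M Q i + degIn G (Q \ J) i ≤ 0)
    (hpot : 0 ≤ pot G H M Q + cross G H J (Q \ J)) (hconn : CutConnected (G \ H) (Q \ J)) :
    (∀ i ∈ J, excess G H M Q i + degIn G (Q \ J) i = 0) ∧
      ∀ i ∈ Q \ J, excess G H M Q i = degIn H J i := by
  have h1 := hc.pot_nonpos hM hne
  have h2 := pot_sdiff_ge hJ hst
  have hsum : ∑ i ∈ J, (excess G H M Q i + (degIn G (Q \ J) i : ℤ)) = 0 := by
    have h3 := pot_sdiff (G := G) (H := H) (M := M) hJ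
    have h4 : cross G H J (Q \ J) = ∑ i ∈ J, (degIn G (Q \ J) i : ℤ) -
      ∑ i ∈ J, (degIn H (Q \ J) i : ℤ) := sum_sub_distrib _ _
    rw [sum_add_distrib]
    have h5 := sum_nonpos hst
    rw [sum_add_distrib] at h5
    linarith
  refine ⟨(sum_eq_zero_iff_of_nonpos hst).1 hsum, ?_⟩
  -- A proper stuck subset of `Q \ J` would have a cut edge outside of the backbone, and deleting it
  -- would make the potential positive.
  obtain ⟨J', hJ', hJ'ne, hst'⟩ := hc.exists_stuck hM hne
  have hJ'eq : J' = Q \ J := by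
    by_contra hcon
    obtain ⟨i, hi, j, hj, hij⟩ := hconn J' hJ' hJ'ne hcon
    have h6 := pot_sdiff_ge hJ' hst'
    have h7 := hc.pot_nonpos hM (S := (Q \ J) \ J') ⟨j, hj⟩
    have h8 : 0 < cross G H J' ((Q \ J) \ J') := by
      refine sum_pos' (fun w _ => ?_) ⟨i, hi, ?_⟩
      · have := degIn_le_of_le hc.le ((Q \ J) \ J') w
        omega
      · have : degIn H ((Q \ J) \ J') i < degIn G ((Q \ J) \ J') i := by
          refine card_lt_card ?_
          rw [ssubset_iff_of_subset (fun w hw => by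
            simp only [mem_filter] at hw ⊢
            exact ⟨hw.1, hc.le hw.2⟩)]
          rw [SimpleGraph.sdiff_adj] at hij
          exact ⟨j, mem_filter.2 ⟨hj, hij.1⟩, fun h => hij.2 (mem_filter.1 h).2⟩
        omega
    linarith
  subst hJ'eq
  have h9 : ∀ i ∈ Q \ J, excess G H M (Q \ J) i ≤ 0 := fun i hi => by
    have := hst' i hi
    omega
  have h10 : ∑ i ∈ Q \ J, excess G H M (Q \ J) i = 0 := le_antisymm h1 (by
    change 0 ≤ pot G H M (Q \ J)
    linarith)
  intro i hi
  have := (sum_eq_zero_iff_of_nonpos h9).1 h10 i hi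
  rw [excess_eq_sub hJ] at this
  omega

end Stages

end Backbone

namespace Backbone

/-! ### List colouring on four vertices -/

section FourLists

lemma exists_far {C : Finset ℤ} (hC : 4 ≤ #C) (d : ℤ) : ∃ c ∈ C, 2 ≤ |c - d| := by
  by_contra! hcon
  have hsub : C ⊆ Icc (d - 1) (d + 1) := fun c hc => by
    have := hcon c hc
    rw [abs_lt] at this
    rw [mem_Icc]
    omega
  have := card_le_card hsub
  rw [Int.card_Icc] at this
  omega

lemma exists_eq_four {A : Finset ℤ} (hA : #A = 4) :
    ∃ a b c d, a < b ∧ b < c ∧ c < d ∧ A = {a, b, c, d} := by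
  let f := A.orderEmbOfFin hA
  refine ⟨f 0, f 1, f 2, f 3, f.strictMono (by decide), f.strictMono (by decide),
    f.strictMono (by decide), ?_⟩
  ext x
  have : x ∈ A ↔ ∃ i, f i = x := by
    rw [← Set.mem_range, A.range_orderEmbOfFin hA, mem_coe]
  rw [this]
  simp only [Fin.exists_fin_succ, mem_insert, mem_singleton]
  simp [eq_comm]

/-- Two sets of colours without a pair at distance two. -/
lemma exists_eq_pair {A B : Finset ℤ} (hA : 2 ≤ #A) (hB : 2 ≤ #B)
    (h : ∀ a ∈ A, ∀ b ∈ B, |a - b| < 2) : ∃ z, A = {z, z + 1} := by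
  obtain ⟨a, ha, a', ha', hne⟩ := one_lt_card.1 (show 1 < #A by omega)
  obtain ⟨b, hb, b', hb', hne'⟩ := one_lt_card.1 (show 1 < #B by omega)
  simp only [abs_lt] at h
  have h1 := h a ha b hb
  have h2 := h a ha b' hb'
  have h3 := h a' ha' b hb
  have h4 := h a' ha' b' hb'
  refine ⟨min a a', ?_⟩
  ext x
  simp only [mem_insert, mem_singleton]
  constructor
  · intro hx
    have := h x hx b hb
    have := h x hx b' hb'
    omega
  · rintro (hx | hx)
    · rcases min_choice a a' with e | e <;> rw [hx, e] <;> assumption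
    · rcases lt_or_gt_of_ne hne with e | e
      · have : x = a' := by omega
        exact this ▸ ha'
      · have : x = a := by omega
        exact this ▸ ha

/-- Lists for the complete graph with a perfect matching as backbone. -/
lemma exists_colors_of_complete {A B C D : Finset ℤ} (hA : 4 ≤ #A) (hB : 4 ≤ #B) (hC : 4 ≤ #C)
    (hD : 3 ≤ #D) : ∃ a ∈ A, ∃ b ∈ B, ∃ c ∈ C, ∃ d ∈ D, 2 ≤ |a - b| ∧ 2 ≤ |c - d| ∧
      a ≠ c ∧ a ≠ d ∧ b ≠ c ∧ b ≠ d := by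
  by_contra! hcon
  -- After `c` and `d` are taken, `A` and `B` keep at least two colours each but no pair at distance
  -- two. This forces two consecutive colours to remain in `A`.
  have key : ∀ c ∈ C, ∀ d ∈ D, 2 ≤ |c - d| → #A = 4 ∧ c ∈ A ∧ d ∈ A ∧
      ∃ z, A \ {c, d} = {z, z + 1} := by
    intro c hc d hd hcd
    have hA' := le_card_sdiff {c, d} A
    have hB' := le_card_sdiff {c, d} B
    have h2 := card_le_two (a := c) (b := d)
    obtain ⟨z, hz⟩ := exists_eq_pair (A := A \ {c, d}) (B := B \ {c, d}) (by omega) (by omega) (by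
      intro a ha b hb
      simp only [mem_sdiff, mem_insert, mem_singleton, not_or] at ha hb
      by_contra! hab
      exact hb.2.2 (hcon a ha.1 b hb.1 c hc d hd hab hcd ha.2.1 ha.2.2 hb.2.1))
    have hzc : #({z, z + 1} : Finset ℤ) ≤ 2 := card_le_two
    have hi := card_sdiff_add_card_inter A {c, d}
    rw [hz] at hi
    have hi' := card_le_card (inter_subset_right (s₁ := A) (s₂ := {c, d}))
    have heq : A ∩ {c, d} = {c, d} := eq_of_subset_of_card_le inter_subset_right (by omega)
    have hsub : {c, d} ⊆ A := inter_eq_right.1 heq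
    exact ⟨by omega, hsub (by simp), hsub (by simp), z, hz⟩
  have hDA : ∀ d ∈ D, d ∈ A := fun d hd => by
    obtain ⟨c, hc, hcd⟩ := exists_far hC d
    exact (key c hc d hd hcd).2.2.1
  have hCA : 3 ≤ #(C ∩ A) := by
    by_contra! hlt
    have h1 := card_sdiff_add_card_inter C A
    obtain ⟨c, hc, c', hc', hne⟩ := one_lt_card.1 (show 1 < #(C \ A) by omega)
    rw [mem_sdiff] at hc hc'
    have hsub : ∀ c ∈ C, c ∉ A → D ⊆ Icc (c - 1) (c + 1) := fun c hc hcA d hd => by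
      by_contra hcd
      refine hcA (key c hc d hd ?_).2.1
      rw [mem_Icc] at hcd
      rw [le_abs]
      omega
    have h2 : D ⊆ Icc (c - 1) (c + 1) ∩ Icc (c' - 1) (c' + 1) :=
      subset_inter (hsub c hc.1 hc.2) (hsub c' hc'.1 hc'.2)
    have h3 : Icc (c - 1) (c + 1) ∩ Icc (c' - 1) (c' + 1) ⊆ Icc (max c c' - 1) (min c c' + 1) := by
      intro x hx
      simp only [mem_inter, mem_Icc] at hx ⊢
      omega
    have h4 := card_le_card (h2.trans h3)
    rw [Int.card_Icc] at h4
    omega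
  obtain ⟨d₀, hd₀⟩ := card_pos.1 (show 0 < #D by omega)
  obtain ⟨c₀, hc₀, hcd₀⟩ := exists_far hC d₀
  obtain ⟨l₁, l₂, l₃, l₄, h12, h23, h34, rfl⟩ := exists_eq_four (key c₀ hc₀ d₀ hd₀ hcd₀).1
  -- Such a pair is far apart but leaves two colours of `A` that are not consecutive.
  have hno : ∀ c ∈ C, ∀ d ∈ D, (c = l₁ ∧ d = l₃) ∨ (c = l₃ ∧ d = l₁) ∨ (c = l₂ ∧ d = l₄) ∨
      (c = l₄ ∧ d = l₂) → False := by
    intro c hc d hd h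
    obtain ⟨-, -, -, z, hz⟩ := key c hc d hd (by rw [le_abs]; omega)
    have hx : ∀ x ∈ ({l₁, l₂, l₃, l₄} : Finset ℤ), x ≠ c → x ≠ d → x = z ∨ x = z + 1 := by
      intro x hx h1 h2
      have : x ∈ ({l₁, l₂, l₃, l₄} : Finset ℤ) \ {c, d} := by
        rw [mem_sdiff]
        exact ⟨hx, by simp [h1, h2]⟩
      rw [hz] at this
      simpa using this
    have e1 := hx l₁ (by simp)
    have e2 := hx l₂ (by simp)
    have e3 := hx l₃ (by simp)
    have e4 := hx l₄ (by simp)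
    omega
  have hmiss : ∀ x ∈ ({l₁, l₂, l₃, l₄} : Finset ℤ), ∀ y ∈ ({l₁, l₂, l₃, l₄} : Finset ℤ), x ≠ y →
      ∀ E : Finset ℤ, E ⊆ {l₁, l₂, l₃, l₄} → x ∉ E → y ∉ E → #E ≤ 2 := by
    intro x hx y hy hxy E hE hxE hyE
    have h1 : E ⊆ ({l₁, l₂, l₃, l₄} \ {x, y} : Finset ℤ) := fun e he => by
      rw [mem_sdiff]
      refine ⟨hE he, ?_⟩
      rw [mem_insert, mem_singleton]
      rintro (rfl | rfl)
      · exact hxE he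
      · exact hyE he
    have h2 := card_le_card h1
    rw [card_sdiff_of_subset (by
      intro e he
      rcases mem_insert.1 he with rfl | he
      · exact hx
      · rw [mem_singleton.1 he]; exact hy), card_pair hxy] at h2
    have h3 := (key c₀ hc₀ d₀ hd₀ hcd₀).1
    omega
  have hmissC : ∀ x ∈ ({l₁, l₂, l₃, l₄} : Finset ℤ), ∀ y ∈ ({l₁, l₂, l₃, l₄} : Finset ℤ), x ≠ y →
      x ∈ C ∨ y ∈ C := by
    intro x hx y hy hxy
    by_contra! h
    have := hmiss x hx y hy hxy (C ∩ _) inter_subset_right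
      (fun e => h.1 (mem_inter.1 e).1) (fun e => h.2 (mem_inter.1 e).1)
    omega
  have hmissD : ∀ x ∈ ({l₁, l₂, l₃, l₄} : Finset ℤ), ∀ y ∈ ({l₁, l₂, l₃, l₄} : Finset ℤ), x ≠ y →
      x ∈ D ∨ y ∈ D := by
    intro x hx y hy hxy
    by_contra! h
    have := hmiss x hx y hy hxy D hDA h.1 h.2
    omega
  -- As `C` omits at most one of the four colours, `D` omits one of `l₁`, `l₃` and one of `l₂`,
  -- `l₄`. But `D` has three of the four.
  have m13 : l₁ ∉ D ∨ l₃ ∉ D := by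
    rcases hmissC l₁ (by simp) l₃ (by simp) (by omega) with h | h
    · exact Or.inr fun h' => hno _ h _ h' (by simp)
    · exact Or.inl fun h' => hno _ h _ h' (by simp)
  have m24 : l₂ ∉ D ∨ l₄ ∉ D := by
    rcases hmissC l₂ (by simp) l₄ (by simp) (by omega) with h | h
    · exact Or.inr fun h' => hno _ h _ h' (by simp)
    · exact Or.inl fun h' => hno _ h _ h' (by simp)
  rcases m13 with h | h <;> rcases m24 with h' | h'
  · rcases hmissD l₁ (by simp) l₂ (by simp) (by omega) with e | e <;> contradiction
  · rcases hmissD l₁ (by simp) l₄ (by simp) (by omega) with e | e <;> contradiction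
  · rcases hmissD l₃ (by simp) l₂ (by simp) (by omega) with e | e <;> contradiction
  · rcases hmissD l₃ (by simp) l₄ (by simp) (by omega) with e | e <;> contradiction

/-- A colour `b` far from `m` is near at most one colour of `A`, so for each `d` the obstruction
lies in `C`. Then at least three `d` are near two distinct `c`, although at most two integers can
be. -/
lemma false_of_middle {A B C D : Finset ℤ} (hA : 3 ≤ #A) (hB : 4 ≤ #B) (hC : 3 ≤ #C)
    (hD : 4 ≤ #D) {m : ℤ} (hm : A ⊆ Icc (m - 1) (m + 1))
    (h : ∀ b ∈ B, ∀ d ∈ D, b ≠ d → (∀ a ∈ A, |a - b| < 2 ∨ a = d) ∨ ∀ c ∈ C, |c - d| < 2 ∨ c = b) :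
    False := by
  have hAm : A = Icc (m - 1) (m + 1) := eq_of_subset_of_card_le hm (by rw [Int.card_Icc]; omega)
  obtain ⟨b, hb, hbm⟩ := exists_far hB m
  have h1 : ∀ d ∈ D, b ≠ d → ∀ c ∈ C, |c - d| < 2 ∨ c = b := by
    intro d hd hbd
    refine (h b hb d hd hbd).resolve_left fun hcon => ?_
    have e1 := hcon (m - 1) (by rw [hAm, mem_Icc]; omega)
    have e2 := hcon m (by rw [hAm, mem_Icc]; omega)
    have e3 := hcon (m + 1) (by rw [hAm, mem_Icc]; omega)
    simp only [abs_lt, le_abs] at e1 e2 e3 hbm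
    omega
  have hD' : 3 ≤ #(D.erase b) := by
    have := pred_card_le_card_erase (s := D) (a := b)
    omega
  have hC' : 2 ≤ #(C.erase b) := by
    have := pred_card_le_card_erase (s := C) (a := b)
    omega
  obtain ⟨c, hc, c', hc', hne⟩ := one_lt_card.1 (show 1 < #(C.erase b) by omega)
  rw [mem_erase] at hc hc'
  have hsub : D.erase b ⊆ Icc (max c c' - 1) (min c c' + 1) := by
    intro d hd
    rw [mem_erase] at hd
    have e1 := h1 d hd.2 hd.1.symm c hc.2
    have e2 := h1 d hd.2 hd.1.symm c' hc'.2
    simp only [abs_lt] at e1 e2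
    rw [mem_Icc]
    omega
  have := card_le_card hsub
  rw [Int.card_Icc] at this
  omega

/-- Lists for the complete graph without an edge, with a perfect matching as backbone. -/
lemma exists_colors_of_diamond {A B C D : Finset ℤ} (hA : 3 ≤ #A) (hB : 4 ≤ #B) (hC : 3 ≤ #C)
    (hD : 4 ≤ #D) : ∃ a ∈ A, ∃ b ∈ B, ∃ c ∈ C, ∃ d ∈ D, 2 ≤ |a - b| ∧ 2 ≤ |c - d| ∧
      a ≠ d ∧ b ≠ c ∧ b ≠ d := by
  by_contra! hcon
  have h : ∀ b ∈ B, ∀ d ∈ D, b ≠ d →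
      (∀ a ∈ A, |a - b| < 2 ∨ a = d) ∨ ∀ c ∈ C, |c - d| < 2 ∨ c = b := by
    intro b hb d hd hbd
    by_contra! h'
    obtain ⟨⟨a, ha, hab, had⟩, c, hc, hcd, hcb⟩ := h'
    exact hbd (hcon a ha b hb c hc d hd hab hcd had hcb.symm)
  by_cases hm : ∃ m, A ⊆ Icc (m - 1) (m + 1)
  · obtain ⟨m, hm⟩ := hm
    exact false_of_middle hA hB hC hD hm h
  by_cases hm' : ∃ m, C ⊆ Icc (m - 1) (m + 1)
  · obtain ⟨m, hm'⟩ := hm'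
    exact false_of_middle hC hD hA hB hm' fun d hd b hb hne => (h b hb d hd hne.symm).symm
  have hfar : ∀ E : Finset ℤ, (¬ ∃ m, E ⊆ Icc (m - 1) (m + 1)) → ∀ b, ∃ a ∈ E, 2 ≤ |a - b| := by
    intro E hE b
    by_contra! hb
    refine hE ⟨b, fun a ha => ?_⟩
    have := hb a ha
    rw [abs_lt] at this
    rw [mem_Icc]
    omega
  -- With far colours `f b` and `g d`, every `d` outside `{b, f b}` satisfies `g d = b`. Hence the
  -- sets `D \ {b, f b}` are disjoint for three `b`, too much for `#D ≥ 4`.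
  choose f hfA hf using hfar A hm
  choose g hgC hg using hfar C hm'
  have hD' : ∀ b ∈ B, ∀ d ∈ D, d ≠ b → d ≠ f b → b = g d := by
    intro b hb d hd hdb hdf
    rcases h b hb d hd hdb.symm with h' | h'
    · rcases h' (f b) (hfA b) with e | e
      · exact absurd (hf b) (not_le.2 e)
      · exact absurd e.symm hdf
    · rcases h' (g d) (hgC d) with e | e
      · exact absurd (hg d) (not_le.2 e)
      · exact e.symm
  obtain ⟨b₁, h1, b₂, h2, b₃, h3, h12, h13, h23⟩ := two_lt_card.1 (show 2 < #B by omega)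
  have hcard : ∀ b, #D ≤ #((D.erase b).erase (f b)) + 2 := by
    intro b
    have e1 := pred_card_le_card_erase (s := D) (a := b)
    have e2 := pred_card_le_card_erase (s := D.erase b) (a := f b)
    omega
  have hmem : ∀ b ∈ B, ∀ d ∈ (D.erase b).erase (f b), b = g d := by
    intro b hb d hd
    simp only [mem_erase] at hd
    exact hD' b hb d hd.2.2 hd.2.1 hd.1
  have hdisj : ∀ b ∈ B, ∀ b' ∈ B, b ≠ b' →
      Disjoint ((D.erase b).erase (f b)) ((D.erase b').erase (f b')) := by
    intro b hb b' hb' hne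
    refine disjoint_left.2 fun d hd hd' => hne ?_
    rw [hmem b hb d hd, hmem b' hb' d hd']
  have hu := card_le_card (show (D.erase b₁).erase (f b₁) ∪ (D.erase b₂).erase (f b₂) ∪
      (D.erase b₃).erase (f b₃) ⊆ D from by
    intro d hd
    simp only [mem_union, mem_erase] at hd
    tauto)
  rw [card_union_of_disjoint (disjoint_union_left.2 ⟨hdisj _ h1 _ h3 h13, hdisj _ h2 _ h3 h23⟩),
    card_union_of_disjoint (hdisj _ h1 _ h2 h12)] at hu
  have := hcard b₁
  have := hcard b₂
  have := hcard b₃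
  omega

end FourLists

/-! ### Large sets of used colours -/

section UsedColors

/-- Sets of half of the colours contain two consecutive ones or an extreme one. If only one
pair of consecutive colours is used, no two consecutive colours are free. -/
lemma mem_or_mem_of_consecutive {C : Finset ℤ} {M c₀ : ℤ} (hC : C ⊆ Ico 0 M) (hM : M ≤ 2 * #C)
    (h0 : 0 ∉ C) (h1 : M - 1 ∉ C) (hc₀ : ∀ c ∈ C, c + 1 ∈ C → c = c₀) :
    ∀ a, 1 ≤ a → a < M → a ∈ C ∨ a - 1 ∈ C := by
  have hdisj : Disjoint C ((C.erase c₀).image (· + 1)) := by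
    refine disjoint_left.2 fun c hc hc' => ?_
    obtain ⟨b, hb, rfl⟩ := mem_image.1 hc'
    rw [mem_erase] at hb
    exact hb.1 (hc₀ b hb.2 hc)
  have hsub : C ∪ (C.erase c₀).image (· + 1) ⊆ Ico 1 M := by
    intro c hc
    rw [mem_Ico]
    rcases mem_union.1 hc with hc | hc
    · have e1 := mem_Ico.1 (hC hc)
      have e2 : c ≠ 0 := fun e => h0 (e ▸ hc)
      omega
    · obtain ⟨b, hb, rfl⟩ := mem_image.1 hc
      have hb := (mem_erase.1 hb).2
      have e1 := mem_Ico.1 (hC hb)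
      have e2 : b ≠ M - 1 := fun e => h1 (e ▸ hb)
      omega
  have hcard := card_union_of_disjoint hdisj
  rw [card_image_of_injective _ (add_left_injective 1)] at hcard
  have h2 := pred_card_le_card_erase (s := C) (a := c₀)
  have heq : C ∪ (C.erase c₀).image (· + 1) = Ico 1 M :=
    eq_of_subset_of_card_le hsub (by rw [Int.card_Ico]; omega)
  intro a ha haM
  have hmem : a ∈ C ∪ (C.erase c₀).image (· + 1) := heq ▸ mem_Ico.2 ⟨ha, haM⟩
  rcases mem_union.1 hmem with h | h
  · exact Or.inl h
  · obtain ⟨b, hb, rfl⟩ := mem_image.1 h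
    exact Or.inr (by simpa using (mem_erase.1 hb).2)

/-- Otherwise `C` and the shift of `C \ {c₀}` are disjoint, and their `2 * #C - 1` or more elements
do not fit between `1` and `M - 1`. -/
lemma exists_second_consecutive {C : Finset ℤ} {M c₀ : ℤ} (hC : C ⊆ Ico 0 M) (hM : M < 2 * #C)
    (hM1 : 1 ≤ M) (h0 : 0 ∉ C) (h1 : M - 1 ∉ C) : ∃ c ∈ C, c + 1 ∈ C ∧ c ≠ c₀ := by
  by_contra! hcon
  have hdisj : Disjoint C ((C.erase c₀).image (· + 1)) := by
    refine disjoint_left.2 fun c hc hc' => ?_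
    obtain ⟨b, hb, rfl⟩ := mem_image.1 hc'
    rw [mem_erase] at hb
    exact hb.1 (hcon b hb.2 hc)
  have hsub : C ∪ (C.erase c₀).image (· + 1) ⊆ Ico 1 M := by
    intro c hc
    rw [mem_Ico]
    rcases mem_union.1 hc with hc | hc
    · have e1 := mem_Ico.1 (hC hc)
      have e2 : c ≠ 0 := fun e => h0 (e ▸ hc)
      omega
    · obtain ⟨b, hb, rfl⟩ := mem_image.1 hc
      have hb := (mem_erase.1 hb).2
      have e1 := mem_Ico.1 (hC hb)
      have e2 : b ≠ M - 1 := fun e => h1 (e ▸ hb)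
      omega
  have hcard := card_union_of_disjoint hdisj
  rw [card_image_of_injective _ (add_left_injective 1)] at hcard
  have h2 := pred_card_le_card_erase (s := C) (a := c₀)
  have h3 := card_le_card hsub
  rw [Int.card_Ico] at h3
  omega

lemma exists_consecutive {C : Finset ℤ} {M : ℤ} (hC : C ⊆ Ico 0 M) (hM : M ≤ 2 * #C)
    (hne : C.Nonempty) (h0 : 0 ∉ C) (h1 : M - 1 ∉ C) : ∃ c ∈ C, c + 1 ∈ C := by
  by_contra! hcon
  obtain ⟨b, hb⟩ := hne
  have hdisj : Disjoint C (C.image (· + 1)) := by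
    refine disjoint_left.2 fun c hc hc' => ?_
    obtain ⟨b, hb, rfl⟩ := mem_image.1 hc'
    exact hcon b hb hc
  have hsub : C ∪ C.image (· + 1) ⊆ Ico 1 M := by
    intro c hc
    rw [mem_Ico]
    rcases mem_union.1 hc with hc | hc
    · have e1 := mem_Ico.1 (hC hc)
      have e2 : c ≠ 0 := fun e => h0 (e ▸ hc)
      omega
    · obtain ⟨b, hb, rfl⟩ := mem_image.1 hc
      have e1 := mem_Ico.1 (hC hb)
      have e2 : b ≠ M - 1 := fun e => h1 (e ▸ hb)
      omega
  have hcard := card_union_of_disjoint hdisj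
  rw [card_image_of_injective _ (add_left_injective 1)] at hcard
  have h3 := card_le_card hsub
  rw [Int.card_Ico] at h3
  have := mem_Ico.1 (hC hb)
  omega

end UsedColors

end Backbone

namespace Backbone

/-! ### Cuts of the possible four-vertex graphs -/

section Cuts

variable {V : Type*} [DecidableEq V] [Fintype V]

/-- All cuts of `Q` have at least `n` edges outside of the backbone, and the smallest cuts are
well connected. -/
def HasCuts (G H : SimpleGraph V) [DecidableRel G.Adj] [DecidableRel H.Adj] (Q : Finset V)
    (n : ℤ) : Prop :=
  ∀ J ⊆ Q, J.Nonempty → J ≠ Q → n ≤ cross G H J (Q \ J) ∧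
    (cross G H J (Q \ J) = n → CutConnected (G \ H) (Q \ J) ∧ CutConnected G (Q \ J) ∧
      CutConnected G J ∧ ∃ i ∈ Q \ J, ∃ j ∈ J, H.Adj i j)

variable {G H : SimpleGraph V} [DecidableRel G.Adj] [DecidableRel H.Adj] {M : ℤ} {Q : Finset V}
  {n : ℤ}

lemma sdiff_nonempty_of_subset_of_ne {J : Finset V} (hJ : J ⊆ Q) (h : J ≠ Q) :
    (Q \ J).Nonempty :=
  sdiff_nonempty.2 fun h' => h (hJ.antisymm h')

/-- The excesses when a proper subset is stuck. -/
lemma IsCritical.excess_eq_of_hasCuts (hc : IsCritical G H M) (hM : 0 ≤ M)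
    (hcut : HasCuts G H Q n) (hpot : pot G H M Q = -n) {J : Finset V} (hJ : J ⊆ Q)
    (hne : J.Nonempty) (hJQ : J ≠ Q)
    (hst : ∀ i ∈ J, excess G H M Q i + degIn G (Q \ J) i ≤ 0) :
    ((∀ i ∈ J, excess G H M Q i + degIn G (Q \ J) i = 0) ∧
      ∀ i ∈ Q \ J, excess G H M Q i = degIn H J i) ∧ CutConnected G (Q \ J) ∧
      CutConnected G J ∧ ∃ i ∈ Q \ J, ∃ j ∈ J, H.Adj i j := by
  have hne' := sdiff_nonempty_of_subset_of_ne hJ hJQ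
  obtain ⟨h1, h2⟩ := hcut J hJ hne hJQ
  have h3 := pot_sdiff_ge hJ hst
  have h4 := hc.pot_nonpos hM hne'
  obtain ⟨h5, h6⟩ := h2 (by linarith)
  exact ⟨hc.excess_eq_of_stuck hM hJ hne' hst (by linarith) h5, h6⟩

/-- If there always is a gain, only the whole set can be stuck. -/
lemma IsCritical.excess_nonpos_of_hasCuts (hc : IsCritical G H M) (hM : 0 ≤ M)
    (hcut : HasCuts G H Q n) (hQ : Q.Nonempty) (hpot : pot G H M Q = -n)
    (hgain : ∀ φ, IsListCol G H Qᶜ (fun _ => Ico 0 M) φ → ∃ i ∈ Q, Gain G H M Q φ i) :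
    ∀ i ∈ Q, excess G H M Q i ≤ 0 := by
  obtain ⟨J, hJ, hne, hst⟩ := hc.exists_stuck hM hQ
  by_cases hJQ : J = Q
  · subst hJQ
    intro i hi
    have := hst i hi
    omega
  obtain ⟨⟨h1, h2⟩, h3, h4, h5⟩ := hc.excess_eq_of_hasCuts hM hcut hpot hJ hne hJQ hst
  exact (hc.false_of_two_stages hM hJ (sdiff_nonempty_of_subset_of_ne hJ hJQ) h4 h3 h5
    (fun i hi => (h1 i hi).ge) (fun i hi => (h2 i hi).ge) hgain).elim

/-- Without a gain this holds when the potential exceeds the bound. -/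
lemma IsCritical.excess_nonpos_of_lt (hc : IsCritical G H M) (hM : 0 ≤ M)
    (hcut : HasCuts G H Q n) (hQ : Q.Nonempty) (hpot : -n < pot G H M Q) :
    ∀ i ∈ Q, excess G H M Q i ≤ 0 := by
  obtain ⟨J, hJ, hne, hst⟩ := hc.exists_stuck hM hQ
  by_cases hJQ : J = Q
  · subst hJQ
    intro i hi
    have := hst i hi
    omega
  have h1 := (hcut J hJ hne hJQ).1
  have h3 := pot_sdiff_ge hJ hst
  have h4 := hc.pot_nonpos hM (sdiff_nonempty_of_subset_of_ne hJ hJQ)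
  linarith

variable {g h : SimpleGraph (Fin 4)} [DecidableRel g.Adj] [DecidableRel h.Adj]

lemma CutConnected.map {q : Fin 4 ↪ V} (hg : ∀ i j, G.Adj (q i) (q j) ↔ g.Adj i j)
    {A : Finset (Fin 4)} (hA : CutConnected g A) : CutConnected G (A.map q) := by
  intro K hK hne hKA
  obtain ⟨K', hK', rfl⟩ := subset_map_iff.1 hK
  obtain ⟨i, hi, j, hj, hij⟩ := hA K' hK' (map_nonempty.1 hne) (fun e => hKA (by rw [e]))
  refine ⟨q i, mem_map_of_mem q hi, q j, ?_, (hg i j).2 hij⟩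
  rw [mem_sdiff, mem_map' q, mem_map' q]
  exact mem_sdiff.1 hj

lemma degIn_map {q : Fin 4 ↪ V} (hg : ∀ i j, G.Adj (q i) (q j) ↔ g.Adj i j)
    (K : Finset (Fin 4)) (i : Fin 4) : degIn G (K.map q) (q i) = degIn g K i := by
  unfold degIn
  rw [filter_map, card_map]
  congr 1
  ext j
  simp [hg]

lemma map_sdiff_map (q : Fin 4 ↪ V) (J : Finset (Fin 4)) :
    univ.map q \ J.map q = (univ \ J).map q := by
  ext x
  simp only [mem_sdiff, mem_map, mem_univ, true_and]
  constructor
  · rintro ⟨⟨i, rfl⟩, h2⟩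
    exact ⟨i, fun hi => h2 ⟨i, hi, rfl⟩, rfl⟩
  · rintro ⟨i, hi, rfl⟩
    refine ⟨⟨i, rfl⟩, ?_⟩
    rintro ⟨j, hj, e⟩
    exact hi (q.injective e ▸ hj)

lemma HasCuts.map {q : Fin 4 ↪ V} (hg : ∀ i j, G.Adj (q i) (q j) ↔ g.Adj i j)
    (hh : ∀ i j, H.Adj (q i) (q j) ↔ h.Adj i j) (hc : HasCuts g h univ n) :
    HasCuts G H (univ.map q) n := by
  intro J hJ hne hJQ
  obtain ⟨J', hJ', rfl⟩ := subset_map_iff.1 hJ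
  obtain ⟨h1, h2⟩ := hc J' hJ' (map_nonempty.1 hne) (fun e => hJQ (by rw [e]))
  have hgh : ∀ i j, (G \ H).Adj (q i) (q j) ↔ (g \ h).Adj i j := fun i j => by
    rw [SimpleGraph.sdiff_adj, SimpleGraph.sdiff_adj, hg, hh]
  rw [map_sdiff_map]
  have hcr : cross G H (J'.map q) ((univ \ J').map q) = cross g h J' (univ \ J') := by
    unfold cross
    rw [sum_map]
    exact sum_congr rfl fun i _ => by rw [degIn_map hg, degIn_map hh]
  rw [hcr]
  refine ⟨h1, fun e => ?_⟩
  obtain ⟨c1, c2, c3, i, hi, j, hj, hij⟩ := h2 e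
  exact ⟨c1.map hgh, c2.map hg, c3.map hg, q i, mem_map_of_mem q hi, q j, mem_map_of_mem q hj,
    (hh i j).2 hij⟩

/-- The graph on four vertices with the perfect matching `01`, `23` and possibly the edges `02`,
`03`, `12`, `13`. -/
def fourGraph (a b c d : Bool) : SimpleGraph (Fin 4) where
  Adj i j := (![![false, true, a, b], ![true, false, c, d], ![a, c, false, true],
    ![b, d, true, false]] : Fin 4 → Fin 4 → Bool) i j = true
  symm := ⟨by revert a b c d; decide⟩
  loopless := ⟨by revert a b c d; decide⟩

instance (a b c d : Bool) : DecidableRel (fourGraph a b c d).Adj := fun i j =>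
  inferInstanceAs (Decidable ((![![false, true, a, b], ![true, false, c, d], ![a, c, false, true],
    ![b, d, true, false]] : Fin 4 → Fin 4 → Bool) i j = true))

instance : DecidableRel (g \ h).Adj := fun i j =>
  decidable_of_iff _ (SimpleGraph.sdiff_adj g h i j).symm

instance (A : Finset (Fin 4)) : Decidable (CutConnected g A) :=
  inferInstanceAs (Decidable (∀ K : Finset (Fin 4), K ⊆ A → K.Nonempty → K ≠ A →
    ∃ i ∈ K, ∃ j ∈ A \ K, g.Adj i j))

instance (Q : Finset (Fin 4)) : Decidable (HasCuts g h Q n) :=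
  inferInstanceAs (Decidable (∀ J : Finset (Fin 4), J ⊆ Q → J.Nonempty → J ≠ Q →
    n ≤ cross g h J (Q \ J) ∧
      (cross g h J (Q \ J) = n → CutConnected (g \ h) (Q \ J) ∧ CutConnected g (Q \ J) ∧
        CutConnected g J ∧ ∃ i ∈ Q \ J, ∃ j ∈ J, h.Adj i j)))

/-- Outside of the matching, the complete graph is a 4-cycle, the diamond a path, and the paw a path
on three vertices plus an isolated one. So minimum cuts are `2`, `1`, `0`, exactly the amounts by
which the potential can be negative. -/
lemma hasCuts_complete :
    HasCuts (fourGraph true true true true) (fourGraph false false false false) univ 2 := by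
  decide +kernel

lemma hasCuts_diamond :
    HasCuts (fourGraph false true true true) (fourGraph false false false false) univ 1 := by
  decide +kernel

lemma hasCuts_paw :
    HasCuts (fourGraph false false true true) (fourGraph false false false false) univ 0 := by
  decide +kernel

end Cuts

/-! ### Labelling a perfect matching on four vertices -/

section Labels

variable {V : Type*} [DecidableEq V] [Fintype V]

/-- The backbone on `Q` is the perfect matching `uv`, `xy`. -/
structure IsMatched (H : SimpleGraph V) (Q : Finset V) (u v x y : V) : Prop where
  eq : Q = {u, v, x, y}
  adj_uv : H.Adj u v
  adj_xy : H.Adj x y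
  not_ux : ¬ H.Adj u x
  not_uy : ¬ H.Adj u y
  not_vx : ¬ H.Adj v x
  not_vy : ¬ H.Adj v y
  ne_ux : u ≠ x
  ne_uy : u ≠ y
  ne_vx : v ≠ x
  ne_vy : v ≠ y

variable {G H : SimpleGraph V} [DecidableRel G.Adj] [DecidableRel H.Adj] {M : ℤ} {Q : Finset V}
  {u v x y : V}

lemma IsMatched.swap_left (h : IsMatched H Q u v x y) : IsMatched H Q v u x y :=
  ⟨by rw [h.eq, insert_comm], h.adj_uv.symm, h.adj_xy, h.not_vx, h.not_vy, h.not_ux, h.not_uy,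
    h.ne_vx, h.ne_vy, h.ne_ux, h.ne_uy⟩

lemma IsMatched.swap_right (h : IsMatched H Q u v x y) : IsMatched H Q u v y x :=
  ⟨by rw [h.eq, pair_comm], h.adj_uv, h.adj_xy.symm, h.not_uy, h.not_ux, h.not_vy, h.not_vx,
    h.ne_uy, h.ne_ux, h.ne_vy, h.ne_vx⟩

lemma IsMatched.swap (h : IsMatched H Q u v x y) : IsMatched H Q x y u v :=
  ⟨by rw [h.eq]; ext; simp only [mem_insert, mem_singleton]; tauto, h.adj_xy, h.adj_uv,
    fun e => h.not_ux e.symm, fun e => h.not_vx e.symm, fun e => h.not_uy e.symm,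
    fun e => h.not_vy e.symm, h.ne_ux.symm, h.ne_vx.symm, h.ne_uy.symm, h.ne_vy.symm⟩

lemma IsMatched.sum_eq (h : IsMatched H Q u v x y) {A : Type*} [AddCommMonoid A] (f : V → A) :
    ∑ i ∈ Q, f i = f u + (f v + (f x + f y)) := by
  rw [h.eq, sum_insert, sum_insert, sum_insert, sum_singleton]
  · simpa using h.adj_xy.ne
  · simp [h.ne_vx, h.ne_vy]
  · simp [h.adj_uv.ne, h.ne_ux, h.ne_uy]

lemma IsMatched.degIn_inter (h : IsMatched H Q u v x y) {K : Finset V} (hK : K ⊆ Q) (z : V) :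
    degIn G K z = (if u ∈ K ∧ G.Adj z u then 1 else 0) + ((if v ∈ K ∧ G.Adj z v then 1 else 0) +
      ((if x ∈ K ∧ G.Adj z x then 1 else 0) + (if y ∈ K ∧ G.Adj z y then 1 else 0))) := by
  rw [← h.sum_eq (fun w => if w ∈ K ∧ G.Adj z w then 1 else 0), ← card_filter]
  unfold degIn
  congr 1
  ext w
  simp only [mem_filter]
  exact ⟨fun hw => ⟨hK hw.1, hw⟩, fun hw => hw.2⟩

lemma IsMatched.exists_map (h : IsMatched H Q u v x y) (hHG : H ≤ G) {a b c d : Bool}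
    (ha : G.Adj u x ↔ a = true) (hb : G.Adj u y ↔ b = true) (hc : G.Adj v x ↔ c = true)
    (hd : G.Adj v y ↔ d = true) : ∃ q : Fin 4 ↪ V, Q = univ.map q ∧
      (∀ i j, G.Adj (q i) (q j) ↔ (fourGraph a b c d).Adj i j) ∧
      ∀ i j, H.Adj (q i) (q j) ↔ (fourGraph false false false false).Adj i j := by
  have hinj : Function.Injective ![u, v, x, y] := by
    have h1 := h.adj_uv.ne
    have h2 := h.adj_xy.ne
    have h3 := h.ne_ux
    have h4 := h.ne_uy
    have h5 := h.ne_vx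
    have h6 := h.ne_vy
    intro i j hij
    fin_cases i <;> fin_cases j <;> simp_all [eq_comm]
  have hQ : Q = univ.map ⟨![u, v, x, y], hinj⟩ := by
    rw [h.eq]
    ext z
    simp [Fin.exists_fin_succ, eq_comm]
  refine ⟨_, hQ, ?_, ?_⟩
  · intro i j
    have e1 := hHG h.adj_uv
    have e2 := hHG h.adj_xy
    have e3 := e1.symm
    have e4 := e2.symm
    have f1 := G.adj_comm x u
    have f2 := G.adj_comm y u
    have f3 := G.adj_comm x v
    have f4 := G.adj_comm y v
    fin_cases i <;> fin_cases j <;> simp_all [fourGraph]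
  · intro i j
    have e1 := h.adj_uv
    have e2 := h.adj_xy
    have e3 := e1.symm
    have e4 := e2.symm
    have f1 := H.adj_comm x u
    have f2 := H.adj_comm y u
    have f3 := H.adj_comm x v
    have f4 := H.adj_comm y v
    have := h.not_ux
    have := h.not_uy
    have := h.not_vx
    have := h.not_vy
    fin_cases i <;> fin_cases j <;> simp_all [fourGraph]

lemma IsMatched.hasCuts (h : IsMatched H Q u v x y) (hHG : H ≤ G) {n : ℤ} {a b c d : Bool}
    (ha : G.Adj u x ↔ a = true) (hb : G.Adj u y ↔ b = true) (hc : G.Adj v x ↔ c = true)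
    (hd : G.Adj v y ↔ d = true)
    (hcut : HasCuts (fourGraph a b c d) (fourGraph false false false false) univ n) :
    HasCuts G H Q n := by
  obtain ⟨q, rfl, h1, h2⟩ := h.exists_map hHG ha hb hc hd
  exact hcut.map h1 h2

lemma IsMatched.cutConnected (h : IsMatched H Q u v x y) (hHG : H ≤ G) {a b c d : Bool}
    (ha : G.Adj u x ↔ a = true) (hb : G.Adj u y ↔ b = true) (hc : G.Adj v x ↔ c = true)
    (hd : G.Adj v y ↔ d = true) (hcut : CutConnected (fourGraph a b c d) univ) :
    CutConnected G Q := by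
  obtain ⟨q, rfl, h1, -⟩ := h.exists_map hHG ha hb hc hd
  exact hcut.map h1

lemma IsMatched.cutConnected_erase (h : IsMatched H Q u v x y) (hHG : H ≤ G) {a b c d : Bool}
    (ha : G.Adj u x ↔ a = true) (hb : G.Adj u y ↔ b = true) (hc : G.Adj v x ↔ c = true)
    (hd : G.Adj v y ↔ d = true) (hcut : ∀ i, CutConnected (fourGraph a b c d) (univ.erase i)) :
    ∀ i ∈ Q, CutConnected G (Q.erase i) := by
  obtain ⟨q, rfl, h1, -⟩ := h.exists_map hHG ha hb hc hd
  intro i hi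
  obtain ⟨i, -, rfl⟩ := mem_map.1 hi
  rw [← map_erase]
  exact (hcut i).map h1

lemma cutConnected_paw : CutConnected (fourGraph false false true true) univ := by
  decide +kernel

lemma cutConnected_diamond_erase :
    ∀ i, CutConnected (fourGraph false true true true) (univ.erase i) := by
  decide +kernel

lemma IsMatched.mem (h : IsMatched H Q u v x y) : u ∈ Q ∧ v ∈ Q ∧ x ∈ Q ∧ y ∈ Q := by
  simp [h.eq]

lemma IsMatched.forall_mem (h : IsMatched H Q u v x y) {P : V → Prop} :
    (∀ i ∈ Q, P i) ↔ P u ∧ P v ∧ P x ∧ P y := by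
  simp [h.eq]

lemma IsMatched.degIn_eq (h : IsMatched H Q u v x y) (hHG : H ≤ G) : degIn G Q u =
    1 + ((if G.Adj u x then 1 else 0) + (if G.Adj u y then 1 else 0)) := by
  rw [h.degIn_inter subset_rfl]
  simp [h.mem, hHG h.adj_uv]

/-- Four suitable colours give a list colouring. -/
lemma IsMatched.exists_isListCol (h : IsMatched H Q u v x y) {L : V → Finset ℤ} {a b c d : ℤ}
    (ha : a ∈ L u) (hb : b ∈ L v) (hc : c ∈ L x) (hd : d ∈ L y) (hab : 2 ≤ |a - b|)
    (hcd : 2 ≤ |c - d|) (hac : G.Adj u x → a ≠ c) (had : G.Adj u y → a ≠ d)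
    (hbc : G.Adj v x → b ≠ c) (hbd : G.Adj v y → b ≠ d) : ∃ φ, IsListCol G H Q L φ := by
  let φ : V → ℤ := fun w => if w = u then a else if w = v then b else if w = x then c else d
  have hu : φ u = a := if_pos rfl
  have hv : φ v = b := by simp [φ, h.adj_uv.ne']
  have hx : φ x = c := by simp [φ, h.ne_ux.symm, h.ne_vx.symm]
  have hy : φ y = d := by simp [φ, h.ne_uy.symm, h.ne_vy.symm, h.adj_xy.ne']
  have hmem : ∀ w ∈ Q, w = u ∨ w = v ∨ w = x ∨ w = y := fun w hw => by
    rw [h.eq] at hw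
    simpa using hw
  have hab' : a ≠ b := by
    rintro rfl
    norm_num at hab
  have hcd' : c ≠ d := by
    rintro rfl
    norm_num at hcd
  have hba : 2 ≤ |b - a| := by rwa [abs_sub_comm]
  have hdc : 2 ≤ |d - c| := by rwa [abs_sub_comm]
  refine ⟨φ, ?_, ?_, ?_⟩
  · intro w hw
    rcases hmem w hw with rfl | rfl | rfl | rfl
    · rwa [hu]
    · rwa [hv]
    · rwa [hx]
    · rwa [hy]
  · intro w hw w' hw' hadj
    rcases hmem w hw with e | e | e | e <;> rcases hmem w' hw' with e' | e' | e' | e' <;>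
      rw [e, e'] at hadj ⊢ <;> simp only [hu, hv, hx, hy] <;>
      first
      | exact absurd hadj (G.irrefl)
      | assumption
      | exact hab'.symm
      | exact hcd'.symm
      | exact hac hadj
      | exact (hac hadj.symm).symm
      | exact had hadj
      | exact (had hadj.symm).symm
      | exact hbc hadj
      | exact (hbc hadj.symm).symm
      | exact hbd hadj
      | exact (hbd hadj.symm).symm
  · intro w hw w' hw' hadj
    rcases hmem w hw with e | e | e | e <;> rcases hmem w' hw' with e' | e' | e' | e' <;>
      rw [e, e'] at hadj ⊢ <;> simp only [hu, hv, hx, hy] <;>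
      first
      | exact absurd hadj (H.irrefl)
      | assumption
      | exact absurd hadj h.not_ux
      | exact absurd hadj.symm h.not_ux
      | exact absurd hadj h.not_uy
      | exact absurd hadj.symm h.not_uy
      | exact absurd hadj h.not_vx
      | exact absurd hadj.symm h.not_vx
      | exact absurd hadj h.not_vy
      | exact absurd hadj.symm h.not_vy

end Labels

end Backbone

namespace Backbone

/-! ### Four descendants: tightness and the shape of the backbone -/

section FourSet

variable {V : Type*} [LinearOrder V] [Fintype V]

/-- A vertex with exactly four descendants in a critical pair. -/
structure IsFour (G H : SimpleGraph V) [DecidableRel G.Adj] [DecidableRel H.Adj] (k D : ℕ)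
    (p : V) : Prop where
  elim : IsElim G k
  crit : IsCritical G H ((k + D : ℕ) : ℤ)
  com : AtMostOneCommon H
  ten_le : 10 ≤ D
  le_two_mul : k + 10 ≤ 2 * D
  le : D ≤ k
  card : #(desc G p) = 4

/-- The potential of the four descendants is as small as it can be. -/
structure IsTight (G H : SimpleGraph V) [DecidableRel G.Adj] [DecidableRel H.Adj] (k D : ℕ)
    (p : V) : Prop extends IsFour G H k D p where
  eq : k + 10 = 2 * D
  card_up : ∀ i ∈ desc G p, #(up G i) = k
  cover : ∀ y ∈ up G p, ∃ i ∈ desc G p, H.Adj i y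

variable {G H : SimpleGraph V} [DecidableRel G.Adj] [DecidableRel H.Adj] {k D : ℕ} {p : V}

lemma IsFour.nonneg (_h : IsFour G H k D p) : (0 : ℤ) ≤ ((k + D : ℕ) : ℤ) := by positivity

/-- Counting on the four descendants with all slack kept: uncovered later neighbours of `p`, missing
later neighbours, and `2 * D - k - 10`. Equality later forces each of these to vanish. -/
lemma IsFour.le_pot (h : IsFour G H k D p) :
    (16 : ℤ) + 4 * (k - #{y ∈ up G p | 0 < degIn H (desc G p) y}) +
      2 * ∑ i ∈ desc G p, ((k : ℤ) - #(up G i)) + 4 * (2 * D - k - 10) +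
      4 * inPairs H (desc G p) ≤ 2 * pot G H ((k + D : ℕ) : ℤ) (desc G p) +
      inSum G (desc G p) + 2 * inSum H (desc G p) := by
  have hb := h.elim.isBlock_desc p
  have hb' : IsBlock H (desc G p) {y ∈ up G p | 0 < degIn H (desc G p) y} :=
    ⟨(hb.mono_left h.crit.le).down, fun i hi j hj hij => mem_filter.2
      ⟨(hb.mono_left h.crit.le).nbr i hi j hj hij,
        card_pos.2 ⟨i, mem_filter.2 ⟨hi, hij.symm⟩⟩⟩⟩
  have h1 := hb'.sum_compl h.com 1 1 le_one_add_choose_two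
  have c4 : Nat.choose 4 2 = 6 := rfl
  rw [h.card, c4] at h1
  have h2 := pot_eq (G := G) (H := H) (M := ((k + D : ℕ) : ℤ)) (desc G p)
  have h3 := hb.two_mul_sum_degIn
  change _ = _ + inSum G (desc G p) at h3
  have h4 : 2 * ∑ i ∈ desc G p, (degIn G univ i : ℤ) =
      2 * ∑ i ∈ desc G p, (#(up G i) : ℤ) + inSum G (desc G p) := by
    exact_mod_cast h3
  rw [h.card] at h2
  rw [sum_sub_distrib, sum_const, h.card]
  push_cast at h2 ⊢
  rw [h2]
  have h5 : (outSum H (desc G p) : ℤ) + inPairs H (desc G p) ≤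
      #{y ∈ up G p | 0 < degIn H (desc G p) y} + 6 := by
    exact_mod_cast (by omega)
  simp only [nsmul_eq_mul]
  push_cast
  linarith

lemma IsFour.isTight (h : IsFour G H k D p)
    (hle : 2 * pot G H ((k + D : ℕ) : ℤ) (desc G p) + inSum G (desc G p) +
      2 * inSum H (desc G p) ≤ 16 + 4 * inPairs H (desc G p)) : IsTight G H k D p := by
  have h1 := h.le_pot
  have h2 : #{y ∈ up G p | 0 < degIn H (desc G p) y} ≤ #(up G p) := card_filter_le _ _
  have h3 := h.elim.card_up p
  have h4 : ∀ i ∈ desc G p, (0 : ℤ) ≤ (k : ℤ) - #(up G i) := fun i _ => by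
    have := h.elim.card_up i
    omega
  have h5 := sum_nonneg h4
  have h6 := h.le_two_mul
  refine ⟨h, by omega, fun i hi => ?_, fun y hy => ?_⟩
  · have := (sum_eq_zero_iff_of_nonneg h4).1 (by omega) i hi
    omega
  · have h7 : {y ∈ up G p | 0 < degIn H (desc G p) y} = up G p :=
      eq_of_subset_of_card_le (filter_subset _ _) (by omega)
    rw [← h7, mem_filter] at hy
    obtain ⟨i, hi⟩ := card_pos.1 hy.2
    rw [mem_filter] at hi
    exact ⟨i, hi.1, hi.2.symm⟩

lemma IsFour.le_inSum (h : IsFour G H k D p) :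
    16 + 4 * inPairs H (desc G p) ≤ inSum G (desc G p) + 2 * inSum H (desc G p) := by
  have h1 := h.le_pot
  have h2 : #{y ∈ up G p | 0 < degIn H (desc G p) y} ≤ #(up G p) := card_filter_le _ _
  have h3 := h.elim.card_up p
  have h4 : ∀ i ∈ desc G p, (0 : ℤ) ≤ (k : ℤ) - #(up G i) := fun i _ => by
    have := h.elim.card_up i
    omega
  have h5 := sum_nonneg h4
  have h6 := h.le_two_mul
  have h7 := h.crit.pot_nonpos h.nonneg ⟨p, self_mem_desc (G := G) p⟩
  omega

/-- A colouring of the outside without gain. -/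
lemma IsTight.of_not_gain (h : IsTight G H k D p) {φ : V → ℤ}
    (hφ : ∀ i ∈ desc G p, ¬ Gain G H ((k + D : ℕ) : ℤ) (desc G p) φ i) :
    (∀ y ∈ up G p, φ y ≠ 0 ∧ φ y ≠ ((k + D : ℕ) : ℤ) - 1) ∧
    ∀ y ∈ up G p, ∀ z ∈ up G p, φ z = φ y + 1 → ∀ i ∈ desc G p, ∀ j ∈ desc G p,
      H.Adj i y → H.Adj j z → ¬ G.Adj i z ∧ ¬ G.Adj j y := by
  have hout : ∀ y ∈ up G p, y ∉ desc G p := fun y hy hy' =>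
    absurd (le_of_mem_desc hy') (not_le.2 (mem_up.1 hy).1)
  refine ⟨fun y hy => ?_, fun y hy z hz hyz i hi j hj hiy hjz => ⟨fun hiz => ?_, fun hjy => ?_⟩⟩
  · obtain ⟨i, hi, hiy⟩ := h.cover y hy
    refine ⟨fun e => hφ i hi ⟨y, hout y hy, hiy, -1, Or.inr rfl, Or.inl ?_⟩,
      fun e => hφ i hi ⟨y, hout y hy, hiy, 1, Or.inl rfl, Or.inl ?_⟩⟩ <;> rw [e, mem_Ico] <;> omega
  · exact hφ i hi ⟨y, hout y hy, hiy, 1, Or.inl rfl, Or.inr ⟨z, hout z hz, hiz, hyz⟩⟩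
  · exact hφ j hj ⟨z, hout z hz, hjz, -1, Or.inr rfl, Or.inr ⟨y, hout y hy, hjy, by omega⟩⟩

lemma IsTight.card_image (h : IsTight G H k D p) {φ : V → ℤ}
    (hφ : IsListCol G H (desc G p)ᶜ (fun _ => Ico 0 ((k + D : ℕ) : ℤ)) φ) :
    #((up G p).image φ) = k ∧ (up G p).image φ ⊆ Ico 0 ((k + D : ℕ) : ℤ) := by
  have hout : ∀ y ∈ up G p, y ∈ (desc G p)ᶜ := fun y hy => mem_compl.2 fun hy' =>
    absurd (le_of_mem_desc hy') (not_le.2 (mem_up.1 hy).1)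
  constructor
  · rw [card_image_of_injOn, h.card_up p (self_mem_desc p)]
    intro y hy z hz hyz
    by_contra hne
    have hy' := mem_up.1 hy
    have hz' := mem_up.1 hz
    exact hφ.ne y (hout y hy) z (hout z hz) (h.elim.adj hy'.1 hz'.1 hne hy'.2 hz'.2) hyz
  · exact image_subset_iff.2 fun y hy => hφ.mem y (hout y hy)

/-- The clique `up G p` uses `k` colours out of `k + D ≤ 2 * k`, so an extreme colour or two
consecutive colours occur. In the latter case, by nestedness, one of the two backbone neighbours
below sees both coloured vertices, and a colour is forbidden twice there. -/
lemma IsTight.exists_gain (h : IsTight G H k D p)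
    (hnest : ∀ i ∈ desc G p, ∀ j ∈ desc G p, (∀ y ∈ up G p, G.Adj i y → G.Adj j y) ∨
      ∀ y ∈ up G p, G.Adj j y → G.Adj i y) (φ : V → ℤ)
    (hφ : IsListCol G H (desc G p)ᶜ (fun _ => Ico 0 ((k + D : ℕ) : ℤ)) φ) :
    ∃ i ∈ desc G p, Gain G H ((k + D : ℕ) : ℤ) (desc G p) φ i := by
  by_contra! hcon
  obtain ⟨h1, h2⟩ := h.of_not_gain hcon
  obtain ⟨h3, h4⟩ := h.card_image hφ
  have h5 := h.le
  have h6 := h.ten_le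
  obtain ⟨c, hc, hc'⟩ := exists_consecutive h4 (by rw [h3]; push_cast; omega)
    (card_pos.1 (by omega))
    (fun h0 => by
      obtain ⟨y, hy, e⟩ := mem_image.1 h0
      exact (h1 y hy).1 e)
    (fun h0 => by
      obtain ⟨y, hy, e⟩ := mem_image.1 h0
      exact (h1 y hy).2 e)
  obtain ⟨y, hy, rfl⟩ := mem_image.1 hc
  obtain ⟨z, hz, e⟩ := mem_image.1 hc'
  obtain ⟨i, hi, hiy⟩ := h.cover y hy
  obtain ⟨j, hj, hjz⟩ := h.cover z hz
  have h7 := h2 y hy z hz e i hi j hj hiy hjz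
  rcases hnest i hi j hj with h8 | h8
  · exact h7.2 (h8 y hy (h.crit.le hiy))
  · exact h7.1 (h8 z hz (h.crit.le hjz))

/-- Neighbours above are inherited by later neighbours. -/
lemma IsFour.adj_of_lt (h : IsFour G H k D p) {i j : V} (hj : j ∈ desc G p)
    (hij : i < j) (hadj : G.Adj i j) : ∀ y ∈ up G p, G.Adj i y → G.Adj j y := by
  intro y hy hiy
  have hjy := (le_of_mem_desc hj).trans_lt (mem_up.1 hy).1
  exact h.elim.adj hij (hij.trans hjy) hjy.ne hadj hiy

lemma IsFour.nested_of_adj (h : IsFour G H k D p) {i j : V} (hi : i ∈ desc G p)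
    (hj : j ∈ desc G p) (hadj : G.Adj i j) : (∀ y ∈ up G p, G.Adj i y → G.Adj j y) ∨
      ∀ y ∈ up G p, G.Adj j y → G.Adj i y := by
  rcases lt_or_gt_of_ne hadj.ne with hlt | hlt
  · exact Or.inl (h.adj_of_lt hj hlt hadj)
  · exact Or.inr (h.adj_of_lt hi hlt hadj.symm)

lemma IsFour.adj_of_inSum (h : IsFour G H k D p) (hs : 12 ≤ inSum G (desc G p)) :
    ∀ i ∈ desc G p, ∀ j ∈ desc G p, i ≠ j → G.Adj i j := by
  have h1 : ∀ i ∈ desc G p, degIn G (desc G p) i ≤ 3 := fun i hi => by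
    have := degIn_lt_card (G := G) hi
    rw [h.card] at this
    omega
  have h2 : ∑ i ∈ desc G p, degIn G (desc G p) i = ∑ i ∈ desc G p, 3 := by
    refine le_antisymm (sum_le_sum h1) ?_
    rw [sum_const, h.card]
    exact hs
  intro i hi j hj hij
  have h3 := (sum_eq_sum_iff_of_le h1).1 h2 i hi
  have h4 : {j ∈ desc G p | G.Adj i j} = (desc G p).erase i := by
    refine eq_of_subset_of_card_le (fun w hw => ?_) ?_
    · rw [mem_filter] at hw
      exact mem_erase.2 ⟨hw.2.ne', hw.1⟩
    · rw [card_erase_of_mem hi, h.card]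
      exact h3.ge
  have h5 : j ∈ (desc G p).erase i := mem_erase.2 ⟨hij.symm, hj⟩
  rw [← h4, mem_filter] at h5
  exact h5.2

/-- The backbone on the four descendants is a perfect matching. -/
lemma IsFour.degIn_eq_one (h : IsFour G H k D p) : ∀ i ∈ desc G p, degIn H (desc G p) i = 1 := by
  set Q := desc G p with hQ
  have h1 : ∀ i ∈ Q, degIn H Q i ≤ 3 := fun i hi => by
    have := degIn_lt_card (G := H) hi
    rw [h.card] at this
    omega
  -- The values are `0, 1, 0, -3` for degrees `0, 1, 2, 3`. The sum is even, at least `2` by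
  -- `le_inSum`, and equals its maximum `4` only for a perfect matching.
  let f : V → ℤ := fun i => degIn H Q i - 2 * (degIn H Q i).choose 2
  have hf : ∀ i ∈ Q, f i ≤ 1 ∧ (f i = 1 → degIn H Q i = 1) ∧ (2 ≤ degIn H Q i → f i ≤ 0) ∧
      (3 ≤ degIn H Q i → f i ≤ -3) := by
    intro i hi
    have := h1 i hi
    simp only [f]
    interval_cases degIn H Q i <;> simp
  have hval : (inSum H Q : ℤ) - 2 * inPairs H Q = ∑ i ∈ Q, f i := by
    simp only [f, sum_sub_distrib, ← mul_sum, inSum, inPairs]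
    push_cast
    rfl
  have hG := inSum_le (H := G) Q
  have hle := h.le_inSum
  rw [← hQ] at hle
  rw [h.card] at hG
  obtain ⟨e, he⟩ := even_inSum (H := H) Q
  have hle4 : ∑ i ∈ Q, f i ≤ 4 := by
    have := sum_le_sum fun i hi => (hf i hi).1
    rw [sum_const, h.card] at this
    simpa using this
  by_cases h4 : ∑ i ∈ Q, f i = 4
  · have h5 : ∑ i ∈ Q, f i = ∑ i ∈ Q, 1 := by
      rw [h4, sum_const, h.card]
      rfl
    exact fun i hi => (hf i hi).2.1 ((sum_eq_sum_iff_of_le fun i hi => (hf i hi).1).1 h5 i hi)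
  exfalso
  have h2 : ∑ i ∈ Q, f i = 2 := by omega
  have hpot := h.crit.pot_nonpos h.nonneg (S := Q) ⟨p, self_mem_desc (G := G) p⟩
  have hpot' := h.le_pot
  rw [← hQ] at hpot'
  have hup : #{y ∈ up G p | 0 < degIn H Q y} ≤ #(up G p) := card_filter_le _ _
  have hup' := h.elim.card_up p
  have hsum : (0 : ℤ) ≤ ∑ i ∈ Q, ((k : ℤ) - #(up G i)) := sum_nonneg fun i _ => by
    have := h.elim.card_up i
    omega
  have hkD := h.le_two_mul
  have hadj := h.adj_of_inSum (by rw [← hQ]; omega)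
  have ht : IsTight G H k D p := h.isTight (by rw [← hQ]; omega)
  have hcut : CutConnected G Q := by
    intro K hK hne hKQ
    obtain ⟨i, hi⟩ := hne
    obtain ⟨j, hj⟩ := sdiff_nonempty_of_subset_of_ne hK hKQ
    exact ⟨i, hi, j, hj, hadj i (hK hi) j (mem_sdiff.1 hj).1
      (fun e => (mem_sdiff.1 hj).2 (e ▸ hi))⟩
  -- A cut with all its edges in `H` contains a star with three leaves or a 4-cycle, and then the
  -- sum of `f` is not positive.
  have hcut' : CutConnected (G \ H) Q := by
    intro K hK hne hKQ
    by_contra! hcon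
    have hall : ∀ i ∈ K, ∀ j ∈ Q \ K, H.Adj i j := fun i hi j hj => by
      have h5 := hcon i hi j hj
      rw [SimpleGraph.sdiff_adj, not_and, not_not] at h5
      exact h5 (hadj i (hK hi) j (mem_sdiff.1 hj).1 (fun e => (mem_sdiff.1 hj).2 (e ▸ hi)))
    have hd1 : ∀ i ∈ K, #(Q \ K) ≤ degIn H Q i := fun i hi =>
      card_le_card fun j hj => mem_filter.2 ⟨(mem_sdiff.1 hj).1, hall i hi j hj⟩
    have hd2 : ∀ j ∈ Q \ K, #K ≤ degIn H Q j := fun j hj =>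
      card_le_card fun i hi => mem_filter.2 ⟨hK hi, (hall i hi j hj).symm⟩
    have hc := card_sdiff_add_card_eq_card hK
    have hc1 := card_pos.2 hne
    have hc2 := card_pos.2 (sdiff_nonempty_of_subset_of_ne hK hKQ)
    have hs := sum_sdiff hK (f := f)
    have hb : ∀ A ⊆ Q, ∀ b : ℤ, (∀ i ∈ A, f i ≤ b) → ∑ i ∈ A, f i ≤ #A * b := by
      intro A _ b hA
      simpa using sum_le_sum hA
    have b1 := hb K hK 1 fun i hi => (hf i (hK hi)).1
    have b2 := hb (Q \ K) sdiff_subset 1 fun i hi => (hf i (sdiff_subset hi)).1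
    have b3 := fun h5 : 2 ≤ #(Q \ K) => hb K hK 0 fun i hi =>
      (hf i (hK hi)).2.2.1 (h5.trans (hd1 i hi))
    have b4 := fun h5 : 2 ≤ #K => hb (Q \ K) sdiff_subset 0 fun i hi =>
      (hf i (sdiff_subset hi)).2.2.1 (h5.trans (hd2 i hi))
    have b5 := fun h5 : 3 ≤ #(Q \ K) => hb K hK (-3) fun i hi =>
      (hf i (hK hi)).2.2.2 (h5.trans (hd1 i hi))
    have b6 := fun h5 : 3 ≤ #K => hb (Q \ K) sdiff_subset (-3) fun i hi =>
      (hf i (sdiff_subset hi)).2.2.2 (h5.trans (hd2 i hi))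
    rw [h.card] at hc
    have h5 : #K = 1 ∨ #K = 2 ∨ #K = 3 := by omega
    rcases h5 with h5 | h5 | h5
    · have h6 : #(Q \ K) = 3 := by omega
      have := b5 (by omega)
      rw [h5] at this
      rw [h6] at b2
      omega
    · have := b3 (by omega)
      have := b4 (by omega)
      omega
    · have h6 : #(Q \ K) = 1 := by omega
      have := b6 (by omega)
      rw [h5] at b1
      rw [h6] at this
      omega
  -- With the empty stuck set the conclusion says that all excesses vanish.
  have h0 := (h.crit.excess_eq_of_stuck h.nonneg (Q := Q) (J := ∅) (by simp)
    ⟨p, by simpa [hQ] using self_mem_desc p⟩ (by simp) (by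
      have : cross G H ∅ (Q \ ∅) = 0 := rfl
      omega) (by simpa using hcut')).2
  obtain ⟨φ, hφ⟩ := h.crit.exists_coloring (Q := Q) ⟨p, self_mem_desc p⟩
  obtain ⟨i, hi, hg⟩ := ht.exists_gain (fun i hi j hj => by
    by_cases e : i = j
    · subst e
      exact Or.inl fun y _ h => h
    · exact h.nested_of_adj hi hj (hadj i hi j hj e)) φ hφ
  exact h.crit.false_of_gain h.nonneg hφ hcut (fun j hj => by
    rw [h0 j (by simpa using hj)]
    positivity) hi hg

/-- Labels for the perfect matching. -/
lemma IsFour.exists_isMatched (h : IsFour G H k D p) :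
    ∃ u v x y, IsMatched H (desc G p) u v x y := by
  set Q := desc G p with hQ
  have h1 := h.degIn_eq_one
  have hex : ∀ i ∈ Q, ∃ j ∈ Q, H.Adj i j ∧ ∀ w ∈ Q, H.Adj i w → w = j := by
    intro i hi
    obtain ⟨j, hj⟩ := card_eq_one.1 (h1 i hi)
    have hj' := mem_filter.1 (hj ▸ mem_singleton_self j)
    exact ⟨j, hj'.1, hj'.2, fun w hw hiw => mem_singleton.1 (hj ▸ mem_filter.2 ⟨hw, hiw⟩)⟩
  have hp : p ∈ Q := self_mem_desc p
  obtain ⟨v, hv, hpv, hpv'⟩ := hex p hp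
  obtain ⟨p', hp', hvp, hvp'⟩ := hex v hv
  have e1 : p = p' := hvp' p hp hpv.symm
  have h2 : #((Q.erase p).erase v) = 2 := by
    rw [card_erase_of_mem (mem_erase.2 ⟨hpv.ne', hv⟩), card_erase_of_mem hp, h.card]
  obtain ⟨x, y, hxy, he⟩ := card_eq_two.1 h2
  have hx : x ∈ (Q.erase p).erase v := he ▸ by simp
  have hy : y ∈ (Q.erase p).erase v := he ▸ by simp
  simp only [mem_erase] at hx hy
  obtain ⟨w, hw, hxw, -⟩ := hex x hx.2.2
  have hpx : ¬ H.Adj p x := fun e => hx.1 (hpv' x hx.2.2 e)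
  have hpy : ¬ H.Adj p y := fun e => hy.1 (hpv' y hy.2.2 e)
  have hvx : ¬ H.Adj v x := fun e => hx.2.1 ((hvp' x hx.2.2 e).trans e1.symm)
  have hvy : ¬ H.Adj v y := fun e => hy.2.1 ((hvp' y hy.2.2 e).trans e1.symm)
  have hwy : w = y := by
    have : w ∈ (Q.erase p).erase v := by
      simp only [mem_erase]
      exact ⟨fun e => hvx (e ▸ hxw.symm), fun e => hpx (e ▸ hxw.symm), hw⟩
    rw [he, mem_insert, mem_singleton] at this
    exact this.resolve_left hxw.ne'
  refine ⟨p, v, x, y, ?_, hpv, hwy ▸ hxw, hpx, hpy, hvx, hvy, hx.2.1.symm, hy.2.1.symm,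
    hx.1.symm, hy.1.symm⟩
  rw [← he, insert_erase (mem_erase.2 ⟨hpv.ne', hv⟩), insert_erase hp]

end FourSet

end Backbone

namespace Backbone

/-! ### Colouring the four descendants -/

section Colours

variable {V : Type*} [DecidableEq V] [Fintype V] {G H : SimpleGraph V} [DecidableRel G.Adj]
  [DecidableRel H.Adj] {M : ℤ} {Q : Finset V} {u v x y : V}

lemma IsMatched.exists_isListCol_of_complete (h : IsMatched H Q u v x y) {L : V → Finset ℤ}
    (s : V → ℤ) (hs : ∀ i ∈ Q, s i ≤ 0) (hsum : -1 ≤ ∑ i ∈ Q, s i)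
    (hL : ∀ i ∈ Q, 4 + s i ≤ #(L i)) : ∃ φ, IsListCol G H Q L φ := by
  have key : ∀ {u v x y : V}, IsMatched H Q u v x y → -1 ≤ s y → ∃ φ, IsListCol G H Q L φ ∨
      (s u < 0 ∨ s v < 0 ∨ s x < 0) := by
    intro u v x y h hy
    by_cases hneg : s u < 0 ∨ s v < 0 ∨ s x < 0
    · exact ⟨0, Or.inr hneg⟩
    obtain ⟨hu', hv', hx', hy'⟩ := h.forall_mem.1 hL
    obtain ⟨a, ha, b, hb, c, hc, d, hd, h1, h2, h3, h4, h5, h6⟩ :=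
      exists_colors_of_complete (A := L u) (B := L v) (C := L x) (D := L y) (by omega) (by omega)
        (by omega) (by omega)
    obtain ⟨φ, hφ⟩ := h.exists_isListCol (G := G) (L := L) ha hb hc hd h1 h2 (fun _ => h3)
      (fun _ => h4) (fun _ => h5) (fun _ => h6)
    exact ⟨φ, Or.inl hφ⟩
  rw [h.sum_eq] at hsum
  obtain ⟨hu, hv, hx, hy⟩ := h.forall_mem.1 hs
  obtain ⟨φ, h1 | h1⟩ := key h (by omega)
  · exact ⟨φ, h1⟩
  obtain ⟨φ, h2 | h2⟩ := key h.swap_right (by omega)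
  · exact ⟨φ, h2⟩
  obtain ⟨φ, h3 | h3⟩ := key h.swap (by omega)
  · exact ⟨φ, h3⟩
  obtain ⟨φ, h4 | h4⟩ := key h.swap.swap_right (by omega)
  · exact ⟨φ, h4⟩
  omega

lemma IsMatched.degIn_backbone (h : IsMatched H Q u v x y) : ∀ i ∈ Q, degIn H Q i = 1 := by
  rw [h.forall_mem]
  refine ⟨?_, ?_, ?_, ?_⟩
  · simpa [h.not_ux, h.not_uy] using h.degIn_eq le_rfl
  · simpa [h.not_vx, h.not_vy] using h.swap_left.degIn_eq le_rfl
  · simpa [h.swap.not_ux, h.swap.not_uy] using h.swap.degIn_eq le_rfl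
  · simpa [h.swap.not_vx, h.swap.not_vy] using h.swap.swap_left.degIn_eq le_rfl

lemma IsMatched.degIn_all (h : IsMatched H Q u v x y) (hHG : H ≤ G) :
    degIn G Q u = 1 + ((if G.Adj u x then 1 else 0) + (if G.Adj u y then 1 else 0)) ∧
    degIn G Q v = 1 + ((if G.Adj v x then 1 else 0) + (if G.Adj v y then 1 else 0)) ∧
    degIn G Q x = 1 + ((if G.Adj u x then 1 else 0) + (if G.Adj v x then 1 else 0)) ∧
    degIn G Q y = 1 + ((if G.Adj u y then 1 else 0) + (if G.Adj v y then 1 else 0)) := by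
  refine ⟨h.degIn_eq hHG, h.swap_left.degIn_eq hHG, ?_, ?_⟩
  · simpa only [G.adj_comm x] using h.swap.degIn_eq hHG
  · simpa only [G.adj_comm y] using h.swap.swap_left.degIn_eq hHG

/-- Only `w` may lack a colour. Sets containing `i` use the gain, other sets meeting `Q.erase w` an
edge leaving them, and for `{w}` the two edges at `w` outweigh the deficit. -/
lemma IsCritical.false_of_gain_of_erase (hc : IsCritical G H M) (hM : 0 ≤ M) {φ : V → ℤ}
    (hφ : IsListCol G H Qᶜ (fun _ => Ico 0 M) φ) {i w : V} (hi : i ∈ Q)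
    (hg : Gain G H M Q φ i) (hiw : i ≠ w) (hconn : CutConnected G (Q.erase w))
    (hdeg : 2 ≤ degIn G Q w) (ht : ∀ j ∈ Q, j ≠ w → 0 ≤ excess G H M Q j)
    (htw : -1 ≤ excess G H M Q w) : False := by
  refine hc.false_of_degenerate hφ fun K hK hne => ?_
  have hcard := fun j => card_resid (G := G) (H := H) hM Q φ j
  by_cases hiK : i ∈ K
  · have := hg.card_resid hM
    have := ht i hi hiw
    have := degIn_mono (G := G) hK i
    exact ⟨i, hiK, by omega⟩
  by_cases hKw : (K.erase w).Nonempty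
  · obtain ⟨j, hj, z, hz, hjz⟩ := hconn (K.erase w) (erase_subset_erase _ hK) hKw
      (fun e => hiK (mem_of_mem_erase (e ▸ mem_erase.2 ⟨hiw, hi⟩)))
    rw [mem_erase] at hj
    simp only [mem_sdiff, mem_erase, not_and] at hz
    have := degIn_lt_of_adj hK (mem_sdiff.2 ⟨hz.1.2, hz.2 hz.1.1⟩) hjz
    have := ht j (hK hj.2) hj.1
    have := hcard j
    exact ⟨j, hj.2, by omega⟩
  · have hKw' : K ⊆ {w} := by
      rw [not_nonempty_iff_eq_empty, erase_eq_empty_iff] at hKw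
      rcases hKw with e | e <;> simp [e]
    obtain ⟨j, hj⟩ := hne
    have e := mem_singleton.1 (hKw' hj)
    subst e
    have h1 := degIn_mono (G := G) hKw' j
    have h2 : degIn G {j} j = 0 := by simp [degIn, filter_singleton]
    have := hcard j
    exact ⟨j, hj, by omega⟩

/-- If a set `K` without `i` failed, its excesses would be at most `#K - 4` each, at most `-3` in
total. -/
lemma IsCritical.false_of_gain_of_complete (hc : IsCritical G H M) (hM : 0 ≤ M) {φ : V → ℤ}
    (hφ : IsListCol G H Qᶜ (fun _ => Ico 0 M) φ) (hQ : #Q = 4)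
    (hdeg : ∀ i ∈ Q, degIn G Q i = 3) {i : V} (hi : i ∈ Q) (hg : Gain G H M Q φ i)
    (ht : ∀ j ∈ Q, excess G H M Q j ≤ 0) (hti : 0 ≤ excess G H M Q i)
    (hsum : -2 ≤ ∑ j ∈ Q, excess G H M Q j) : False := by
  refine hc.false_of_degenerate hφ fun K hK hne => ?_
  have hcard := fun j => card_resid (G := G) (H := H) hM Q φ j
  by_cases hiK : i ∈ K
  · have := hg.card_resid hM
    have := degIn_mono (G := G) hK i
    exact ⟨i, hiK, by omega⟩
  by_contra! hcon
  have h1 : ∀ j ∈ K, excess G H M Q j ≤ #K - 4 := fun j hj => by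
    have h2 := hcon j hj
    have h3 := degIn_lt_card (G := G) hj
    have h4 := hdeg j (hK hj)
    have h5 := hcard j
    omega
  have h2 := sum_le_sum h1
  have h3 := sum_sdiff hK (f := fun j => excess G H M Q j)
  have h4 : ∑ j ∈ Q \ K, excess G H M Q j ≤ 0 := sum_nonpos fun j hj => ht j (sdiff_subset hj)
  have h5 : #K < #Q := card_lt_card ((ssubset_iff_of_subset hK).2 ⟨i, hi, hiK⟩)
  have h6 := card_pos.2 hne
  rw [sum_const, nsmul_eq_mul] at h2
  rw [hQ] at h5
  have h7 : #K = 1 ∨ #K = 2 ∨ #K = 3 := by omega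
  rcases h7 with e | e | e <;> rw [e] at h2 <;> omega

end Colours

section Cases

variable {V : Type*} [LinearOrder V] [Fintype V] {G H : SimpleGraph V} [DecidableRel G.Adj]
  [DecidableRel H.Adj] {k D : ℕ} {p u v x y : V}

/-- With `e` edges of `G` between the two matching edges, `inSum G` is `4 + 2 * e`, so the potential
is at least `2 - e`. In particular `e ≥ 2`. -/
lemma IsFour.matched_pot (h : IsFour G H k D p) (hm : IsMatched H (desc G p) u v x y) :
    8 ≤ 2 * pot G H ((k + D : ℕ) : ℤ) (desc G p) + inSum G (desc G p) ∧
    (2 * pot G H ((k + D : ℕ) : ℤ) (desc G p) + inSum G (desc G p) ≤ 8 → IsTight G H k D p) := by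
  have h1 : inSum H (desc G p) = 4 := by
    rw [inSum, sum_congr rfl hm.degIn_backbone, sum_const, h.card]
    rfl
  have h2 : inPairs H (desc G p) = 0 := by
    rw [inPairs]
    refine sum_eq_zero fun i hi => ?_
    rw [hm.degIn_backbone i hi]
    rfl
  have h3 := h.le_pot
  have h4 : #{y ∈ up G p | 0 < degIn H (desc G p) y} ≤ #(up G p) := card_filter_le _ _
  have h5 := h.elim.card_up p
  have h6 : (0 : ℤ) ≤ ∑ i ∈ desc G p, ((k : ℤ) - #(up G i)) := sum_nonneg fun i _ => by
    have := h.elim.card_up i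
    omega
  have h7 := h.le_two_mul
  exact ⟨by omega, fun h8 => h.isTight (by omega)⟩

lemma IsMatched.inSum_eq (hm : IsMatched H (desc G p) u v x y) (hHG : H ≤ G) :
    inSum G (desc G p) = 4 + 2 * (((if G.Adj u x then 1 else 0) + (if G.Adj u y then 1 else 0)) +
      ((if G.Adj v x then 1 else 0) + (if G.Adj v y then 1 else 0))) := by
  obtain ⟨h1, h2, h3, h4⟩ := hm.degIn_all hHG
  rw [inSum, hm.sum_eq, h1, h2, h3, h4]
  ring

/-- Lists have at least `4` plus excess colours, and a total deficit of one is harmless. At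
potential `-2` a gain either repairs one unit of deficit or sits at a vertex of excess zero. -/
lemma IsFour.false_of_complete (h : IsFour G H k D p) (hm : IsMatched H (desc G p) u v x y)
    (hux : G.Adj u x) (huy : G.Adj u y) (hvx : G.Adj v x) (hvy : G.Adj v y) : False := by
  have hin := hm.inSum_eq h.crit.le
  obtain ⟨hp1, hp2⟩ := h.matched_pot hm
  have hne : (desc G p).Nonempty := ⟨p, self_mem_desc p⟩
  have hpot := h.crit.pot_nonpos h.nonneg hne
  have hcut := hm.hasCuts h.crit.le (a := true) (b := true) (c := true) (d := true) (by simpa)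
    (by simpa) (by simpa) (by simpa) hasCuts_complete
  have hdeg : ∀ i ∈ desc G p, degIn G (desc G p) i = 3 := by
    obtain ⟨h1, h2, h3, h4⟩ := hm.degIn_all h.crit.le
    rw [hm.forall_mem, h1, h2, h3, h4]
    simp [hux, huy, hvx, hvy]
  have hdeg' := hm.degIn_backbone
  obtain ⟨φ, hφ⟩ := h.crit.exists_coloring hne
  have hcard := fun j => card_resid (G := G) (H := H) h.nonneg (desc G p) φ j
  have hfin : ∀ s : V → ℤ, (∀ i ∈ desc G p, s i ≤ 0) → -1 ≤ ∑ i ∈ desc G p, s i →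
      (∀ i ∈ desc G p, 4 + s i ≤ #(resid G H ((k + D : ℕ) : ℤ) (desc G p) φ i)) → False := by
    intro s h1 h2 h3
    obtain ⟨c, hcol⟩ := hm.exists_isListCol_of_complete (G := G) s h1 h2 h3
    exact h.crit.not_colorable (colorable_of_resid h.crit.le hφ hcol)
  simp only [hux, huy, hvx, hvy, if_true] at hin
  by_cases hlt : -2 < pot G H ((k + D : ℕ) : ℤ) (desc G p)
  · refine hfin (fun i => excess G H ((k + D : ℕ) : ℤ) (desc G p) i)
      (h.crit.excess_nonpos_of_lt h.nonneg hcut hne hlt) (by unfold pot at hlt; omega) ?_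
    intro i hi
    have h1 := hcard i
    rw [hdeg i hi, hdeg' i hi] at h1
    omega
  · have ht := hp2 (by omega)
    have hgain := ht.exists_gain (fun i hi j hj => by
      by_cases e : i = j
      · subst e
        exact Or.inl fun y _ h => h
      · exact h.nested_of_adj hi hj (h.adj_of_inSum (by omega) i hi j hj e))
    have hpot2 : pot G H ((k + D : ℕ) : ℤ) (desc G p) = -2 := by omega
    have h0 := h.crit.excess_nonpos_of_hasCuts h.nonneg hcut hne hpot2 hgain
    obtain ⟨i, hi, hg⟩ := hgain φ hφ
    by_cases hti : 0 ≤ excess G H ((k + D : ℕ) : ℤ) (desc G p) i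
    · exact h.crit.false_of_gain_of_complete h.nonneg hφ h.card hdeg hi hg h0 hti hpot2.ge
    · refine hfin (fun j => excess G H ((k + D : ℕ) : ℤ) (desc G p) j + if j = i then 1 else 0)
        ?_ ?_ ?_
      · intro j hj
        have := h0 j hj
        split_ifs with e
        · subst e
          omega
        · omega
      · unfold pot at hpot2
        rw [sum_add_distrib, sum_ite_eq' (desc G p) i, if_pos hi]
        omega
      · intro j hj
        have h1 := hcard j
        rw [hdeg j hj, hdeg' j hj] at h1
        split_ifs with e
        · subst e
          have h2 := hg.card_resid h.nonneg
          rw [hdeg j hj, hdeg' j hj] at h2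
          omega
        · omega

/-- Lists one larger than the `G`-degrees suffice. At potential `-1` one vertex lacks one colour,
and the gain is either there or elsewhere. -/
lemma IsFour.false_of_diamond (h : IsFour G H k D p) (hm : IsMatched H (desc G p) u v x y)
    (hux : ¬ G.Adj u x) (huy : G.Adj u y) (hvx : G.Adj v x) (hvy : G.Adj v y)
    (hgain : IsTight G H k D p → pot G H ((k + D : ℕ) : ℤ) (desc G p) = -1 → ∀ φ,
      IsListCol G H (desc G p)ᶜ (fun _ => Ico 0 ((k + D : ℕ) : ℤ)) φ →
      ∃ i ∈ desc G p, Gain G H ((k + D : ℕ) : ℤ) (desc G p) φ i) : False := by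
  have hin := hm.inSum_eq h.crit.le
  obtain ⟨hp1, hp2⟩ := h.matched_pot hm
  have hne : (desc G p).Nonempty := ⟨p, self_mem_desc p⟩
  have hpot := h.crit.pot_nonpos h.nonneg hne
  have hcut := hm.hasCuts h.crit.le (a := false) (b := true) (c := true) (d := true) (by simpa)
    (by simpa) (by simpa) (by simpa) hasCuts_diamond
  have hconn := hm.cutConnected_erase h.crit.le (a := false) (b := true) (c := true) (d := true)
    (by simpa) (by simpa) (by simpa) (by simpa) cutConnected_diamond_erase
  obtain ⟨hdu, hdv, hdx, hdy⟩ := hm.degIn_all h.crit.le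
  simp only [hux, huy, hvx, hvy, if_true, if_false] at hin hdu hdv hdx hdy
  have hdeg : ∀ i ∈ desc G p, 2 ≤ degIn G (desc G p) i := by
    rw [hm.forall_mem]
    omega
  have hdeg' := hm.degIn_backbone
  obtain ⟨φ, hφ⟩ := h.crit.exists_coloring hne
  have hcard := fun j => card_resid (G := G) (H := H) h.nonneg (desc G p) φ j
  have hfin : ¬ ∀ i ∈ desc G p, degIn G (desc G p) i + 1 ≤
      #(resid G H ((k + D : ℕ) : ℤ) (desc G p) φ i) := by
    intro hL
    obtain ⟨h1, h2, h3, h4⟩ := hm.forall_mem.1 hL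
    obtain ⟨a, ha, b, hb, c, hc, d, hd, e1, e2, e3, e4, e5⟩ :=
      exists_colors_of_diamond (A := resid G H ((k + D : ℕ) : ℤ) (desc G p) φ u)
        (B := resid G H ((k + D : ℕ) : ℤ) (desc G p) φ v)
        (C := resid G H ((k + D : ℕ) : ℤ) (desc G p) φ x)
        (D := resid G H ((k + D : ℕ) : ℤ) (desc G p) φ y) (by omega) (by omega) (by omega)
        (by omega)
    obtain ⟨c, hcol⟩ := hm.exists_isListCol (G := G)
      (L := resid G H ((k + D : ℕ) : ℤ) (desc G p) φ) ha hb hc hd e1 e2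
      (fun e => absurd e hux) (fun _ => e3) (fun _ => e4) (fun _ => e5)
    exact h.crit.not_colorable (colorable_of_resid h.crit.le hφ hcol)
  by_cases hlt : -1 < pot G H ((k + D : ℕ) : ℤ) (desc G p)
  · have h0 := h.crit.excess_nonpos_of_lt h.nonneg hcut hne hlt
    refine hfin fun i hi => ?_
    have h1 : excess G H ((k + D : ℕ) : ℤ) (desc G p) i = 0 :=
      (sum_eq_zero_iff_of_nonpos h0).1 (by unfold pot at hlt hpot; omega) i hi
    have h2 := hcard i
    rw [h1, hdeg' i hi] at h2
    omega
  · have hpot2 : pot G H ((k + D : ℕ) : ℤ) (desc G p) = -1 := by omega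
    have hgain := hgain (hp2 (by omega)) hpot2
    have h0 := h.crit.excess_nonpos_of_hasCuts h.nonneg hcut hne hpot2 hgain
    obtain ⟨i, hi, hg⟩ := hgain φ hφ
    have hsub : ∀ w ∈ desc G p, ∀ j ∈ desc G p, j ≠ w →
        -1 ≤ excess G H ((k + D : ℕ) : ℤ) (desc G p) j +
          excess G H ((k + D : ℕ) : ℤ) (desc G p) w := by
      intro w hw j hj hjw
      have h1 := add_sum_erase (desc G p) (fun j => excess G H ((k + D : ℕ) : ℤ) (desc G p) j) hw
      have h2 := add_sum_erase ((desc G p).erase w)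
        (fun j => excess G H ((k + D : ℕ) : ℤ) (desc G p) j) (mem_erase.2 ⟨hjw, hj⟩)
      have h3 : ∑ a ∈ ((desc G p).erase w).erase j,
          excess G H ((k + D : ℕ) : ℤ) (desc G p) a ≤ 0 :=
        sum_nonpos fun a ha => h0 a (mem_of_mem_erase (mem_of_mem_erase ha))
      unfold pot at hpot2
      linarith
    by_cases hti : 0 ≤ excess G H ((k + D : ℕ) : ℤ) (desc G p) i
    · obtain ⟨w, hw, hw0⟩ : ∃ w ∈ desc G p, excess G H ((k + D : ℕ) : ℤ) (desc G p) w < 0 := by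
        by_contra! hcon
        have := sum_nonneg hcon
        unfold pot at hpot2
        omega
      have hiw : i ≠ w := by
        rintro rfl
        omega
      refine h.crit.false_of_gain_of_erase h.nonneg hφ hi hg hiw (hconn w hw) (hdeg w hw) ?_ ?_
      · intro j hj hjw
        have := hsub w hw j hj hjw
        omega
      · have := hsub w hw i hi hiw
        have := h0 i hi
        omega
    · refine hfin fun j hj => ?_
      by_cases e : j = i
      · subst e
        have h1 := hg.card_resid h.nonneg
        rw [hdeg' j hj] at h1
        have h2 : -1 ≤ excess G H ((k + D : ℕ) : ℤ) (desc G p) j := by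
          have h2 := add_sum_erase (desc G p)
            (fun j => excess G H ((k + D : ℕ) : ℤ) (desc G p) j) hj
          have h3 : ∑ a ∈ (desc G p).erase j, excess G H ((k + D : ℕ) : ℤ) (desc G p) a ≤ 0 :=
            sum_nonpos fun a ha => h0 a (mem_of_mem_erase ha)
          unfold pot at hpot2
          linarith
        omega
      · have h1 := hcard j
        rw [hdeg' j hj] at h1
        have := hsub i hi j hj e
        have := h0 j hj
        omega

lemma IsFour.false_of_paw (h : IsFour G H k D p) (hm : IsMatched H (desc G p) u v x y)
    (hux : ¬ G.Adj u x) (huy : ¬ G.Adj u y) (hvx : G.Adj v x) (hvy : G.Adj v y)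
    (hgain : IsTight G H k D p → pot G H ((k + D : ℕ) : ℤ) (desc G p) = -0 → ∀ φ,
      IsListCol G H (desc G p)ᶜ (fun _ => Ico 0 ((k + D : ℕ) : ℤ)) φ →
      ∃ i ∈ desc G p, Gain G H ((k + D : ℕ) : ℤ) (desc G p) φ i) : False := by
  have hin := hm.inSum_eq h.crit.le
  obtain ⟨hp1, hp2⟩ := h.matched_pot hm
  have hne : (desc G p).Nonempty := ⟨p, self_mem_desc p⟩
  have hpot := h.crit.pot_nonpos h.nonneg hne
  have hcut := hm.hasCuts h.crit.le (a := false) (b := false) (c := true) (d := true) (by simpa)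
    (by simpa) (by simpa) (by simpa) hasCuts_paw
  have hconn := hm.cutConnected h.crit.le (a := false) (b := false) (c := true) (d := true)
    (by simpa) (by simpa) (by simpa) (by simpa) cutConnected_paw
  simp only [hux, huy, hvx, hvy, if_true, if_false] at hin
  have hpot2 : pot G H ((k + D : ℕ) : ℤ) (desc G p) = -0 := by omega
  have hgain := hgain (hp2 (by omega)) hpot2
  have h0 := h.crit.excess_nonpos_of_hasCuts h.nonneg hcut hne hpot2 hgain
  obtain ⟨φ, hφ⟩ := h.crit.exists_coloring hne
  obtain ⟨i, hi, hg⟩ := hgain φ hφ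
  refine h.crit.false_of_gain h.nonneg hφ hconn (fun j hj => ?_) hi hg
  exact ((sum_eq_zero_iff_of_nonpos h0).1 (by unfold pot at hpot2; omega) j hj).ge

end Cases

end Backbone

namespace Backbone

section Lists

variable {V : Type*} [DecidableEq V] [Fintype V] {G H : SimpleGraph V} [DecidableRel G.Adj]
  [DecidableRel H.Adj] {M : ℤ} {Q : Finset V} {u v x y : V}

lemma of_mem_resid {φ : V → ℤ} {i : V} {a : ℤ} (h : a ∈ resid G H M Q φ i) :
    a ∈ Ico 0 M ∧ ∀ w, w ∉ Q → (G.Adj i w → a ≠ φ w) ∧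
      (H.Adj i w → a ≠ φ w + 1 ∧ a ≠ φ w - 1) := by
  simp only [resid, mem_sdiff, mem_union, mem_image, mem_filter, mem_compl, not_or,
    not_exists, not_and] at h
  obtain ⟨h0, h1, h2, h3⟩ := h
  exact ⟨h0, fun w hw => ⟨fun e e' => h1 w ⟨hw, e⟩ e'.symm, fun e =>
    ⟨fun e' => h2 w ⟨hw, e⟩ e'.symm, fun e' => h3 w ⟨hw, e⟩ e'.symm⟩⟩⟩

lemma IsMatched.eq_of_stuck (hm : IsMatched H Q u v x y) (hHG : H ≤ G) {J : Finset V}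
    (hJ : J ⊆ Q) {t : V → ℤ} (h1 : ∀ i ∈ J, t i + degIn G (Q \ J) i = 0)
    (h2 : ∀ i ∈ Q \ J, t i = degIn H J i) :
    (u ∈ J → t u + ((if v ∈ J then 0 else 1) + ((if x ∉ J ∧ G.Adj u x then 1 else 0) +
      (if y ∉ J ∧ G.Adj u y then 1 else 0))) = 0) ∧
    (u ∉ J → t u = if v ∈ J then 1 else 0) := by
  obtain ⟨mu, mv, mx, my⟩ := hm.mem
  constructor
  · intro hu
    have h3 := h1 u hu
    rw [hm.degIn_inter sdiff_subset] at h3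
    simp only [mem_sdiff, mu, mv, mx, my, true_and, hu, G.irrefl, hHG hm.adj_uv, and_false,
      and_true, if_false, zero_add] at h3
    push_cast at h3
    by_cases hv : v ∈ J <;> simpa [hv] using h3
  · intro hu
    rw [h2 u (mem_sdiff.2 ⟨mu, hu⟩), hm.degIn_inter hJ]
    simp [hu, hm.adj_uv, hm.not_ux, hm.not_uy]

end Lists

/-! ### Nested neighbourhoods and the paw -/

section Gains

variable {V : Type*} [LinearOrder V] [Fintype V] {G H : SimpleGraph V} [DecidableRel G.Adj]
  [DecidableRel H.Adj] {k D : ℕ} {p u v x y : V}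

/-- One of the neighbourhoods in `X` contains the other. -/
def Nested (G : SimpleGraph V) (X : Finset V) (i j : V) : Prop :=
  (∀ y ∈ X, G.Adj i y → G.Adj j y) ∨ ∀ y ∈ X, G.Adj j y → G.Adj i y

lemma Nested.symm {X : Finset V} {i j : V} (h : Nested G X i j) : Nested G X j i := Or.symm h

lemma IsFour.nested (h : IsFour G H k D p) (hm : IsMatched H (desc G p) u v x y)
    (hux : Nested G (up G p) u x) (huy : Nested G (up G p) u y) (hvx : Nested G (up G p) v x)
    (hvy : Nested G (up G p) v y) :
    ∀ i ∈ desc G p, ∀ j ∈ desc G p, Nested G (up G p) i j := by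
  obtain ⟨mu, mv, mx, my⟩ := hm.mem
  have huv : Nested G (up G p) u v := h.nested_of_adj mu mv (h.crit.le hm.adj_uv)
  have hxy : Nested G (up G p) x y := h.nested_of_adj mx my (h.crit.le hm.adj_xy)
  have hr : ∀ i, Nested G (up G p) i i := fun i => Or.inl fun _ _ h => h
  rw [hm.forall_mem]
  simp only [hm.forall_mem]
  exact ⟨⟨hr u, huv, hux, huy⟩, ⟨huv.symm, hr v, hvx, hvy⟩, ⟨hux.symm, hvx.symm, hr x, hxy⟩,
    huy.symm, hvy.symm, hxy.symm, hr y⟩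

lemma IsFour.degIn_compl (h : IsFour G H k D p) {i : V} (hi : i ∈ desc G p) :
    degIn G (desc G p)ᶜ i = #{y ∈ up G p | G.Adj i y} := by
  unfold degIn
  congr 1
  ext w
  simp only [mem_filter, mem_compl]
  exact ⟨fun hw => ⟨h.elim.mem_up_of_adj hi hw.1 hw.2, hw.2⟩, fun hw =>
    ⟨fun hw' => absurd (le_of_mem_desc hw') (not_le.2 (mem_up.1 hw.1).1), hw.2⟩⟩

lemma IsFour.card_up_eq (h : IsFour G H k D p) {i : V} (hi : i ∈ desc G p) :
    #(up G i) = #{y ∈ up G p | G.Adj i y} + #{j ∈ desc G p | i < j ∧ G.Adj i j} := by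
  rw [← card_union_of_disjoint]
  · congr 1
    ext w
    simp only [mem_up, mem_union, mem_filter]
    constructor
    · intro hw
      by_cases hwd : w ∈ desc G p
      · exact Or.inr ⟨hwd, hw⟩
      · exact Or.inl ⟨mem_up.1 (h.elim.mem_up_of_adj hi hwd hw.2), hw.2⟩
    · rintro (hw | hw)
      · exact ⟨(le_of_mem_desc hi).trans_lt hw.1.1, hw.2⟩
      · exact hw.2
  · refine disjoint_left.2 fun w hw hw' => ?_
    rw [mem_filter] at hw hw'
    exact absurd (le_of_mem_desc hw'.1) (not_le.2 (mem_up.1 hw.1).1)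

lemma IsTight.card_filter_add (h : IsTight G H k D p) (hm : IsMatched H (desc G p) u v x y) :
    #{z ∈ up G p | G.Adj u z} + ((if u < v then 1 else 0) +
      ((if u < x ∧ G.Adj u x then 1 else 0) + (if u < y ∧ G.Adj u y then 1 else 0))) = k := by
  rw [← h.card_up u hm.mem.1, h.card_up_eq hm.mem.1]
  congr 1
  rw [card_filter, hm.sum_eq]
  simp [h.crit.le hm.adj_uv]

/-- Tightness fixes the number of later neighbours to be `k`. The parity of the excess then depends
only on `D`, the edges inside and the order. -/
lemma IsTight.excess_eq (h : IsTight G H k D p) (hm : IsMatched H (desc G p) u v x y) :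
    excess G H ((k + D : ℕ) : ℤ) (desc G p) u = D + 1 - 2 * degIn H univ u +
      (if u < v then 1 else 0) + ((if u < x ∧ G.Adj u x then 1 else 0) +
      (if u < y ∧ G.Adj u y then 1 else 0)) - degIn G (desc G p) u := by
  have h1 := h.card_filter_add hm
  have h2 := h.degIn_compl hm.mem.1
  have h3 := degIn_add_compl (G := G) (desc G p) u
  have h4 := hm.degIn_backbone u hm.mem.1
  unfold excess
  rw [h4]
  zify at h1 h2 h3
  push_cast at h1 ⊢
  linarith

/-- Common neighbours of two nonadjacent vertices that are not nested come later. -/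
lemma IsFour.lt_of_not_nested (h : IsFour G H k D p) {w : V} (hu : u ∈ desc G p)
    (hx : x ∈ desc G p) (hw : w ∈ desc G p) (hux : u ≠ x) (hn : ¬ Nested G (up G p) u x)
    (hadj : ¬ G.Adj u x) (huw : G.Adj u w) (hxw : G.Adj x w) : u < w ∧ x < w := by
  rcases lt_or_gt_of_ne huw.ne with h1 | h1 <;> rcases lt_or_gt_of_ne hxw.ne with h2 | h2
  · exact ⟨h1, h2⟩
  · exact (hn (Or.inl fun z hz e => h.adj_of_lt hx h2 hxw.symm z hz
      (h.adj_of_lt hw h1 huw z hz e))).elim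
  · exact (hn (Or.inr fun z hz e => h.adj_of_lt hu h1 huw.symm z hz
      (h.adj_of_lt hw h2 hxw z hz e))).elim
  · exact (hadj (h.elim.adj h1 h2 hux huw.symm hxw.symm)).elim

lemma IsTight.nested_of_paw (h : IsTight G H k D p) (hm : IsMatched H (desc G p) u v x y)
    (hux : ¬ G.Adj u x) (huy : ¬ G.Adj u y) (hvx : G.Adj v x) (hvy : G.Adj v y)
    (hpot : pot G H ((k + D : ℕ) : ℤ) (desc G p) = -0) :
    Nested G (up G p) u x ∧ Nested G (up G p) u y := by
  obtain ⟨mu, mv, mx, my⟩ := hm.mem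
  have huv := h.crit.le hm.adj_uv
  have h' := h.toIsFour
  rcases lt_or_gt_of_ne huv.ne with h1 | h1
  swap
  · have key : ∀ w ∈ desc G p, u ≠ w → ¬ G.Adj u w → G.Adj v w → Nested G (up G p) u w := by
      intro w hw huw hadj hvw
      by_contra hn
      exact absurd (h'.lt_of_not_nested mu hw mv huw hn hadj huv hvw.symm).1 (not_lt.2 h1.le)
    exact ⟨key x mx hm.ne_ux hux hvx, key y my hm.ne_uy huy hvy⟩
  have key : ∀ {x y : V}, IsMatched H (desc G p) u v x y → ¬ G.Adj u x → ¬ G.Adj u y →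
      G.Adj v x → G.Adj v y → x < v → v < y →
      Nested G (up G p) u x ∧ Nested G (up G p) u y := by
    intro x y hm hux huy hvx hvy hxv hvy'
    have e1 := h.card_filter_add hm
    have e2 := h.card_filter_add hm.swap_left
    simp only [hux, huy, hvx, hvy, h1, h1.not_gt, hxv.not_gt, hvy', and_false, and_true, if_true,
      if_false] at e1 e2
    have hsub : {z ∈ up G p | G.Adj u z} ⊆ {z ∈ up G p | G.Adj v z} := fun z hz => by
      rw [mem_filter] at hz ⊢
      exact ⟨hz.1, h'.adj_of_lt mv h1 huv z hz.1 hz.2⟩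
    -- Both `u` and `v` have exactly one later neighbour among the four, hence equally many above,
    -- and the inclusion is an equality.
    have heq := eq_of_subset_of_card_le hsub (by omega)
    refine ⟨Or.inr fun z hz e => ?_, Or.inl fun z hz e => ?_⟩
    · have hz' : z ∈ {z ∈ up G p | G.Adj v z} :=
        mem_filter.2 ⟨hz, h'.adj_of_lt mv hxv hvx.symm z hz e⟩
      rw [← heq, mem_filter] at hz'
      exact hz'.2
    · exact h'.adj_of_lt hm.mem.2.2.2 hvy' hvy z hz (h'.adj_of_lt mv h1 huv z hz e)
  rcases lt_or_gt_of_ne hvx.ne with h2 | h2 <;> rcases lt_or_gt_of_ne hvy.ne with h3 | h3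
  · exact ⟨Or.inl fun z hz e => h'.adj_of_lt mx h2 hvx z hz (h'.adj_of_lt mv h1 huv z hz e),
      Or.inl fun z hz e => h'.adj_of_lt my h3 hvy z hz (h'.adj_of_lt mv h1 huv z hz e)⟩
  · exact (key hm.swap_right huy hux hvy hvx h3 h2).symm
  · exact key hm hux huy hvx hvy h2 h3
  -- Now `v` comes after the three others. Two of the four excesses have the parity of `D` and two
  -- that of `D + 1`, which no stuck set allows.
  exfalso
  have hxy := h.crit.le hm.adj_xy
  have eu := h.excess_eq hm
  have ev := h.excess_eq hm.swap_left
  have ex := h.excess_eq hm.swap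
  have ey := h.excess_eq hm.swap.swap_left
  obtain ⟨du, dv, dx, dy⟩ := hm.degIn_all h.crit.le
  simp only [hux, huy, hvx, hvy, if_true, if_false] at du dv dx dy
  rw [du] at eu
  rw [dv] at ev
  rw [dx] at ex
  rw [dy] at ey
  simp only [G.adj_comm x u, G.adj_comm x v, G.adj_comm y u, G.adj_comm y v, hux, huy, hvx, hvy,
    h1, h1.not_gt, h2, h2.not_gt, h3, h3.not_gt, and_false, and_true, if_true, if_false] at eu ev ex ey
  have hxy' : ((if x < y then 1 else 0 : ℤ) + if y < x then 1 else 0) = 1 := by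
    rcases lt_or_gt_of_ne hxy.ne with e | e <;> simp [e, e.not_gt]
  have hcut := hm.hasCuts h.crit.le (a := false) (b := false) (c := true) (d := true) (by simpa)
    (by simpa) (by simpa) (by simpa) hasCuts_paw
  have hsum := hpot
  unfold pot at hsum
  rw [hm.sum_eq] at hsum
  obtain ⟨J, hJ, hne, hst⟩ := h.crit.exists_stuck h'.nonneg (Q := desc G p) ⟨u, mu⟩
  have hp1 : 0 ≤ (if x < y then 1 else 0 : ℤ) := by positivity
  have hp2 : 0 ≤ (if y < x then 1 else 0 : ℤ) := by positivity
  by_cases hJQ : J = desc G p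
  · subst hJQ
    have hu := hst u mu
    have hv := hst v mv
    have hx := hst x mx
    have hy := hst y my
    omega
  obtain ⟨⟨f1, f2⟩, -⟩ := h.crit.excess_eq_of_hasCuts h'.nonneg hcut hpot hJ hne hJQ hst
  obtain ⟨u1, u2⟩ := hm.eq_of_stuck h.crit.le hJ f1 f2
  obtain ⟨v1, v2⟩ := hm.swap_left.eq_of_stuck h.crit.le hJ f1 f2
  obtain ⟨x1, x2⟩ := hm.swap.eq_of_stuck h.crit.le hJ f1 f2
  obtain ⟨y1, y2⟩ := hm.swap.swap_left.eq_of_stuck h.crit.le hJ f1 f2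
  simp only [G.adj_comm x u, G.adj_comm x v, G.adj_comm y u, G.adj_comm y v, hux, huy, hvx, hvy,
    and_false, and_true, if_false] at u1 v1 x1 y1
  clear hpot hcut f1 f2 hst h2 h3 h1 key
  by_cases ju : u ∈ J <;> by_cases jv : v ∈ J <;> by_cases jx : x ∈ J <;> by_cases jy : y ∈ J <;>
    simp only [ju, jv, jx, jy, if_true, if_false, not_true_eq_false, not_false_eq_true,
      forall_true_left, false_implies] at u1 u2 v1 v2 x1 x2 y1 y2 <;> omega

end Gains

end Backbone

namespace Backbone

/-! ### The diamond without nested neighbourhoods -/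

section Diamond

variable {V : Type*} [LinearOrder V] [Fintype V] {G H : SimpleGraph V} [DecidableRel G.Adj]
  [DecidableRel H.Adj] {k D : ℕ} {p u v x y : V}

/-- The lists of four vertices that are stuck in a diamond. -/
lemma IsTight.le_card_resid (h : IsTight G H k D p) (hm : IsMatched H (desc G p) u v x y)
    (hux : ¬ G.Adj u x) (huy : G.Adj u y) (hvx : G.Adj v x) (hvy : G.Adj v y)
    (hpot : pot G H ((k + D : ℕ) : ℤ) (desc G p) = -1) (hD : D = 10) (huv : u < v) (hxv : x < v)
    (hvy' : v < y) (φ : V → ℤ) :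
    2 ≤ #(resid G H ((k + D : ℕ) : ℤ) (desc G p) φ u) ∧
    5 ≤ #(resid G H ((k + D : ℕ) : ℤ) (desc G p) φ v) ∧
    4 ≤ #(resid G H ((k + D : ℕ) : ℤ) (desc G p) φ x) ∧
    2 ≤ #(resid G H ((k + D : ℕ) : ℤ) (desc G p) φ y) := by
  obtain ⟨mu, mv, mx, my⟩ := hm.mem
  have h' := h.toIsFour
  have eu := h.excess_eq hm
  have ev := h.excess_eq hm.swap_left
  have ex := h.excess_eq hm.swap
  have ey := h.excess_eq hm.swap.swap_left
  have hcard := fun j => card_resid (G := G) (H := H) h'.nonneg (desc G p) φ j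
  have hu := hcard u
  have hv := hcard v
  have hx := hcard x
  have hy := hcard y
  rw [hm.degIn_backbone _ mu] at hu
  rw [hm.degIn_backbone _ mv] at hv
  rw [hm.degIn_backbone _ mx] at hx
  rw [hm.degIn_backbone _ my] at hy
  obtain ⟨du, dv, dx, dy⟩ := hm.degIn_all h.crit.le
  simp only [hux, huy, hvx, hvy, if_true, if_false] at du dv dx dy
  rw [du] at eu hu
  rw [dv] at ev hv
  rw [dx] at ex hx
  rw [dy] at ey hy
  have huy' := huv.trans hvy'
  have hxy' := hxv.trans hvy'
  simp only [G.adj_comm x u, G.adj_comm x v, G.adj_comm y u, G.adj_comm y v, hux, huy, hvx, hvy,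
    huv, huv.not_gt, hxv, hxv.not_gt, hvy', hvy'.not_gt, huy', huy'.not_gt, hxy', hxy'.not_gt,
    and_false, and_true, if_true, if_false] at eu ev ex ey
  have hcut := hm.hasCuts h.crit.le (a := false) (b := true) (c := true) (d := true) (by simpa)
    (by simpa) (by simpa) (by simpa) hasCuts_diamond
  have hsum := hpot
  unfold pot at hsum
  rw [hm.sum_eq] at hsum
  obtain ⟨J, hJ, hne, hst⟩ := h.crit.exists_stuck h'.nonneg (Q := desc G p) ⟨u, mu⟩
  -- Three excesses are odd, so they cannot all be nonpositive with sum `-1`. A proper stuck set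
  -- determines the excesses; `J = {u, y}`, for instance, gives `-1, 1, 1, -2` at `u, v, x, y`.
  by_cases hJQ : J = desc G p
  · subst hJQ
    have hu := hst u mu
    have hv := hst v mv
    have hx := hst x mx
    have hy := hst y my
    omega
  obtain ⟨⟨f1, f2⟩, -⟩ := h.crit.excess_eq_of_hasCuts h'.nonneg hcut hpot hJ hne hJQ hst
  obtain ⟨u1, u2⟩ := hm.eq_of_stuck h.crit.le hJ f1 f2
  obtain ⟨v1, v2⟩ := hm.swap_left.eq_of_stuck h.crit.le hJ f1 f2
  obtain ⟨x1, x2⟩ := hm.swap.eq_of_stuck h.crit.le hJ f1 f2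
  obtain ⟨y1, y2⟩ := hm.swap.swap_left.eq_of_stuck h.crit.le hJ f1 f2
  simp only [G.adj_comm x u, G.adj_comm x v, G.adj_comm y u, G.adj_comm y v, hux, huy, hvx, hvy,
    and_false, and_true, if_false] at u1 v1 x1 y1
  clear hpot hcut f1 f2 hst hcard
  by_cases ju : u ∈ J <;> by_cases jv : v ∈ J <;> by_cases jx : x ∈ J <;> by_cases jy : y ∈ J <;>
    simp only [ju, jv, jx, jy, if_true, if_false, not_true_eq_false, not_false_eq_true,
      forall_true_left, false_implies] at u1 u2 v1 v2 x1 x2 y1 y2 <;> omega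

/-- Four colours for a diamond whose lists at `x` and `y` have no consecutive colours. -/
lemma IsMatched.exists_isListCol_of_far {Q : Finset V} (hm : IsMatched H Q u v x y)
    (hux : ¬ G.Adj u x) {L : V → Finset ℤ} (hu : 2 ≤ #(L u)) (hv : 5 ≤ #(L v))
    (hx : 4 ≤ #(L x)) (hy : 2 ≤ #(L y))
    (hfar : ∀ c ∈ L x, ∀ d ∈ L y, c ≠ d + 1 ∧ d ≠ c + 1) : ∃ φ, IsListCol G H Q L φ := by
  obtain ⟨d, hd⟩ := card_pos.1 (show 0 < #(L y) by omega)
  have h1 := le_card_sdiff {d} (L u)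
  rw [card_singleton] at h1
  obtain ⟨a, ha⟩ := card_pos.1 (show 0 < #(L u \ {d}) by omega)
  have h2 := le_card_sdiff {d, a, a - 1, a + 1} (L v)
  have h2' : #({d, a, a - 1, a + 1} : Finset ℤ) ≤ 4 := card_le_four
  obtain ⟨b, hb⟩ := card_pos.1 (show 0 < #(L v \ {d, a, a - 1, a + 1}) by omega)
  have h3 := le_card_sdiff {d, b} (L x)
  have h3' : #({d, b} : Finset ℤ) ≤ 2 := card_le_two
  obtain ⟨c, hc⟩ := card_pos.1 (show 0 < #(L x \ {d, b}) by omega)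
  simp only [mem_sdiff, mem_insert, mem_singleton, not_or] at ha hb hc
  have h4 := hfar c hc.1 d hd
  refine hm.exists_isListCol (G := G) ha.1 hb.1 hc.1 hd ?_ ?_ (fun e => absurd e hux)
    (fun _ => ha.2) (fun _ => fun e => hc.2.2 e.symm) (fun _ => hb.2.1)
  · rw [le_abs]
    omega
  · rw [le_abs]
    omega

/-- Here `u` and `x` precede `v`, and `y = p` sees all of `up G p`. Above, `u` misses one neighbour
`b` of `v`, and `x` misses one, `a`. Without gain only `a` and `b` can carry consecutive colours, so
at most half of the colours are used above; this forces `D = 10`, and the four vertices can be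
coloured directly. -/
lemma IsTight.exists_gain_of_diamond_of_lt (h : IsTight G H k D p)
    (hm : IsMatched H (desc G p) u v x y)
    (hux : ¬ G.Adj u x) (huy : G.Adj u y) (hvx : G.Adj v x) (hvy : G.Adj v y)
    (hpot : pot G H ((k + D : ℕ) : ℤ) (desc G p) = -1) (hn : ¬ Nested G (up G p) u x)
    (hvy' : v < y) (φ : V → ℤ)
    (hφ : IsListCol G H (desc G p)ᶜ (fun _ => Ico 0 ((k + D : ℕ) : ℤ)) φ) :
    ∃ i ∈ desc G p, Gain G H ((k + D : ℕ) : ℤ) (desc G p) φ i := by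
  by_contra! hcon
  obtain ⟨mu, mv, mx, my⟩ := hm.mem
  have h' := h.toIsFour
  have huv := h.crit.le hm.adj_uv
  have hxy := h.crit.le hm.adj_xy
  obtain ⟨luv, lxv⟩ := h'.lt_of_not_nested mu mx mv hm.ne_ux hn hux huv hvx.symm
  have luy := luv.trans hvy'
  have lxy := lxv.trans hvy'
  have hyp : y = p := by
    refine le_antisymm (le_of_mem_desc my) ?_
    have hle : ∀ i ∈ desc G p, i ≤ y := hm.forall_mem.2 ⟨luy.le, hvy'.le, lxy.le, le_rfl⟩
    exact hle p (self_mem_desc p)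
  have hUuv := h'.adj_of_lt mv luv huv
  have hUxv := h'.adj_of_lt mv lxv hvx.symm
  have hUy : ∀ z ∈ up G p, G.Adj y z := fun z hz => by
    rw [hyp]
    exact (mem_up.1 hz).2
  have hout : ∀ z ∈ up G p, z ∉ desc G p := fun y hy hy' =>
    absurd (le_of_mem_desc hy') (not_le.2 (mem_up.1 hy).1)
  have cu := h.card_filter_add hm
  have cv := h.card_filter_add hm.swap_left
  have cx := h.card_filter_add hm.swap
  simp only [G.adj_comm x u, G.adj_comm x v, hux, huy, hvx, hvy, luv, luv.not_gt, luy, lxv,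
    lxv.not_gt, lxy, hvy', and_false, and_true, if_true, if_false] at cu cv cx
  have huniq : ∀ w, (∀ z ∈ up G p, G.Adj w z → G.Adj v z) →
      #{z ∈ up G p | G.Adj w z} + 1 = #{z ∈ up G p | G.Adj v z} →
      ∀ z ∈ up G p, ∀ z' ∈ up G p, G.Adj v z → G.Adj v z' → ¬ G.Adj w z → ¬ G.Adj w z' →
      z = z' := by
    intro w hw hc z hz z' hz' h1 h2 h3 h4
    by_contra hne
    have hsub : insert z {z ∈ up G p | G.Adj w z} ⊆ {z ∈ up G p | G.Adj v z}.erase z' := by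
      intro t ht
      rw [mem_insert, mem_filter] at ht
      rw [mem_erase, mem_filter]
      rcases ht with rfl | ht
      · exact ⟨hne, hz, h1⟩
      · exact ⟨fun e => h4 (e ▸ ht.2), ht.1, hw t ht.1 ht.2⟩
    have hle := card_le_card hsub
    rw [card_insert_of_notMem (by simp [h3]), card_erase_of_mem (mem_filter.2 ⟨hz', h2⟩)] at hle
    have hpos : 0 < #{z ∈ up G p | G.Adj v z} := card_pos.2 ⟨z, mem_filter.2 ⟨hz, h1⟩⟩
    have hle' : #{z ∈ up G p | G.Adj w z} + 1 ≤ #{z ∈ up G p | G.Adj v z} - 1 := hle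
    rw [← hc] at hle'
    omega
  have huniq_u := huniq u hUuv (by omega)
  have huniq_x := huniq x hUxv (by omega)
  unfold Nested at hn
  push Not at hn
  obtain ⟨⟨a, ha, hua, hxa⟩, b, hb, hxb, hub⟩ := hn
  have hva := hUuv a ha hua
  have hvb := hUxv b hb hxb
  obtain ⟨g1, g2⟩ := h.of_not_gain hcon
  have hpair : ∀ s ∈ up G p, ∀ t ∈ up G p, φ t = φ s + 1 →
      (H.Adj u a ∧ H.Adj x b) ∧ ((s = a ∧ t = b) ∨ (s = b ∧ t = a)) := by
    intro s hs t ht hst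
    obtain ⟨i, hi, his⟩ := h.cover s hs
    obtain ⟨j, hj, hjt⟩ := h.cover t ht
    obtain ⟨n1, n2⟩ := g2 s hs t ht hst i hi j hj his hjt
    have gis := h.crit.le his
    have gjt := h.crit.le hjt
    have hi' : i = u ∨ i = v ∨ i = x ∨ i = y := by simpa [hm.eq] using hi
    have hj' : j = u ∨ j = v ∨ j = x ∨ j = y := by simpa [hm.eq] using hj
    rcases hi' with rfl | rfl | rfl | rfl <;> rcases hj' with rfl | rfl | rfl | rfl
    · exact absurd gjt n1
    · exact absurd (hUuv s hs gis) n2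
    · have e1 := huniq_x s hs a ha (hUuv s hs gis) hva n2 hxa
      have e2 := huniq_u t ht b hb (hUxv t ht gjt) hvb n1 hub
      subst e1 e2
      exact ⟨⟨his, hjt⟩, Or.inl ⟨rfl, rfl⟩⟩
    · exact absurd (hUy s hs) n2
    · exact absurd (hUuv t ht gjt) n1
    · exact absurd gjt n1
    · exact absurd (hUxv t ht gjt) n1
    · exact absurd (hUy s hs) n2
    · have e1 := huniq_u s hs b hb (hUxv s hs gis) hvb n2 hub
      have e2 := huniq_x t ht a ha (hUuv t ht gjt) hva n1 hxa
      subst e1 e2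
      exact ⟨⟨hjt, his⟩, Or.inr ⟨rfl, rfl⟩⟩
    · exact absurd (hUxv s hs gis) n2
    · exact absurd gjt n1
    · exact absurd (hUy s hs) n2
    · exact absurd (hUy t ht) n1
    · exact absurd (hUy t ht) n1
    · exact absurd (hUy t ht) n1
    · exact absurd gjt n1
  obtain ⟨hC1, hC2⟩ := h.card_image hφ
  have h0 : (0 : ℤ) ∉ (up G p).image φ := fun e => by
    obtain ⟨z, hz, e⟩ := mem_image.1 e
    exact (g1 z hz).1 e
  have hM1 : ((k + D : ℕ) : ℤ) - 1 ∉ (up G p).image φ := fun e => by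
    obtain ⟨z, hz, e⟩ := mem_image.1 e
    exact (g1 z hz).2 e
  have hDk := h'.le
  have hD10 := h'.ten_le
  have hkD := h.eq
  have hcons : ∀ c ∈ (up G p).image φ, c + 1 ∈ (up G p).image φ →
      (H.Adj u a ∧ H.Adj x b) ∧ ((φ a = c ∧ φ b = c + 1) ∨ (φ b = c ∧ φ a = c + 1)) := by
    intro c hc hc'
    obtain ⟨s, hs, rfl⟩ := mem_image.1 hc
    obtain ⟨t, ht, e⟩ := mem_image.1 hc'
    obtain ⟨h1, ⟨rfl, rfl⟩ | ⟨rfl, rfl⟩⟩ := hpair s hs t ht e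
    · exact ⟨h1, Or.inl ⟨rfl, e⟩⟩
    · exact ⟨h1, Or.inr ⟨rfl, e⟩⟩
  obtain ⟨c₀, hc₀, hc₀'⟩ := exists_consecutive hC2 (by rw [hC1]; push_cast; omega)
    (card_pos.1 (by omega)) h0 hM1
  obtain ⟨⟨hua', hxb'⟩, hab⟩ := hcons c₀ hc₀ hc₀'
  have huniq₀ : ∀ c ∈ (up G p).image φ, c + 1 ∈ (up G p).image φ → c = c₀ := by
    intro c hc hc'
    have := (hcons c hc hc').2
    omega
  -- For `D > 10` the clique uses more than half of the colours, and a second consecutive pair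
  -- appears.
  have hD : D = 10 := by
    by_contra hne
    obtain ⟨c, hc, hc', hcne⟩ := exists_second_consecutive (c₀ := c₀) hC2
      (by rw [hC1]; push_cast; omega) (by push_cast; omega) h0 hM1
    exact hcne (huniq₀ c hc hc')
  have hmem := mem_or_mem_of_consecutive hC2 (by rw [hC1]; push_cast; omega) h0 hM1 huniq₀
  obtain ⟨r1, r2, r3, r4⟩ := h.le_card_resid hm hux huy hvx hvy hpot hD luv lxv hvy' φ
  -- Colours of `y` are unused above, and no two consecutive colours are unused. A used colour left
  -- at `x` belongs to `a`, but is then forbidden by `b`, or to a vertex whose backbone neighbour is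
  -- `y`.
  obtain ⟨ψ, hψ⟩ := hm.exists_isListCol_of_far (G := G) hux r1 r2 r3 r4 (by
    intro c hc d hd
    obtain ⟨c1, c2⟩ := of_mem_resid hc
    obtain ⟨d1, d2⟩ := of_mem_resid hd
    rw [mem_Ico] at c1 d1
    have hdC : d ∉ (up G p).image φ := fun e => by
      obtain ⟨z, hz, e⟩ := mem_image.1 e
      exact (d2 z (hout z hz)).1 (hUy z hz) e.symm
    have hcC : c ∈ (up G p).image φ → c ≠ d + 1 ∧ d ≠ c + 1 := by
      intro hcC
      obtain ⟨z, hz, rfl⟩ := mem_image.1 hcC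
      have hxz : ¬ G.Adj x z := fun e => (c2 z (hout z hz)).1 e rfl
      by_cases hvz : G.Adj v z
      · have e := huniq_x z hz a ha hvz hva hxz hxa
        subst e
        have := (c2 b (hout b hb)).2 hxb'
        omega
      · obtain ⟨i, hi, hiz⟩ := h.cover z hz
        have giz := h.crit.le hiz
        have hi' : i = u ∨ i = v ∨ i = x ∨ i = y := by simpa [hm.eq] using hi
        rcases hi' with rfl | rfl | rfl | rfl
        · exact absurd (hUuv z hz giz) hvz
        · exact absurd giz hvz
        · exact absurd giz hxz
        · have := (d2 z (hout z hz)).2 hiz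
          omega
    by_cases hcC' : c ∈ (up G p).image φ
    · exact hcC hcC'
    · constructor
      · rintro rfl
        rcases hmem (d + 1) (by omega) (by omega) with e | e
        · exact hcC' e
        · rw [add_sub_cancel_right] at e
          exact hdC e
      · rintro rfl
        rcases hmem (c + 1) (by omega) (by omega) with e | e
        · exact hdC e
        · rw [add_sub_cancel_right] at e
          exact hcC' e)
  exact h.crit.not_colorable (colorable_of_resid h.crit.le hφ hψ)

lemma IsTight.exists_gain_of_diamond (h : IsTight G H k D p)
    (hm : IsMatched H (desc G p) u v x y)
    (hux : ¬ G.Adj u x) (huy : G.Adj u y) (hvx : G.Adj v x) (hvy : G.Adj v y)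
    (hpot : pot G H ((k + D : ℕ) : ℤ) (desc G p) = -1) (φ : V → ℤ)
    (hφ : IsListCol G H (desc G p)ᶜ (fun _ => Ico 0 ((k + D : ℕ) : ℤ)) φ) :
    ∃ i ∈ desc G p, Gain G H ((k + D : ℕ) : ℤ) (desc G p) φ i := by
  obtain ⟨mu, mv, mx, my⟩ := hm.mem
  by_cases hn : Nested G (up G p) u x
  · exact h.exists_gain (h.nested hm hn (h.nested_of_adj mu my huy) (h.nested_of_adj mv mx hvx)
      (h.nested_of_adj mv my hvy)) φ hφ
  rcases lt_or_gt_of_ne hvy.ne with h1 | h1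
  · exact h.exists_gain_of_diamond_of_lt hm hux huy hvx hvy hpot hn h1 φ hφ
  · exact h.exists_gain_of_diamond_of_lt hm.swap (fun e => hux e.symm) hvx.symm huy.symm hvy.symm
      hpot (fun e => hn e.symm) h1 φ hφ

lemma IsTight.exists_gain_of_paw (h : IsTight G H k D p)
    (hm : IsMatched H (desc G p) u v x y)
    (hux : ¬ G.Adj u x) (huy : ¬ G.Adj u y) (hvx : G.Adj v x) (hvy : G.Adj v y)
    (hpot : pot G H ((k + D : ℕ) : ℤ) (desc G p) = -0) (φ : V → ℤ)
    (hφ : IsListCol G H (desc G p)ᶜ (fun _ => Ico 0 ((k + D : ℕ) : ℤ)) φ) :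
    ∃ i ∈ desc G p, Gain G H ((k + D : ℕ) : ℤ) (desc G p) φ i := by
  obtain ⟨mu, mv, mx, my⟩ := hm.mem
  obtain ⟨h1, h2⟩ := h.nested_of_paw hm hux huy hvx hvy hpot
  exact h.exists_gain (h.nested hm h1 h2 (h.nested_of_adj mv mx hvx)
    (h.nested_of_adj mv my hvy)) φ hφ

end Diamond

/-! ### Excluding four descendants -/

section Main

variable {V : Type*} [LinearOrder V] [Fintype V] {G H : SimpleGraph V} [DecidableRel G.Adj]
  [DecidableRel H.Adj] {k D : ℕ} {p u v x y : V}

/-- There are no induced cycles of length four. -/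
lemma IsElim.adj_or_adj (hG : IsElim G k) {a b c d : V} (hac : a ≠ c) (hbd : b ≠ d)
    (hab : G.Adj a b) (hbc : G.Adj b c) (hcd : G.Adj c d) (hda : G.Adj d a) :
    G.Adj a c ∨ G.Adj b d := by
  by_cases h1 : b < a ∧ b < c
  · exact Or.inl (hG.adj h1.1 h1.2 hac hab.symm hbc)
  by_cases h2 : d < a ∧ d < c
  · exact Or.inl (hG.adj h2.1 h2.2 hac hda hcd.symm)
  right
  have e1 := hab.ne
  have e2 := hbc.ne
  have e3 := hcd.ne
  have e4 := hda.ne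
  by_cases h3 : a < b ∧ a < d
  · exact hG.adj h3.1 h3.2 hbd hab hda.symm
  · refine hG.adj (a := c) ?_ ?_ hbd hbc.symm hcd
    all_goals grind

/-- At least two edges of `G` join the matching edges, and two disjoint ones alone would be an
induced 4-cycle. The rest is complete, diamond or paw up to symmetry. -/
lemma IsFour.false (h : IsFour G H k D p) : False := by
  obtain ⟨u, v, x, y, hm⟩ := h.exists_isMatched
  have hin := hm.inSum_eq h.crit.le
  have hp := (h.matched_pot hm).1
  have hpot := h.crit.pot_nonpos h.nonneg (S := desc G p) ⟨p, self_mem_desc p⟩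
  have huv := h.crit.le hm.adj_uv
  have hxy := h.crit.le hm.adj_xy
  have hcyc : G.Adj u y → G.Adj v x → G.Adj u x ∨ G.Adj v y := fun huy hvx =>
    h.elim.adj_or_adj hm.ne_ux hm.ne_vy huv hvx hxy huy.symm
  have hcyc' : G.Adj u x → G.Adj v y → G.Adj u y ∨ G.Adj v x := fun hux hvy =>
    h.elim.adj_or_adj hm.ne_uy hm.ne_vx huv hvy hxy.symm hux.symm
  have diamond : ∀ {u v x y : V}, IsMatched H (desc G p) u v x y → ¬ G.Adj u x → G.Adj u y →
      G.Adj v x → G.Adj v y → False := fun hm hux huy hvx hvy =>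
    h.false_of_diamond hm hux huy hvx hvy fun ht hpot =>
      ht.exists_gain_of_diamond hm hux huy hvx hvy hpot
  have paw : ∀ {u v x y : V}, IsMatched H (desc G p) u v x y → ¬ G.Adj u x → ¬ G.Adj u y →
      G.Adj v x → G.Adj v y → False := fun hm hux huy hvx hvy =>
    h.false_of_paw hm hux huy hvx hvy fun ht hpot =>
      ht.exists_gain_of_paw hm hux huy hvx hvy hpot
  by_cases hux : G.Adj u x <;> by_cases huy : G.Adj u y <;> by_cases hvx : G.Adj v x <;>
    by_cases hvy : G.Adj v y <;> simp only [hux, huy, hvx, hvy, if_true, if_false] at hin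
  · exact h.false_of_complete hm hux huy hvx hvy
  · exact diamond hm.swap_left.swap_right hvy hvx huy hux
  · exact diamond hm.swap_left hvx hvy hux huy
  · exact paw hm.swap_left hvx hvy hux huy
  · exact diamond hm.swap_right huy hux hvy hvx
  · exact paw hm.swap.swap_left (fun e => huy e.symm) (fun e => hvy e.symm) hux.symm hvx.symm
  · rcases hcyc' hux hvy with e | e
    · exact huy e
    · exact hvx e
  · omega
  · exact diamond hm hux huy hvx hvy
  · rcases hcyc huy hvx with e | e
    · exact hux e
    · exact hvy e
  · exact paw hm.swap (fun e => hux e.symm) (fun e => hvx e.symm) huy.symm hvy.symm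
  · omega
  · exact paw hm hux huy hvx hvy
  · omega
  · omega
  · omega

end Main

theorem IsElim.colorable_of_atMostOneCommon {V : Type*} [LinearOrder V] [Fintype V]
    {G H : SimpleGraph V} [DecidableRel G.Adj] [DecidableRel H.Adj] {k : ℕ} (hG : IsElim G k)
    (hHG : H ≤ G) (hH : AtMostOneCommon H) (hk : 10 ≤ k) :
    Colorable G H (k + ((k + 11) / 2 : ℕ)) univ := by
  by_contra hcon
  obtain ⟨S, hS⟩ := exists_isCritical hHG hcon
  have hcom : AtMostOneCommon (H.comap (Subtype.val : S → V)) := by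
    intro u v x y huv h1 h2 h3 h4
    exact Subtype.ext (hH (fun e => huv (Subtype.ext e)) h1 h2 h3 h4)
  have hS' : IsCritical (G.comap (Subtype.val : S → V)) (H.comap (Subtype.val : S → V))
      ((k + (k + 11) / 2 : ℕ) : ℤ) := by
    push_cast
    exact_mod_cast hS
  obtain ⟨p, hp⟩ := (hG.comap S).exists_card_desc_eq_four hk (D := (k + 11) / 2) (by omega)
    (by omega) hS' hcom
  exact (IsFour.mk (hG.comap S) hS' hcom (by omega) (by omega) (by omega) hp).false

end Backbone

namespace Backbone

/-! ### Translation to the original statement -/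

section Main

variable {V : Type*}

lemma backboneChromaticNumber_le [Fintype V] {G G' : SimpleGraph V} {H : G.Subgraph} (hG : G ≤ G')
    {M : ℕ} (h : Colorable G' H.spanningCoe M univ) : G.backboneChromaticNumber H 2 ≤ M := by
  obtain ⟨c, hc⟩ := h
  have hmem : ∀ v, 0 ≤ c v ∧ c v < M := fun v => mem_Ico.1 (hc.mem v (mem_univ v))
  have hval : ∀ v, ((c v).toNat : ℤ) = c v := fun v => Int.toNat_of_nonneg (hmem v).1
  refine Nat.sInf_le ⟨SimpleGraph.Coloring.mk
    (fun v => ⟨(c v).toNat, by have := hval v; have := (hmem v).2; omega⟩) ?_, ?_⟩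
  · intro u v huv e
    have e' := congrArg (fun z : Fin M => ((z : ℕ) : ℤ)) e
    simp only [hval] at e'
    exact hc.ne u (mem_univ u) v (mem_univ v) (hG huv) e'
  · intro u v huv
    have := hc.dist u (mem_univ u) v (mem_univ v) (by simpa using huv)
    change ((2 : ℕ) : ℤ) ≤ |((c u).toNat : ℤ) - ((c v).toNat : ℤ)|
    rwa [hval, hval]

lemma backboneChromaticNumber_eq_zero [IsEmpty V] (G : SimpleGraph V) (H : G.Subgraph) :
    G.backboneChromaticNumber H 2 = 0 := by
  have : Fintype V := Fintype.ofIsEmpty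
  have h : Colorable G H.spanningCoe (0 : ℕ) univ :=
    ⟨0, fun v => isEmptyElim v, fun v => isEmptyElim v, fun v => isEmptyElim v⟩
  exact Nat.le_zero.1 (backboneChromaticNumber_le le_rfl h)

lemma sum_degIn_le_maximumAverageDegree [Fintype V] [DecidableEq V] {G : SimpleGraph V}
    (H : G.Subgraph) [DecidableRel H.spanningCoe.Adj] (S : Finset V) :
    (∑ i ∈ S, degIn H.spanningCoe S i : ℝ) ≤ H.maximumAverageDegree * #S := by
  classical
  let K : G.Subgraph := H.induce (S ∩ H.verts)
  have hK : K ≤ H := SimpleGraph.Subgraph.induce_mono_right (Set.inter_subset_right) |>.trans_eq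
    SimpleGraph.Subgraph.induce_self_verts
  have hadj : ∀ u v, K.Adj u v ↔ u ∈ S ∧ v ∈ S ∧ H.Adj u v := by
    intro u v
    simp only [K, SimpleGraph.Subgraph.induce_adj, Set.mem_inter_iff, mem_coe]
    constructor
    · tauto
    · rintro ⟨h1, h2, h3⟩
      exact ⟨⟨h1, h3.fst_mem⟩, ⟨h2, h3.snd_mem⟩, h3⟩
  have hsum : ∑ i ∈ S, degIn H.spanningCoe S i = 2 * K.edgeSet.ncard := by
    have h1 := K.spanningCoe.sum_degrees_eq_twice_card_edges
    rw [← Set.ncard_coe_finset, SimpleGraph.coe_edgeFinset,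
      SimpleGraph.Subgraph.edgeSet_spanningCoe] at h1
    rw [← h1, ← sum_subset (subset_univ S)]
    · refine sum_congr rfl fun i hi => ?_
      rw [← SimpleGraph.card_neighborFinset_eq_degree]
      unfold degIn
      congr 1
      ext w
      simp [hadj, hi]
    · intro i _ hi
      rw [← SimpleGraph.card_neighborFinset_eq_degree, card_eq_zero]
      ext w
      simp [hadj, hi]
  have hbdd : BddAbove (Set.range fun K : {K : G.Subgraph // K ≤ H} => K.1.averageDegree) :=
    (Set.finite_range _).bddAbove
  have hle : K.averageDegree ≤ H.maximumAverageDegree := le_ciSup hbdd ⟨K, hK⟩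
  have hverts : K.verts.ncard ≤ #S := by
    rw [← Set.ncard_coe_finset]
    exact Set.ncard_le_ncard Set.inter_subset_left
  have h0 : 0 ≤ K.averageDegree := by
    unfold SimpleGraph.Subgraph.averageDegree
    positivity
  have hsum' : (∑ i ∈ S, degIn H.spanningCoe S i : ℝ) = 2 * (K.edgeSet.ncard : ℝ) := by
    exact_mod_cast hsum
  have hmul : 2 * (K.edgeSet.ncard : ℝ) ≤ K.averageDegree * K.verts.ncard := by
    unfold SimpleGraph.Subgraph.averageDegree
    rcases Nat.eq_zero_or_pos K.verts.ncard with h | h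
    · have he : K.edgeSet = ∅ := by
        rw [Set.eq_empty_iff_forall_notMem]
        intro e
        induction e with
        | _ u v =>
          intro huv
          rw [SimpleGraph.Subgraph.mem_edgeSet] at huv
          have : 0 < K.verts.ncard := (Set.ncard_pos (Set.toFinite _)).2 ⟨u, huv.fst_mem⟩
          omega
      simp [he]
    · have : (K.verts.ncard : ℝ) ≠ 0 := by positivity
      rw [div_mul_cancel₀ _ this]
  calc (∑ i ∈ S, degIn H.spanningCoe S i : ℝ) ≤ K.averageDegree * K.verts.ncard :=
        hsum'.trans_le hmul
    _ ≤ H.maximumAverageDegree * #S := by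
        have : (K.verts.ncard : ℝ) ≤ #S := by exact_mod_cast hverts
        exact mul_le_mul hle this (by positivity) (h0.trans hle)

lemma atMostOneCommon_of_free {G : SimpleGraph V} {H : G.Subgraph}
    (h : (SimpleGraph.cycleGraph 4).Free H.coe) : AtMostOneCommon H.spanningCoe := by
  intro u v x y huv hux hvx huy hvy
  simp only [SimpleGraph.Subgraph.spanningCoe_adj] at hux hvx huy hvy
  by_contra hxy
  -- Two common neighbours `x`, `y` of `u`, `v` give the 4-cycle `u x v y`.
  let f : Fin 4 → H.verts := ![⟨u, hux.fst_mem⟩, ⟨x, hux.snd_mem⟩, ⟨v, hvx.fst_mem⟩,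
    ⟨y, huy.snd_mem⟩]
  refine h ⟨⟨⟨f, ?_⟩, ?_⟩⟩
  · intro a b hab
    rw [SimpleGraph.Subgraph.coe_adj]
    fin_cases a <;> fin_cases b <;>
      first
      | (exfalso; revert hab; decide)
      | simp [f, hux, hvx, huy, hvy, hux.symm, hvx.symm, huy.symm, hvy.symm]
  · intro a b hab
    have h1 := hux.ne
    have h2 := hvx.ne
    have h3 := huy.ne
    have h4 := hvy.ne
    fin_cases a <;> fin_cases b <;>
      simp_all [f, eq_comm]

end Main

end Backbone

theorem corollary5 :
    (∃ C : ℝ, ∀ (V : Type*) [Finite V] (G : SimpleGraph V) (H : G.Subgraph),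
      (H.edgeSet.Nonempty →
        (G.backboneChromaticNumber H 2 : ℝ) ≤
          (G.treewidth : ℝ) + C * Real.sqrt (H.maximumAverageDegree * (G.treewidth : ℝ))) ∧
      (H.edgeSet = ∅ →
        (G.backboneChromaticNumber H 2 : ℝ) ≤ (G.treewidth : ℝ) + 1)) ∧
    (∀ (V : Type*) [Finite V] (G : SimpleGraph V) (H : G.Subgraph),
      (SimpleGraph.cycleGraph 4).Free H.coe →
        (G.backboneChromaticNumber H 2 : ℝ) ≤ 3 / 2 * (G.treewidth : ℝ) + 11 / 2) := by
  classical
  -- Twelve from the sparse bound, and one for rounding up, since the root is at least `1`.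
  refine ⟨⟨13, fun V _ G H => ⟨fun hE => ?_, fun hE => ?_⟩⟩, fun V _ G H hC4 => ?_⟩
  · have := Fintype.ofFinite V
    obtain ⟨e, he⟩ := hE
    induction e with
    | _ u v =>
    rw [SimpleGraph.Subgraph.mem_edgeSet] at he
    have htw := Backbone.one_le_treewidth he.adj_sub
    obtain ⟨k, hk⟩ := Int.eq_ofNat_of_zero_le (zero_le_one.trans htw)
    rw [hk] at htw
    obtain ⟨_, G', _, hGG', hG'⟩ := Backbone.exists_isElim G hk
    have hHG' : H.spanningCoe ≤ G' := H.spanningCoe_le.trans hGG'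
    have hd := Backbone.sum_degIn_le_maximumAverageDegree H
    set d := H.maximumAverageDegree
    have hd1 : 1 ≤ d := by
      have h1 := hd {u, v}
      rw [Finset.sum_pair he.ne, Finset.card_pair he.ne] at h1
      have h2 : 1 ≤ Backbone.degIn H.spanningCoe {u, v} u := Finset.card_pos.2 ⟨v, by simp [he]⟩
      have h3 : 1 ≤ Backbone.degIn H.spanningCoe {u, v} v :=
        Finset.card_pos.2 ⟨u, by simp [he.symm]⟩
      have h2' : (1 : ℝ) ≤ Backbone.degIn H.spanningCoe {u, v} u := by exact_mod_cast h2
      have h3' : (1 : ℝ) ≤ Backbone.degIn H.spanningCoe {u, v} v := by exact_mod_cast h3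
      push_cast at h1
      linarith
    have hk1 : 1 ≤ k := by exact_mod_cast htw
    have hk1' : (1 : ℝ) ≤ k := by exact_mod_cast hk1
    have hs : 1 ≤ Real.sqrt (d * k) := by
      rw [Real.one_le_sqrt]
      nlinarith
    have hcol := hG'.colorable_of_sparse (M := (⌈k + 12 * Real.sqrt (d * k)⌉₊ : ℕ)) hHG' hk1 hd1 hd
      (by exact_mod_cast Nat.le_ceil _)
    have h1 := Backbone.backboneChromaticNumber_le hGG' hcol
    have h2 : (⌈k + 12 * Real.sqrt (d * k)⌉₊ : ℝ) < k + 12 * Real.sqrt (d * k) + 1 :=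
      Nat.ceil_lt_add_one (by positivity)
    have h3 : (G.backboneChromaticNumber H 2 : ℝ) ≤ (⌈k + 12 * Real.sqrt (d * k)⌉₊ : ℝ) := by
      exact_mod_cast h1
    rw [hk]
    push_cast
    linarith
  · rcases isEmpty_or_nonempty V with hV | hV
    · rw [Backbone.backboneChromaticNumber_eq_zero]
      have : (-1 : ℝ) ≤ G.treewidth := by exact_mod_cast Backbone.neg_one_le_treewidth G
      push_cast
      linarith
    · have := Fintype.ofFinite V
      obtain ⟨k, hk⟩ := Int.eq_ofNat_of_zero_le (Backbone.treewidth_nonneg G)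
      obtain ⟨_, G', _, hGG', hG'⟩ := Backbone.exists_isElim G hk
      have hbot : ∀ u v, ¬ H.spanningCoe.Adj u v := by
        intro u v huv
        have : s(u, v) ∈ H.edgeSet := by simpa using huv
        rw [hE] at this
        exact this
      have h1 := Backbone.backboneChromaticNumber_le (M := k + 1) hGG'
        (hG'.colorable_of_bot hbot (by push_cast; exact le_rfl))
      rw [hk]
      exact_mod_cast h1
  · rcases isEmpty_or_nonempty V with hV | hV
    · rw [Backbone.backboneChromaticNumber_eq_zero]
      have : (-1 : ℝ) ≤ G.treewidth := by exact_mod_cast Backbone.neg_one_le_treewidth G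
      push_cast
      linarith
    · have := Fintype.ofFinite V
      obtain ⟨k, hk⟩ := Int.eq_ofNat_of_zero_le (Backbone.treewidth_nonneg G)
      obtain ⟨_, G', _, hGG', hG'⟩ := Backbone.exists_isElim G hk
      have hHG' : H.spanningCoe ≤ G' := H.spanningCoe_le.trans hGG'
      have h2 : 2 * G.backboneChromaticNumber H 2 ≤ 3 * k + 11 := by
        -- For `k ≤ 9` the bound `2 * k + 1` is good enough; `k ≥ 10` ensures `10 ≤ D ≤ k` above.
        rcases lt_or_ge k 10 with hk10 | hk10
        · have h1 := Backbone.backboneChromaticNumber_le (M := 2 * k + 1) hGG'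
            (hG'.colorable_of_two_mul hHG' (by push_cast; exact le_rfl))
          omega
        · have h1 := Backbone.backboneChromaticNumber_le (M := k + (k + 11) / 2) hGG'
            (by
              have := hG'.colorable_of_atMostOneCommon hHG'
                (Backbone.atMostOneCommon_of_free hC4) hk10
              exact_mod_cast this)
          omega
      have h3 : 2 * (G.backboneChromaticNumber H 2 : ℝ) ≤ 3 * k + 11 := by exact_mod_cast h2
      rw [hk]
      push_cast
      linarith
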